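/- **Setting.** Let $d$ be a dimension and let $\hat k:\mathbb R^d\to\mathbb R$ satisfy $0\le\hat k\le1$ and $\hat k\in L^1(\mathbb R^d)$. Put $H=L^2(\mathbb R^d)$ with complexification $H_{\mathbb C}$ (scalar products are antilinear in the first argument), and let $\mathcal F_{\mathrm a}(H\oplus H)=\bigoplus_{n\ge0}(H_{\mathbb C}\oplus H_{\mathbb C})^{\wedge n}$ be the antisymmetric Fock space. Let $\mathcal F_{\mathrm{a,fin}}(H\oplus H)$ be its subspace of vectors with finitely many nonzero components, with the topology of the topological direct sum (convergence of sequences is uniform finiteness and coordinatewise convergence). Let $\mathcal F_{\mathrm{a,fin}}(\Phi)\subset\mathcal F_{\mathrm{a,fin}}(H\oplus H)$ be the space of finite sequences of antisymmetric $n$-particle wave functions of Schwartz class ($\Phi=S_{\mathbb C}(\mathbb R^d)\oplus S_{\mathbb C}(\mathbb R^d)$). On $n$-particle vectors let $$a(u)\,h_1\wedge\dots\wedge h_n=\tfrac1{\sqrt n}\sum_{i=1}^n(-1)^{i+1}(u,h_i)\,h_1\wedge\dots\check h_i\dots\wedge h_n,\qquad a^*(u)\,h_1\wedge\dots\wedge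 h_n=\sqrt{n+1}\;u\wedge h_1\wedge\dots\wedge h_n,$$ and write $a_1(u)=a(u,0)$, $a_2(u)=a(0,u)$, and similarly $a_1^*,a_2^*$; for a tempered distribution $u$ the operator $a^*(u)$ is understood as the dual of $a(u)$. Let $\mathcal F$ be the unitary Fourier transform $\mathcal Ff(\lambda)=(2\pi)^{-d/2}\int e^{-ix\cdot\lambda}f(x)\,dx$ and put $$\varkappa_1=(2\pi)^{-d/2}\mathcal F^{-1}\hat k^{1/2}\in L^2_{\mathbb C}(\mathbb R^d),\quad \varkappa_2=(2\pi)^{-d/2}\mathcal F^{-1}(1-\hat k)^{1/2}\in S'_{\mathbb C}(\mathbb R^d),\quad \langle\varkappa_{i,x},h\rangle=\langle\varkappa_i,h(x+\cdot)\rangle,$$ $$\psi(x)=a_2(\varkappa_{2,x})+a_1^*(\overline{\varkappa_{1,x}}),\qquad \psi^*(x)=a_2^*(\varkappa_{2,x})+a_1(\overline{\varkappa_{1,x}}),\qquad \rho_{\mathrm a}(x)=\psi^*(x)\psi(x),\qquad x\in\mathbb R^d.$$ For a real weight $w$ and an operator field $A(x)$, the operator $\int w(x)A(x)\,dx$ is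 the continuous linear operator $T$ on $\mathcal F_{\mathrm{a,fin}}(H\oplus H)$ with $(TG_1,G_2)=\int w(x)\langle A(x)G_1,G_2\rangle\,dx$ (absolutely convergent) for all $G_1,G_2\in\mathcal F_{\mathrm{a,fin}}(\Phi)$. Put $\rho_{\mathrm a}(f)=\int f(x)\rho_{\mathrm a}(x)\,dx$ for real-valued $f\in S(\mathbb R^d)$. The operators $:\!\rho_{\mathrm a}(x_1)\cdots\rho_{\mathrm a}(x_n)\!:$ are defined, after integration with test functions, by $:\!\rho_{\mathrm a}(x)\!:\,=\rho_{\mathrm a}(x)$ and $$:\!\rho_{\mathrm a}(x_{n+1})\cdots\rho_{\mathrm a}(x_1)\!:\;=\Big(\rho_{\mathrm a}(x_{n+1})\,:\!\rho_{\mathrm a}(x_1)\cdots\rho_{\mathrm a}(x_n)\!:\;-\sum_{i=1}^n\delta(x_{n+1}-x_i)\,:\!\rho_{\mathrm a}(x_1)\cdots\rho_{\mathrm a}(x_n)\!:\Big)^{\sim},$$ where $(\cdot)^\sim$ is symmetrization in $x_1,\dots,x_{n+1}$. That is, writing $W_n(f_1,\dots,f_n)$ for the operator smeared with $f_1\otimes\dots\otimes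 f_n$, one has $W_1(f)=\rho_{\mathrm a}(f)$ and $$W_{n+1}(f_1,\dots,f_{n+1})=\frac1{(n+1)!}\sum_{\sigma\in S_{n+1}}\Big(\rho_{\mathrm a}(f_{\sigma(n+1)})\,W_n(f_{\sigma(1)},\dots,f_{\sigma(n)})-\sum_{i=1}^nW_n(f_{\sigma(1)},\dots,f_{\sigma(i)}f_{\sigma(n+1)},\dots,f_{\sigma(n)})\Big).$$ **Proposition.** For each $f\in S(\mathbb R^d)$ the operator $\rho_{\mathrm a}(f)$ exists and is unique. For each $n\ge1$ and all real-valued $f_1,\dots,f_n\in S(\mathbb R^d)$, the integral on the right-hand side below is a well-defined (existing and unique) continuous linear operator on $\mathcal F_{\mathrm{a,fin}}(H\oplus H)$, and on $\mathcal F_{\mathrm{a,fin}}(H\oplus H)$ $$\int_{(\mathbb R^d)^n}dx_1\cdots dx_n\,f_1(x_1)\cdots f_n(x_n)\,:\!\rho_{\mathrm a}(x_1)\cdots\rho_{\mathrm a}(x_n)\!:\;=\int_{(\mathbb R^d)^n}dx_1\cdots dx_n\,f_1(x_1)\cdots f_n(x_n)\,\psi^*(x_n)\cdots\psi^*(x_1)\psi(x_1)\cdots\psi(x_n),$$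 where the left-hand side denotes $W_n(f_1,\dots,f_n)$. -/

import Mathlib

open MeasureTheory Filter Topology
open scoped FourierTransform SchwartzMap ComplexConjugate ENNReal

noncomputable section

namespace FermiGas

/-! ### One-particle space and antisymmetric Fock space -/

/-- The space `ℝ^d` with the Euclidean norm. -/
abbrev E (d : ℕ) : Type := EuclideanSpace ℝ (Fin d)

/-- Two labelled copies of `ℝ^d`; the label `0` is the first copy and the label `1` the second one.
With `H = L²(ℝ^d)`, the complexification of `H ⊕ H` is `L²(X d → ℂ)`. -/
abbrev X (d : ℕ) : Type := Fin 2 × E d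

/-- Lebesgue measure on both copies. -/
def μX (d : ℕ) : Measure (X d) := (Measure.count : Measure (Fin 2)).prod volume

instance (d : ℕ) : SigmaFinite (μX d) := by unfold μX; infer_instance

/-- The product measure on `(X d)^n`. -/
def μ (d n : ℕ) : Measure (Fin n → X d) := Measure.pi fun _ => μX d

/-- Permuting the `n` arguments preserves the product measure. -/
theorem measurePreserving_perm (d n : ℕ) (σ : Equiv.Perm (Fin n)) :
    MeasurePreserving (fun y : Fin n → X d => y ∘ σ) (μ d n) (μ d n) := by
  have h := measurePreserving_piCongrLeft (α := fun _ : Fin n => X d) (fun _ => μX d) σ.symm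
  have he : (fun y : Fin n → X d => y ∘ σ)
      = MeasurableEquiv.piCongrLeft (fun _ : Fin n => X d) σ.symm := by
    funext y i
    have := Equiv.piCongrLeft_apply_apply (fun _ : Fin n => X d) σ.symm y (σ i)
    rw [Equiv.symm_apply_apply] at this
    rw [MeasurableEquiv.coe_piCongrLeft, this]
    rfl
  rw [he]
  exact h

/-- The `n`-particle space `(H ⊕ H)^{∧n}`, realized as the space of antisymmetric functions in
`L²((X d)^n → ℂ)`.  Here `h₁ ∧ ⋯ ∧ hₙ` is the orthogonal projection of `h₁ ⊗ ⋯ ⊗ hₙ`, so that the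
norm is the one inherited from `L²((X d)^n)`. -/
def NParticle (d n : ℕ) : Submodule ℂ (Lp ℂ 2 (μ d n)) where
  carrier := {F | ∀ σ : Equiv.Perm (Fin n), ∀ᵐ y ∂(μ d n),
    F (y ∘ σ) = ((Equiv.Perm.sign σ : ℤ) : ℂ) * F y}
  add_mem' := by
    intro F G hF hG σ
    have h := (measurePreserving_perm d n σ).quasiMeasurePreserving.ae (Lp.coeFn_add F G)
    filter_upwards [hF σ, hG σ, Lp.coeFn_add F G, h] with y h1 h2 h3 h4
    rw [h4, h3, Pi.add_apply, Pi.add_apply, h1, h2, mul_add]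
  zero_mem' := by
    intro σ
    have h := (measurePreserving_perm d n σ).quasiMeasurePreserving.ae
      (Lp.coeFn_zero (E := ℂ) (p := 2) (μ := μ d n))
    filter_upwards [Lp.coeFn_zero (E := ℂ) (p := 2) (μ := μ d n), h] with y h1 h2
    rw [h1, h2, Pi.zero_apply, Pi.zero_apply, mul_zero]
  smul_mem' := by
    intro c F hF σ
    have h := (measurePreserving_perm d n σ).quasiMeasurePreserving.ae (Lp.coeFn_smul c F)
    filter_upwards [hF σ, Lp.coeFn_smul c F, h] with y h1 h2 h3
    rw [h3, h2, Pi.smul_apply, Pi.smul_apply, h1, smul_eq_mul, smul_eq_mul]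
    ring

/-- The antisymmetric Fock space over `H ⊕ H`: the Hilbert direct sum of the `n`-particle
spaces. -/
abbrev Fock (d : ℕ) : Type := lp (fun n => NParticle d n) 2

/-- The finite-particle space: all vectors of the Fock space with only finitely many nonzero
components. -/
def FockFin (d : ℕ) : Submodule ℂ (Fock d) where
  carrier := {F | ∃ N : ℕ, ∀ n, N ≤ n → F n = 0}
  add_mem' := by
    rintro F G ⟨M, hM⟩ ⟨N, hN⟩
    refine ⟨max M N, fun n hn => ?_⟩
    rw [lp.coeFn_add, Pi.add_apply, hM n (le_of_max_le_left hn), hN n (le_of_max_le_right hn),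
      add_zero]
  zero_mem' := ⟨0, fun n _ => rfl⟩
  smul_mem' := by
    rintro c F ⟨N, hN⟩
    exact ⟨N, fun n hn => by rw [lp.coeFn_smul, Pi.smul_apply, hN n hn, smul_zero]⟩

/-- Convergence of sequences in the finite-particle space, which carries the topology of the
topological direct sum: uniform finiteness and coordinatewise convergence. -/
def FinTendsto {d : ℕ} (u : ℕ → FockFin d) (v : FockFin d) : Prop :=
  (∃ N : ℕ, ∀ j n, N ≤ n → (u j : Fock d) n = 0) ∧
    ∀ n, Tendsto (fun j => (u j : Fock d) n) atTop (𝓝 ((v : Fock d) n))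

/-- Continuity of a linear operator on the finite-particle space with the topology of the
topological direct sum. -/
def FinContinuous {d : ℕ} (T : FockFin d →ₗ[ℂ] FockFin d) : Prop :=
  ∀ (u : ℕ → FockFin d) (v : FockFin d), FinTendsto u v → FinTendsto (fun j => T (u j)) (T v)

/-! ### Wave functions, test vectors and generalized vectors -/

/-- Sequences of (everywhere defined) `n`-particle wave functions.  The operators at a fixed point
act on such sequences; only sequences obtained from test vectors matter below. -/
abbrev Wave (d : ℕ) : Type := (n : ℕ) → (Fin n → X d) → ℂ

/-- Generalized vectors, given by their pairing (linear in the wave function) with wave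
functions. -/
abbrev GenVec (d : ℕ) : Type := Wave d → ℂ

/-- The test vectors `𝓕_fin(Φ)`, `Φ = S_ℂ(ℝ^d) ⊕ S_ℂ(ℝ^d)`: finite sequences of antisymmetric
wave functions which are Schwartz functions on `(ℝ^d)^n` for each choice of the labels. -/
def IsTest {d : ℕ} (g : Wave d) : Prop :=
  (∃ N : ℕ, ∀ n, N ≤ n → g n = 0) ∧
  ∀ n, (∀ s : Fin n → Fin 2, ∃ φ : 𝓢(Fin n → E d, ℂ), ∀ y, g n (fun i => (s i, y i)) = φ y) ∧
    ∀ (σ : Equiv.Perm (Fin n)) (y : Fin n → X d),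
      g n (y ∘ σ) = ((Equiv.Perm.sign σ : ℤ) : ℂ) * g n y

/-- The wave functions `g` represent the vector `G` of the finite-particle space. -/
def Represents {d : ℕ} (g : Wave d) (G : FockFin d) : Prop :=
  ∀ n, (((G : Fock d) n : Lp ℂ 2 (μ d n)) : (Fin n → X d) → ℂ) =ᵐ[μ d n] g n

/-- A (square-integrable) vector as a generalized vector, through the scalar product of the Fock
space, which is antilinear in the first argument. -/
def toGenVec {d : ℕ} (v : Wave d) : GenVec d := fun g =>
  ∑' n, ∫ y, conj (v n y) * g n y ∂(μ d n)

/-- The annihilation operator `a(u)` of a generalized one-particle vector `u`, which is given by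
its pairing `T h = (u, h)` with one-particle functions. On `h₁ ∧ ⋯ ∧ hₙ` this is
`n^{-1/2} ∑ᵢ (-1)^{i+1} (u, hᵢ) h₁ ∧ ⋯ ȟᵢ ⋯ ∧ hₙ`. -/
def annihilation {d : ℕ} (T : (X d → ℂ) → ℂ) (g : Wave d) : Wave d := fun n y =>
  (Real.sqrt (n + 1) : ℂ) * T (fun z => g (n + 1) (Fin.cons z y))

/-- The creation operator `a*(u)` of a function `u`, that is, `√(n+1) u ∧ ·` on antisymmetric
`n`-particle functions. -/
def creation {d : ℕ} (u : X d → ℂ) (g : Wave d) : Wave d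
  | 0 => fun _ => 0
  | n + 1 => fun y => (Real.sqrt (n + 1) : ℂ)⁻¹ *
      ∑ i : Fin (n + 1), (-1 : ℂ) ^ (i : ℕ) * u (y i) * g n (i.removeNth y)

/-- The creation operator `a*(u)` of a generalized one-particle vector, on generalized vectors:
the dual of `a(u)`. -/
def creationGen {d : ℕ} (T : (X d → ℂ) → ℂ) (L : GenVec d) : GenVec d :=
  fun g => L (annihilation T g)

/-- The annihilation operator `a(u)` on generalized vectors: the dual of `a*(u)`. -/
def annihilationGen {d : ℕ} (u : X d → ℂ) (L : GenVec d) : GenVec d :=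
  fun g => L (creation u g)

/-! ### Operator-valued integrals -/

/-- `T = ∫ w(x) A(x) dx` as a continuous operator on the finite-particle space, where `A` is an
operator field which maps test vectors to generalized vectors:
`⟨T G₁, G₂⟩ = ∫ w(x) ⟨A(x) G₁, G₂⟩ dx` for all test vectors, the integral being absolutely
convergent. -/
def IsWeakIntegral {d : ℕ} {ι : Type} [MeasureSpace ι] (w : ι → ℝ) (A : ι → Wave d → GenVec d)
    (T : FockFin d →ₗ[ℂ] FockFin d) : Prop :=
  FinContinuous T ∧
  ∀ (g₁ g₂ : Wave d) (G₁ G₂ : FockFin d), IsTest g₁ → IsTest g₂ →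
    Represents g₁ G₁ → Represents g₂ G₂ →
    Integrable (fun x => (w x : ℂ) * A x g₁ g₂) ∧
      inner ℂ (T G₁) G₂ = ∫ x, (w x : ℂ) * A x g₁ g₂

open Classical in
/-- The operator `∫ w(x) A(x) dx` on the finite-particle space (zero if it does not exist). -/
def weakIntegral {d : ℕ} {ι : Type} [MeasureSpace ι] (w : ι → ℝ) (A : ι → Wave d → GenVec d) :
    FockFin d →ₗ[ℂ] FockFin d :=
  if h : ∃ T, IsWeakIntegral w A T then h.choose else 0

/-! ### The free Fermi gas -/

/-- The density distribution `k̂` in momentum space: `0 ≤ k̂ ≤ 1` and `k̂ ∈ L¹(ℝ^d)`. -/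
structure MomentumDensity (d : ℕ) where
  toFun : E d → ℝ
  nonneg : ∀ p, 0 ≤ toFun p
  le_one : ∀ p, toFun p ≤ 1
  integrable : Integrable toFun

namespace MomentumDensity

variable {d : ℕ} (k : MomentumDensity d)

/-- The function `k̂^{1/2}` in the frequency variable `ξ`, where the momentum is `2πξ`. -/
def sqrtDensity (ξ : E d) : ℂ := (Real.sqrt (k.toFun ((2 * Real.pi) • ξ)) : ℂ)

/-- The function `(1 - k̂)^{1/2}` in the frequency variable `ξ`, where the momentum is `2πξ`. -/
def sqrtCoDensity (ξ : E d) : ℂ := (Real.sqrt (1 - k.toFun ((2 * Real.pi) • ξ)) : ℂ)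

theorem memLp_sqrtDensity : MemLp k.sqrtDensity 2 (volume : Measure (E d)) := by
  have hi : Integrable (fun ξ : E d => k.toFun ((2 * Real.pi) • ξ)) :=
    k.integrable.comp_smul (by positivity)
  have hm : AEStronglyMeasurable k.sqrtDensity (volume : Measure (E d)) :=
    (Complex.continuous_ofReal.comp Real.continuous_sqrt).comp_aestronglyMeasurable
      hi.aestronglyMeasurable
  refine (memLp_two_iff_integrable_sq_norm hm).2 (hi.congr (Eventually.of_forall fun ξ => ?_))
  simp only [sqrtDensity, Complex.norm_real, Real.norm_eq_abs, sq_abs]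
  rw [Real.sq_sqrt (k.nonneg _)]

/-- The function `κ₁ ∈ L²(ℝ^d)`, formally
`κ₁(x) = (2π)^{-d} ∫ exp(i p · x) k̂(p)^{1/2} dp = ∫ exp(2πi ξ · x) k̂(2πξ)^{1/2} dξ`;
the last integral is the inverse Fourier transform in the normalization used here. -/
def kappa1 : E d → ℂ :=
  ((𝓕⁻ (k.memLp_sqrtDensity.toLp k.sqrtDensity) : Lp ℂ 2 (volume : Measure (E d))) : E d → ℂ)

/-- The pairing `⟨κ₂, h⟩` of the tempered distribution `κ₂` with a Schwartz function `h`, where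
formally `κ₂(x) = (2π)^{-d} ∫ exp(i p · x) (1 - k̂(p))^{1/2} dp`. The pairing extends the scalar
product of `L²(ℝ^d)` and is antilinear in `κ₂`. -/
def kappa2 (h : E d → ℂ) : ℂ := ∫ ξ, k.sqrtCoDensity ξ * 𝓕 h ξ

/-- The element `(κ̄_{1,x}, 0)` of `H ⊕ H`, with `κ_{1,x}(z) = κ₁(z - x)`. -/
def vec1 (x : E d) : X d → ℂ := fun z => if z.1 = 0 then conj (k.kappa1 (z.2 - x)) else 0

/-- The pairing with the generalized vector `(0, κ_{2,x})`, with
`⟨κ_{2,x}, h⟩ = ⟨κ₂, h(x + ·)⟩`. -/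
def vec2 (x : E d) : (X d → ℂ) → ℂ := fun h => k.kappa2 fun z => h (1, x + z)

/-- The field `ψ(x) = a₂(κ_{2,x}) + a₁*(κ̄_{1,x})`. -/
def psi (x : E d) (g : Wave d) : Wave d :=
  annihilation (k.vec2 x) g + creation (k.vec1 x) g

/-- The field `ψ*(x) = a₂*(κ_{2,x}) + a₁(κ̄_{1,x})`. -/
def psiStar (x : E d) (L : GenVec d) : GenVec d :=
  creationGen (k.vec2 x) L + annihilationGen (k.vec1 x) L

/-- The product `ψ(x₁) ⋯ ψ(xₙ)`. -/
def psiProd : (n : ℕ) → (Fin n → E d) → Wave d → Wave d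
  | 0, _, g => g
  | n + 1, x, g => k.psi (x 0) (psiProd n (Fin.tail x) g)

/-- The product `ψ*(xₙ) ⋯ ψ*(x₁)`. -/
def psiStarProd : (n : ℕ) → (Fin n → E d) → GenVec d → GenVec d
  | 0, _, L => L
  | n + 1, x, L => psiStarProd n (Fin.tail x) (k.psiStar (x 0) L)

/-- The normal-ordered product `ψ*(xₙ) ⋯ ψ*(x₁) ψ(x₁) ⋯ ψ(xₙ)`. -/
def normalOrdered (n : ℕ) (x : Fin n → E d) (g : Wave d) : GenVec d :=
  k.psiStarProd n x (toGenVec (k.psiProd n x g))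

/-- The particle density `ρ(x) = ψ*(x) ψ(x)` at a point. -/
def rhoAt (x : E d) (g : Wave d) : GenVec d := k.psiStar x (toGenVec (k.psi x g))

/-- The smeared particle density `ρ(f) = ∫ f(x) ρ(x) dx`. -/
def rho (f : 𝓢(E d, ℝ)) : FockFin d →ₗ[ℂ] FockFin d := weakIntegral (fun x => f x) k.rhoAt

/-- The smeared operators `∫ f₁(x₁) ⋯ fₙ(xₙ) :ρ(x₁) ⋯ ρ(xₙ): dx₁ ⋯ dxₙ`, defined by
`:ρ(x): = ρ(x)` and the recursion
`:ρ(xₙ₊₁) ⋯ ρ(x₁): = (ρ(xₙ₊₁) :ρ(x₁) ⋯ ρ(xₙ): - ∑ᵢ δ(xₙ₊₁ - xᵢ) :ρ(x₁) ⋯ ρ(xₙ):)^~`,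
where `~` is the symmetrization in `x₁, …, xₙ₊₁`.  After integration against
`f₁ ⊗ ⋯ ⊗ fₙ₊₁`, the delta function replaces `fᵢ` by `fᵢ fₙ₊₁`, and the symmetrization is the mean
over all permutations of the test functions.  (The recursion starts at one test function; the
value for none is the identity by convention.) -/
def wick : (n : ℕ) → (Fin n → 𝓢(E d, ℝ)) → (FockFin d →ₗ[ℂ] FockFin d)
  | 0, _ => LinearMap.id
  | 1, f => k.rho (f 0)
  | n + 2, f => ((Nat.factorial (n + 2) : ℂ))⁻¹ • ∑ σ : Equiv.Perm (Fin (n + 2)),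
      (k.rho (f (σ (Fin.last (n + 1)))) ∘ₗ wick (n + 1) (fun j => f (σ j.castSucc))
        - ∑ i : Fin (n + 1), wick (n + 1)
            (Function.update (fun j => f (σ j.castSucc)) i
              (SchwartzMap.smulLeftCLM ℝ (f (σ (Fin.last (n + 1)))) (f (σ i.castSucc)))))

end MomentumDensity

end FermiGas

end

/-!
The field `ψ(x)` at a point is not an operator on the Fock space: `κ₂` is only a tempered
distribution. Smeared with the conjugate of `u ∈ L²(ℝ^d)` it is one, namely
`b u = a₂(K₂ u) + a₁*(conj (K₁ u))`, where `K₁` and `K₂` are the Fourier multipliers `k̂^{1/2}` and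
`(1 - k̂)^{1/2}`. The adjoint of `b u` is `c u`, the field `ψ*` smeared with `u`. As the squares of
the two multipliers add up to one, `b` and `c` satisfy the canonical anticommutation relations of
`L²(ℝ^d)`: `b u c v + c v b u = ⟨u, v⟩` (`b_c`), and all other anticommutators vanish.

The integral `∫ f(x) ψ*(x) R ψ(x) dx` is made discrete. A test function is a product `f = p q` of
two bounded square-integrable weights, and `x ↦ p(x) ψ(x) G` is square-integrable with values in
the Fock space: the annihilation part because `K₂` is a contraction and `p` is bounded, the
creation part because `κ₁` and `p` are square-integrable. Its coefficient along a basis vector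
`e_j` of `L²(ℝ^d)` is `b (p e_j) G` (`isField_psi`). By Parseval the integral therefore equals
`∑ⱼ c (q e_j) R b (p e_j)` as a form, which defines the operator `dress f R`
(`integral_inner_comp_psi`). The same square-summability shows that the series converges strongly
and that `dress f R` is bounded on vectors with a bounded number of particles if `R` is
(`exists_sandwich`). Fubini's theorem and induction on the number of fields give
`∫ f₁(x₁) ⋯ fₙ(xₙ) ψ*(xₙ) ⋯ ψ*(x₁) ψ(x₁) ⋯ ψ(xₙ) dx = dress f₁ (⋯ (dress fₙ 1))`
(`integral_psiVec`, `isWeakIntegral_normalOrdered`); the right-hand side is `densProd [f₁, …, fₙ]`.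

The identity is then algebra. Since the `b` anticommute among themselves, the operations
`dress f` commute, and `densProd` is symmetric in the test functions (`densProd_perm`). The
relation between `b` and `c` gives
`ρ(h) densProd [f₁, …, fₙ] = densProd [h, f₁, …, fₙ] + ∑ᵢ densProd [f₁, …, h fᵢ, …, fₙ]`
(`dens_comp_densProd`): the density is moved past each `c`, and the contraction is the discrete
form of `δ(x - xᵢ)`. This is the recursion of the Wick products in which every permutation
contributes the same operator (`wick_eq_densProd`).

Two points concern the pointwise objects. Products `ψ(x₁) ⋯ ψ(xₙ)` applied to test vectors have
to make sense although `κ₁` is not a Schwartz function. They stay in the space `Nice` spanned by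
products of creation operators applied to test waves: the annihilation part anticommutes with the
creation part and maps test waves to test waves, as a partial Fourier functional with a bounded
symbol maps Schwartz functions to Schwartz functions (`exists_schwartz_integral_fourier_slice`).
Uniqueness of the operators follows from the density of the test vectors
(`exists_isTest_tendsto`).
-/

noncomputable section

namespace FermiGas

variable {d : ℕ}

/-- The scalar product of the finite-particle space, made available directly so that instance
search does not find it through the theory of `C⋆`-modules. -/
instance instInnerFockFin (d : ℕ) : Inner ℂ (FockFin d) :=
  (Submodule.innerProductSpace (FockFin d)).toInner

/-! ### Wave functions representing finite-particle vectors -/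

/-- The sign of a permutation as a complex number. -/
abbrev sgn {n : ℕ} (σ : Equiv.Perm (Fin n)) : ℂ := ((Equiv.Perm.sign σ : ℤ) : ℂ)

theorem sgn_mul {n : ℕ} (σ τ : Equiv.Perm (Fin n)) : sgn (σ * τ) = sgn σ * sgn τ := by
  simp [sgn]

theorem sgn_mul_self {n : ℕ} (σ : Equiv.Perm (Fin n)) : sgn σ * sgn σ = 1 := by
  rcases Int.units_eq_one_or (Equiv.Perm.sign σ) with h | h <;> simp [sgn, h]

theorem norm_sgn {n : ℕ} (σ : Equiv.Perm (Fin n)) : ‖sgn σ‖ = 1 := by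
  rcases Int.units_eq_one_or (Equiv.Perm.sign σ) with h | h <;> simp [sgn, h]

/-- Sequences of everywhere antisymmetric, strongly measurable, square-integrable wave functions
with finitely many nonzero members. -/
structure IsL2Wave (g : Wave d) : Prop where
  fin : ∃ N : ℕ, ∀ n, N ≤ n → g n = 0
  meas : ∀ n, StronglyMeasurable (g n)
  memLp : ∀ n, MemLp (g n) 2 (μ d n)
  anti : ∀ n (σ : Equiv.Perm (Fin n)) (y : Fin n → X d), g n (y ∘ σ) = sgn σ * g n y

theorem toLp_eq_zero_of_eq_zero {α : Type*} [MeasurableSpace α] {m : Measure α} {f : α → ℂ}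
    (hf : MemLp f 2 m) (h : f = 0) : hf.toLp f = 0 := by
  subst h; rfl

instance (d n : ℕ) : SigmaFinite (μ d n) := by unfold μ; infer_instance

namespace IsL2Wave

theorem add {g h : Wave d} (hg : IsL2Wave g) (hh : IsL2Wave h) : IsL2Wave (g + h) where
  fin := by
    obtain ⟨M, hM⟩ := hg.fin
    obtain ⟨N, hN⟩ := hh.fin
    refine ⟨max M N, fun n hn => ?_⟩
    rw [Pi.add_apply, hM n (le_of_max_le_left hn), hN n (le_of_max_le_right hn), add_zero]
  meas n := (hg.meas n).add (hh.meas n)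
  memLp n := (hg.memLp n).add (hh.memLp n)
  anti n σ y := by
    simp only [Pi.add_apply, hg.anti n σ y, hh.anti n σ y, mul_add]

theorem smul {g : Wave d} (hg : IsL2Wave g) (c : ℂ) : IsL2Wave (c • g) where
  fin := by
    obtain ⟨M, hM⟩ := hg.fin
    exact ⟨M, fun n hn => by rw [Pi.smul_apply, hM n hn, smul_zero]⟩
  meas n := (hg.meas n).const_smul c
  memLp n := (hg.memLp n).const_smul c
  anti n σ y := by
    simp only [Pi.smul_apply, hg.anti n σ y, smul_eq_mul]; ring

/-- The vector of the finite-particle space given by a wave function. -/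
def vec {g : Wave d} (hg : IsL2Wave g) : FockFin d :=
  ⟨⟨fun n => ⟨(hg.memLp n).toLp (g n), fun σ => by
      have h1 := (hg.memLp n).coeFn_toLp
      have h2 := (measurePreserving_perm d n σ).quasiMeasurePreserving.ae h1
      filter_upwards [h1, h2] with y hy1 hy2
      rw [hy2, hy1, hg.anti n σ y]⟩, by
      obtain ⟨N, hN⟩ := hg.fin
      refine memℓp_gen (summable_of_ne_finset_zero (s := Finset.range N) fun n hn => ?_)
      have hz : g n = 0 := hN n (by simpa using hn)
      have : (hg.memLp n).toLp (g n) = 0 := toLp_eq_zero_of_eq_zero _ hz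
      simp [this]⟩, by
      obtain ⟨N, hN⟩ := hg.fin
      refine ⟨N, fun n hn => ?_⟩
      ext1
      exact toLp_eq_zero_of_eq_zero (hg.memLp n) (hN n hn)⟩

theorem represents_vec {g : Wave d} (hg : IsL2Wave g) : Represents g hg.vec :=
  fun n => (hg.memLp n).coeFn_toLp

end IsL2Wave

namespace Represents

theorem ext {g : Wave d} {G K : FockFin d} (h1 : Represents g G) (h2 : Represents g K) : G = K := by
  ext n : 3
  exact Subtype.ext (Lp.ext ((h1 n).trans (h2 n).symm))

theorem eq_vec {g : Wave d} {G : FockFin d} (h : Represents g G) (hg : IsL2Wave g) :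
    G = hg.vec := h.ext hg.represents_vec

theorem congr {g g' : Wave d} {G : FockFin d} (h1 : Represents g G)
    (h : ∀ n, g n =ᵐ[μ d n] g' n) : Represents g' G := fun n => (h1 n).trans (h n)

theorem ae_eq {g g' : Wave d} {G : FockFin d} (h1 : Represents g G) (h2 : Represents g' G) (n : ℕ) :
    g n =ᵐ[μ d n] g' n := (h1 n).symm.trans (h2 n)

theorem add {g h : Wave d} {G K : FockFin d} (h1 : Represents g G) (h2 : Represents h K) :
    Represents (g + h) (G + K) := fun n => by
  have h3 := Lp.coeFn_add ((G : Fock d) n : Lp ℂ 2 (μ d n)) ((K : Fock d) n : Lp ℂ 2 (μ d n))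
  exact h3.trans ((h1 n).add (h2 n))

theorem smul {g : Wave d} {G : FockFin d} (h1 : Represents g G) (c : ℂ) :
    Represents (c • g) (c • G) := fun n => by
  have h3 := Lp.coeFn_smul c ((G : Fock d) n : Lp ℂ 2 (μ d n))
  exact h3.trans ((h1 n).const_smul c)

theorem inner_apply {g h : Wave d} {G K : FockFin d} (h1 : Represents g G) (h2 : Represents h K)
    (n : ℕ) : inner ℂ ((G : Fock d) n) ((K : Fock d) n) = ∫ y, conj (g n y) * h n y ∂(μ d n) := by
  rw [Submodule.coe_inner, L2.inner_def]
  refine integral_congr_ae ?_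
  filter_upwards [h1 n, h2 n] with y hy1 hy2
  rw [hy1, hy2, RCLike.inner_apply, mul_comm]

theorem inner_eq {g h : Wave d} {G K : FockFin d} (h1 : Represents g G) (h2 : Represents h K) :
    inner ℂ G K = toGenVec g h := by
  rw [Submodule.coe_inner, lp.inner_eq_tsum]
  exact tsum_congr fun n => h1.inner_apply h2 n

end Represents

/-- Vectors with fewer than `N` particles. -/
def Below (N : ℕ) (G : FockFin d) : Prop := ∀ n, N ≤ n → (G : Fock d) n = 0

theorem exists_below (G : FockFin d) : ∃ N, Below N G := G.2

/-- Every vector is represented by an everywhere antisymmetric wave function: antisymmetrize any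
representative. -/
theorem Below.exists_isL2Wave {N : ℕ} {G : FockFin d} (hN : Below N G) :
    ∃ g : Wave d, IsL2Wave g ∧ Represents g G ∧ ∀ n, N ≤ n → g n = 0 := by
  classical
  let F : (n : ℕ) → (Fin n → X d) → ℂ := fun n => ((G : Fock d) n : Lp ℂ 2 (μ d n))
  let g : Wave d := fun n => if N ≤ n then 0 else fun y =>
    ((Nat.factorial n : ℂ))⁻¹ * ∑ σ : Equiv.Perm (Fin n), sgn σ * F n (y ∘ σ)
  have hmp : ∀ n (σ : Equiv.Perm (Fin n)), StronglyMeasurable fun y : Fin n → X d => F n (y ∘ σ) :=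
    fun n σ => (Lp.stronglyMeasurable _).comp_measurable (measurePreserving_perm d n σ).measurable
  have hrep : ∀ n, F n =ᵐ[μ d n] g n := by
    intro n
    by_cases hn : N ≤ n
    · simp only [g, F, if_pos hn, hN n hn]
      exact Lp.coeFn_zero ℂ 2 (μ d n)
    · have hall : ∀ᵐ y ∂(μ d n), ∀ σ : Equiv.Perm (Fin n), F n (y ∘ σ) = sgn σ * F n y :=
        ae_all_iff.2 fun σ => ((G : Fock d) n).2 σ
      filter_upwards [hall] with y hy
      simp only [g, if_neg hn, hy, ← mul_assoc, sgn_mul_self]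
      simp [Fintype.card_perm, Nat.factorial_ne_zero]
  have hmeas : ∀ n, StronglyMeasurable (g n) := by
    intro n
    by_cases hn : N ≤ n
    · simp only [g, if_pos hn]; exact stronglyMeasurable_zero
    · simp only [g, if_neg hn]
      exact (Finset.stronglyMeasurable_fun_sum
        (f := fun (σ : Equiv.Perm (Fin n)) (y : Fin n → X d) => sgn σ * F n (y ∘ σ)) Finset.univ
        fun σ _ => (hmp n σ).const_mul (sgn σ)).const_mul _
  refine ⟨g, ⟨⟨N, fun n hn => by simp only [g, if_pos hn]⟩, hmeas, fun n => ?_, fun n τ y => ?_⟩,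
    hrep, fun n hn => by simp only [g, if_pos hn]⟩
  · exact (memLp_congr_ae (hrep n)).1 (Lp.memLp _)
  · by_cases hn : N ≤ n
    · simp [g, if_pos hn]
    · simp only [g, if_neg hn]
      rw [mul_left_comm]
      refine congrArg (((Nat.factorial n : ℂ))⁻¹ * ·) ?_
      rw [Finset.mul_sum]
      refine Fintype.sum_equiv (Equiv.mulLeft τ) _ _ fun σ => ?_
      rw [Equiv.coe_mulLeft, sgn_mul, ← mul_assoc, ← mul_assoc, sgn_mul_self, one_mul]
      rfl

/-! ### Splitting off one particle -/

theorem measurePreserving_insertNth (d n : ℕ) (i : Fin (n + 1)) :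
    MeasurePreserving (fun p : X d × (Fin n → X d) => i.insertNth (α := fun _ => X d) p.1 p.2)
      ((μX d).prod (μ d n)) (μ d (n + 1)) :=
  (measurePreserving_piFinSuccAbove (fun _ : Fin (n + 1) => μX d) i).symm

theorem integral_insertNth {n : ℕ} (i : Fin (n + 1)) (F : (Fin (n + 1) → X d) → ℂ) :
    ∫ y, F y ∂(μ d (n + 1))
      = ∫ p, F (i.insertNth (α := fun _ => X d) p.1 p.2) ∂((μX d).prod (μ d n)) :=
  ((measurePreserving_piFinSuccAbove (fun _ : Fin (n + 1) => μX d) i).symm.integral_comp' F).symm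

theorem lintegral_insertNth {n : ℕ} (i : Fin (n + 1)) (F : (Fin (n + 1) → X d) → ℝ≥0∞) :
    ∫⁻ y, F y ∂(μ d (n + 1))
      = ∫⁻ p, F (i.insertNth (α := fun _ => X d) p.1 p.2) ∂((μX d).prod (μ d n)) :=
  ((measurePreserving_piFinSuccAbove (fun _ : Fin (n + 1) => μX d) i).symm.lintegral_comp_emb
    (MeasurableEquiv.measurableEmbedding _) F).symm

/-- Singling out the first of `n + 1` particles. -/
theorem measurePreserving_cons (d n : ℕ) :
    MeasurePreserving (fun p : X d × (Fin n → X d) => Fin.cons (α := fun _ => X d) p.1 p.2)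
      ((μX d).prod (μ d n)) (μ d (n + 1)) := by
  simpa only [Fin.insertNth_zero'] using measurePreserving_insertNth d n 0

theorem lintegral_cons {n : ℕ} (F : (Fin (n + 1) → X d) → ℝ≥0∞) :
    ∫⁻ y, F y ∂(μ d (n + 1))
      = ∫⁻ p, F (Fin.cons (α := fun _ => X d) p.1 p.2) ∂((μX d).prod (μ d n)) := by
  simpa only [Fin.insertNth_zero'] using lintegral_insertNth 0 F

theorem measurePreserving_removeNth (d n : ℕ) (i : Fin (n + 1)) :
    Measure.QuasiMeasurePreserving (fun y : Fin (n + 1) → X d => (y i, i.removeNth y))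
      (μ d (n + 1)) ((μX d).prod (μ d n)) :=
  (measurePreserving_piFinSuccAbove (fun _ : Fin (n + 1) => μX d) i).quasiMeasurePreserving

theorem comp_cycleRange_symm {α : Type*} {n : ℕ} (i : Fin (n + 1)) (y : Fin (n + 1) → α) :
    y ∘ i.cycleRange.symm = Fin.cons (α := fun _ => α) (y i) (i.removeNth y) := by
  funext j
  refine Fin.cases ?_ (fun j => ?_) j
  · simp
  · simp [Fin.removeNth]

theorem sgn_cycleRange {n : ℕ} (i : Fin n) : sgn i.cycleRange.symm = (-1) ^ (i : ℕ) := by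
  rw [sgn, Equiv.Perm.sign_symm, Fin.sign_cycleRange]
  simp

/-- Moving the `i`-th particle to the front costs the sign `(-1)^i`. -/
theorem IsL2Wave.insertNth {g : Wave d} (ha : ∀ n (σ : Equiv.Perm (Fin n)) (y : Fin n → X d),
    g n (y ∘ σ) = sgn σ * g n y) {n : ℕ} (i : Fin (n + 1)) (w : X d) (r : Fin n → X d) :
    g (n + 1) (i.insertNth (α := fun _ => X d) w r)
      = (-1) ^ (i : ℕ) * g (n + 1) (Fin.cons (α := fun _ => X d) w r) := by
  have h := ha (n + 1) i.cycleRange.symm (i.insertNth (α := fun _ => X d) w r)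
  rw [comp_cycleRange_symm, sgn_cycleRange, Fin.insertNth_apply_same, Fin.removeNth_insertNth] at h
  rw [h, ← mul_assoc, ← mul_pow]
  simp

theorem ae_memLp_slice {α β : Type*} [MeasurableSpace α] [MeasurableSpace β] {m : Measure α}
    {ν : Measure β} [SFinite m] [SFinite ν] {F : α × β → ℂ} (hm : StronglyMeasurable F)
    (hF : MemLp F 2 (m.prod ν)) : ∀ᵐ y ∂ν, MemLp (fun z => F (z, y)) 2 m := by
  have h := ((memLp_two_iff_integrable_sq_norm hF.1).1 hF).swap.prod_right_ae
  filter_upwards [h] with y hy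
  exact (memLp_two_iff_integrable_sq_norm
    (hm.comp_measurable measurable_prodMk_right).aestronglyMeasurable).2 hy

theorem lintegral_enorm_sq_lt_top {α : Type*} [MeasurableSpace α] {m : Measure α} {f : α → ℂ}
    (hf : MemLp f 2 m) : ∫⁻ z, ‖f z‖ₑ ^ 2 ∂m < ∞ := by
  have := hf.2
  rw [eLpNorm_lt_top_iff_lintegral_rpow_enorm_lt_top (by norm_num) (by norm_num)] at this
  simpa using this

theorem memLp_two_of_lintegral {α : Type*} [MeasurableSpace α] {m : Measure α} {f : α → ℂ}
    (hm : AEStronglyMeasurable f m) (hf : ∫⁻ z, ‖f z‖ₑ ^ 2 ∂m < ∞) : MemLp f 2 m := by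
  refine ⟨hm, ?_⟩
  rw [eLpNorm_lt_top_iff_lintegral_rpow_enorm_lt_top (by norm_num) (by norm_num)]
  simpa using hf

/-- The Cauchy–Schwarz inequality in the form needed for measurable slices. -/
theorem enorm_integral_mul_sq_le {α : Type*} [MeasurableSpace α] {m : Measure α} {f h : α → ℂ}
    (hf : AEStronglyMeasurable f m) (hh : AEStronglyMeasurable h m) :
    ‖∫ z, f z * h z ∂m‖ₑ ^ 2 ≤ (∫⁻ z, ‖f z‖ₑ ^ 2 ∂m) * ∫⁻ z, ‖h z‖ₑ ^ 2 ∂m := by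
  have h1 : ‖∫ z, f z * h z ∂m‖ₑ ≤ ∫⁻ z, ‖f z‖ₑ * ‖h z‖ₑ ∂m := by
    refine (enorm_integral_le_lintegral_enorm _).trans_eq ?_
    simp only [enorm_mul]
  have h2 := ENNReal.lintegral_mul_le_Lp_mul_Lq m Real.HolderConjugate.two_two hf.enorm hh.enorm
  have h3 := h1.trans h2
  calc ‖∫ z, f z * h z ∂m‖ₑ ^ 2
      ≤ ((∫⁻ a, ‖f a‖ₑ ^ (2:ℝ) ∂m) ^ (1 / 2 : ℝ) * (∫⁻ a, ‖h a‖ₑ ^ (2:ℝ) ∂m) ^ (1 / 2 : ℝ)) ^ 2 :=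
        pow_le_pow_left' h3 2
    _ = _ := by
        rw [mul_pow, ← ENNReal.rpow_natCast, ← ENNReal.rpow_natCast, ← ENNReal.rpow_mul,
          ← ENNReal.rpow_mul]
        norm_num

theorem IsL2Wave.meas_cons {g : Wave d} (hg : ∀ n, StronglyMeasurable (g n)) (n : ℕ) :
    StronglyMeasurable fun p : X d × (Fin n → X d) =>
      g (n + 1) (Fin.cons (α := fun _ => X d) p.1 p.2) :=
  (hg (n + 1)).comp_measurable (measurePreserving_cons d n).measurable

theorem IsL2Wave.ae_memLp_cons {g : Wave d} (hg : IsL2Wave g) (n : ℕ) :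
    ∀ᵐ y ∂(μ d n), MemLp (fun z => g (n + 1) (Fin.cons (α := fun _ => X d) z y)) 2 (μX d) :=
  ae_memLp_slice (IsL2Wave.meas_cons hg.meas n)
    ((hg.memLp (n + 1)).comp_measurePreserving (measurePreserving_cons d n))

/-- The squared norm as an extended nonnegative number. -/
theorem Represents.enorm_sq {g : Wave d} {G : FockFin d} (h : Represents g G) :
    ‖G‖ₑ ^ 2 = ∑' n, ∫⁻ y, ‖g n y‖ₑ ^ 2 ∂(μ d n) := by
  have h1 : HasSum (fun n => ‖(G : Fock d) n‖ ^ 2) (‖(G : Fock d)‖ ^ 2) := by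
    have := lp.hasSum_norm (p := 2) (by norm_num) (G : Fock d)
    simpa using this
  have h2 : ∀ n, ENNReal.ofReal (‖(G : Fock d) n‖ ^ 2) = ∫⁻ y, ‖g n y‖ₑ ^ 2 ∂(μ d n) := by
    intro n
    have h3 : ∫⁻ y, ‖g n y‖ₑ ^ 2 ∂(μ d n)
        = ∫⁻ y, ‖((G : Fock d) n : Lp ℂ 2 (μ d n)) y‖ₑ ^ (2 : ℝ) ∂(μ d n) := by
      refine lintegral_congr_ae ?_
      filter_upwards [h n] with y hy
      rw [hy]; simp
    have h4 := Lp.enorm_def ((G : Fock d) n : Lp ℂ 2 (μ d n))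
    rw [eLpNorm_eq_lintegral_rpow_enorm_toReal (by norm_num) (by norm_num)] at h4
    rw [h3, ← ofReal_norm] at *
    rw [ENNReal.ofReal_pow (norm_nonneg _), Submodule.coe_norm, h4, ← ENNReal.rpow_natCast,
      ← ENNReal.rpow_mul]
    norm_num
  rw [← ofReal_norm, ← ENNReal.ofReal_pow (norm_nonneg _), Submodule.coe_norm, ← h1.tsum_eq,
    ENNReal.ofReal_tsum_of_nonneg (fun _ => by positivity) h1.summable]
  exact tsum_congr h2

/-! ### Creation and annihilation of wave functions -/

/-- The pairing `h ↦ (u, h)` of `L²(X d)`. -/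
def pair (u : X d → ℂ) (h : X d → ℂ) : ℂ := ∫ z, conj (u z) * h z ∂(μX d)

theorem pair_smul (u : X d → ℂ) (c : ℂ) (h : X d → ℂ) :
    pair u (fun z => c * h z) = c * pair u h := by
  simp only [pair, mul_left_comm _ c, integral_const_mul]

theorem cons_comp_decomposeFin {α : Type*} {n : ℕ} (z : α) (y : Fin n → α)
    (σ : Equiv.Perm (Fin n)) :
    Fin.cons (α := fun _ => α) z y ∘ Equiv.Perm.decomposeFin.symm (0, σ)
      = Fin.cons (α := fun _ => α) z (y ∘ σ) := by
  funext j
  refine Fin.cases ?_ (fun j => ?_) j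
  · simp
  · simp

theorem sgn_decomposeFin {n : ℕ} (σ : Equiv.Perm (Fin n)) :
    sgn (Equiv.Perm.decomposeFin.symm ((0 : Fin (n + 1)), σ)) = sgn σ := by
  rw [sgn, Equiv.Perm.decomposeFin.symm_sign]; simp

theorem annihilation_anti {T : (X d → ℂ) → ℂ} (hT : ∀ (c : ℂ) h, T (fun z => c * h z) = c * T h)
    {g : Wave d} (ha : ∀ n (σ : Equiv.Perm (Fin n)) (y : Fin n → X d),
      g n (y ∘ σ) = sgn σ * g n y) (n : ℕ) (σ : Equiv.Perm (Fin n)) (y : Fin n → X d) :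
    annihilation T g n (y ∘ σ) = sgn σ * annihilation T g n y := by
  have h : ∀ z, g (n + 1) (Fin.cons z (y ∘ σ)) = sgn σ * g (n + 1) (Fin.cons z y) := by
    intro z
    rw [← cons_comp_decomposeFin, ha, sgn_decomposeFin]
  simp only [annihilation, h, hT]
  ring

theorem annihilation_fin {T : (X d → ℂ) → ℂ} (hT : ∀ (c : ℂ) h, T (fun z => c * h z) = c * T h)
    {g : Wave d} {N : ℕ} (h : ∀ n, N ≤ n → g n = 0) (n : ℕ) (hn : N ≤ n + 1) :
    annihilation T g n = 0 := by
  funext y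
  have h0 : T (fun _ => 0) = 0 := by simpa using hT 0 (fun _ => 0)
  simp [annihilation, h (n + 1) hn, h0]

theorem creation_fin {u : X d → ℂ} {g : Wave d} {N : ℕ} (h : ∀ n, N ≤ n → g n = 0) (n : ℕ)
    (hn : N + 1 ≤ n) : creation u g n = 0 := by
  obtain ⟨n, rfl⟩ : ∃ m, n = m + 1 := ⟨n - 1, by omega⟩
  funext y
  simp [creation, h n (by omega)]

/-- For a permutation `σ` of `n + 1` letters, removing the `i`-th letter from `y ∘ σ` is the same as
removing the `σ i`-th letter from `y`, up to a permutation whose sign is `(-1)^(i + σ i) sgn σ`. -/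
theorem exists_removeNth_comp {α : Type*} {n : ℕ} (σ : Equiv.Perm (Fin (n + 1))) (i : Fin (n + 1)) :
    ∃ τ : Equiv.Perm (Fin n), (∀ y : Fin (n + 1) → α,
      i.removeNth (α := fun _ => α) (y ∘ σ) = (σ i).removeNth (α := fun _ => α) y ∘ τ) ∧
      (-1 : ℂ) ^ (i : ℕ) * sgn τ = sgn σ * (-1) ^ ((σ i : Fin (n + 1)) : ℕ) := by
  let π : Equiv.Perm (Fin (n + 1)) := (σ i).cycleRange * σ * i.cycleRange.symm
  have hπ0 : π 0 = 0 := by simp [π]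
  obtain ⟨⟨p, τ⟩, hτ⟩ := Equiv.Perm.decomposeFin.symm.surjective π
  have hp : p = 0 := by
    rw [← Equiv.Perm.decomposeFin_symm_apply_zero p τ, hτ, hπ0]
  subst hp
  refine ⟨τ, fun y => ?_, ?_⟩
  · have h : (y ∘ σ) ∘ i.cycleRange.symm = (y ∘ (σ i).cycleRange.symm) ∘ π := by
      funext j; simp [π]
    rw [comp_cycleRange_symm, comp_cycleRange_symm, ← hτ, cons_comp_decomposeFin] at h
    exact (Fin.cons_inj.1 h).2
  · have h1 := sgn_decomposeFin τ
    rw [hτ] at h1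
    have h2 : sgn π = sgn (σ i).cycleRange * sgn σ * sgn i.cycleRange.symm := by
      rw [sgn_mul, sgn_mul]
    have h3 : sgn (σ i).cycleRange = (-1) ^ ((σ i : Fin (n + 1)) : ℕ) := by
      rw [← sgn_cycleRange, sgn, sgn, Equiv.Perm.sign_symm]
    rw [← h1, h2, h3, sgn_cycleRange]
    have h4 : ((-1 : ℂ) ^ (i : ℕ)) * (-1) ^ (i : ℕ) = 1 := by rw [← mul_pow]; simp
    linear_combination (sgn σ * (-1) ^ ((σ i : Fin (n + 1)) : ℕ)) * h4

theorem creation_anti (u : X d → ℂ) {g : Wave d}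
    (ha : ∀ n (σ : Equiv.Perm (Fin n)) (y : Fin n → X d), g n (y ∘ σ) = sgn σ * g n y) (n : ℕ)
    (σ : Equiv.Perm (Fin n)) (y : Fin n → X d) :
    creation u g n (y ∘ σ) = sgn σ * creation u g n y := by
  cases n with
  | zero => simp [creation]
  | succ n =>
    simp only [creation]
    rw [mul_left_comm]
    refine congrArg ((Real.sqrt ((n : ℝ) + 1) : ℂ)⁻¹ * ·) ?_
    rw [Finset.mul_sum]
    refine Fintype.sum_equiv σ _ _ fun i => ?_
    obtain ⟨τ, h1, h2⟩ := exists_removeNth_comp (α := X d) σ i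
    rw [h1, ha, Function.comp_apply]
    linear_combination (u (y (σ i)) * g n ((σ i).removeNth y)) * h2

theorem memLp_prod_mul {α β : Type*} [MeasurableSpace α] [MeasurableSpace β] {m : Measure α}
    {ν : Measure β} [SFinite m] [SFinite ν] {f : α → ℂ} {h : β → ℂ} (hf : MemLp f 2 m)
    (hh : MemLp h 2 ν) : MemLp (fun p : α × β => f p.1 * h p.2) 2 (m.prod ν) := by
  refine memLp_two_of_lintegral (hf.1.comp_fst.mul hh.1.comp_snd) ?_
  simp only [enorm_mul, mul_pow]
  rw [lintegral_prod_mul (f := fun z => ‖f z‖ₑ ^ 2) (g := fun z => ‖h z‖ₑ ^ 2)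
    (hf.1.enorm.pow_const 2) (hh.1.enorm.pow_const 2)]
  exact ENNReal.mul_lt_top (lintegral_enorm_sq_lt_top hf) (lintegral_enorm_sq_lt_top hh)

theorem meas_removeNth {u : X d → ℂ} (hu : StronglyMeasurable u) {n : ℕ} {f : (Fin n → X d) → ℂ}
    (hf : StronglyMeasurable f) (i : Fin (n + 1)) :
    StronglyMeasurable fun y : Fin (n + 1) → X d => u (y i) * f (i.removeNth y) :=
  (hu.comp_measurable (measurePreserving_removeNth d n i).measurable.fst).mul
    (hf.comp_measurable (measurePreserving_removeNth d n i).measurable.snd)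

theorem creation_meas {u : X d → ℂ} (hu : StronglyMeasurable u) {g : Wave d}
    (hg : ∀ n, StronglyMeasurable (g n)) (n : ℕ) : StronglyMeasurable (creation u g n) := by
  cases n with
  | zero => exact stronglyMeasurable_const
  | succ n =>
    refine (Finset.stronglyMeasurable_fun_sum (f := fun (i : Fin (n + 1)) (y : Fin (n + 1) → X d) =>
      (-1 : ℂ) ^ (i : ℕ) * u (y i) * g n (i.removeNth y)) Finset.univ fun i _ => ?_).const_mul _
    simp only [mul_assoc]
    exact (meas_removeNth hu (hg n) i).const_mul _

theorem creation_memLp {u : X d → ℂ} (hu : MemLp u 2 (μX d)) {g : Wave d}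
    (hg : ∀ n, MemLp (g n) 2 (μ d n)) (n : ℕ) : MemLp (creation u g n) 2 (μ d n) := by
  cases n with
  | zero => exact MemLp.zero
  | succ n =>
    refine (memLp_finsetSum (f := fun (i : Fin (n + 1)) (y : Fin (n + 1) → X d) =>
      (-1 : ℂ) ^ (i : ℕ) * u (y i) * g n (i.removeNth y)) Finset.univ fun i _ => ?_).const_mul _
    simp only [mul_assoc]
    exact (((memLp_prod_mul hu (hg n)).comp_measurePreserving
      (measurePreserving_piFinSuccAbove (fun _ : Fin (n + 1) => μX d) i)).const_mul _)

theorem IsL2Wave.creation {u : X d → ℂ} (hm : StronglyMeasurable u) (hu : MemLp u 2 (μX d))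
    {g : Wave d} (hg : IsL2Wave g) : IsL2Wave (creation u g) where
  fin := by
    obtain ⟨N, hN⟩ := hg.fin
    exact ⟨N + 1, creation_fin hN⟩
  meas := creation_meas hm hg.meas
  memLp := creation_memLp hu hg.memLp
  anti := creation_anti u hg.anti

theorem IsL2Wave.annihilation {u : X d → ℂ} (hm : StronglyMeasurable u) (hu : MemLp u 2 (μX d))
    {g : Wave d} (hg : IsL2Wave g) : IsL2Wave (annihilation (pair u) g) where
  fin := by
    obtain ⟨N, hN⟩ := hg.fin
    exact ⟨N, fun n hn => annihilation_fin (pair_smul u) hN n (by omega)⟩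
  meas n := by
    have h : StronglyMeasurable fun p : X d × (Fin n → X d) =>
        conj (u p.1) * g (n + 1) (Fin.cons (α := fun _ => X d) p.1 p.2) :=
      ((Complex.continuous_conj.comp_stronglyMeasurable hm).comp_measurable measurable_fst).mul
        (IsL2Wave.meas_cons hg.meas n)
    exact h.integral_prod_left'.const_mul _
  memLp n := by
    have hmc := IsL2Wave.meas_cons hg.meas n
    have h : StronglyMeasurable fun p : X d × (Fin n → X d) =>
        conj (u p.1) * g (n + 1) (Fin.cons (α := fun _ => X d) p.1 p.2) :=
      ((Complex.continuous_conj.comp_stronglyMeasurable hm).comp_measurable measurable_fst).mul hmc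
    refine MemLp.const_mul (memLp_two_of_lintegral h.integral_prod_left'.aestronglyMeasurable ?_) _
    have hc : ∀ y : Fin n → X d, ‖∫ z, conj (u z) * g (n + 1) (Fin.cons z y) ∂(μX d)‖ₑ ^ 2
        ≤ (∫⁻ z, ‖u z‖ₑ ^ 2 ∂(μX d)) * ∫⁻ z, ‖g (n + 1) (Fin.cons z y)‖ₑ ^ 2 ∂(μX d) := by
      intro y
      refine (enorm_integral_mul_sq_le
        (Complex.continuous_conj.comp_stronglyMeasurable hm).aestronglyMeasurable
        (hmc.comp_measurable measurable_prodMk_right).aestronglyMeasurable).trans_eq ?_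
      simp
    refine (lintegral_mono hc).trans_lt ?_
    rw [lintegral_const_mul _ (by
      exact (hmc.enorm.pow_const 2).lintegral_prod_left')]
    refine ENNReal.mul_lt_top (lintegral_enorm_sq_lt_top hu) ?_
    have h1 := lintegral_enorm_sq_lt_top (hg.memLp (n + 1))
    rw [lintegral_cons, lintegral_prod_symm' _ (hmc.enorm.pow_const 2)] at h1
    exact h1
  anti := annihilation_anti (pair_smul u) hg.anti

theorem annihilation_congr {u u' : X d → ℂ} (hu : u =ᵐ[μX d] u') {g g' : Wave d}
    (hg : ∀ n, g n =ᵐ[μ d n] g' n) (n : ℕ) :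
    annihilation (pair u) g n =ᵐ[μ d n] annihilation (pair u') g' n := by
  have h := (measurePreserving_cons d n).quasiMeasurePreserving.ae (hg (n + 1))
  have h' := Measure.ae_ae_of_ae_prod
    (Measure.measurePreserving_swap.quasiMeasurePreserving.ae h)
  filter_upwards [h'] with y hy
  simp only [annihilation, pair]
  congr 1
  refine integral_congr_ae ?_
  filter_upwards [hu, hy] with z h1 h2
  rw [h1]; congr 1

theorem creation_congr {u u' : X d → ℂ} (hu : u =ᵐ[μX d] u') {g g' : Wave d}
    (hg : ∀ n, g n =ᵐ[μ d n] g' n) (n : ℕ) :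
    creation u g n =ᵐ[μ d n] creation u' g' n := by
  cases n with
  | zero => exact EventuallyEq.rfl
  | succ n =>
    have h : ∀ i : Fin (n + 1), ∀ᵐ y ∂(μ d (n + 1)),
        u (y i) = u' (y i) ∧ g n (i.removeNth y) = g' n (i.removeNth y) := fun i =>
      (measurePreserving_removeNth d n i).ae
        ((Measure.quasiMeasurePreserving_fst.ae hu).and
          (Measure.quasiMeasurePreserving_snd.ae (hg n)))
    filter_upwards [ae_all_iff.2 h] with y hy
    simp only [creation]
    congr 1
    exact Finset.sum_congr rfl fun i _ => by rw [(hy i).1, (hy i).2]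

/-! ### Creation and annihilation operators -/

theorem stronglyMeasurable_coe (u : Lp ℂ 2 (μX d)) : StronglyMeasurable (u : X d → ℂ) :=
  Lp.stronglyMeasurable u

/-- Choice of an everywhere antisymmetric representative. -/
def rep (G : FockFin d) : Wave d := (exists_below G).choose_spec.exists_isL2Wave.choose

theorem isL2Wave_rep (G : FockFin d) : IsL2Wave (rep G) :=
  (exists_below G).choose_spec.exists_isL2Wave.choose_spec.1

theorem represents_rep (G : FockFin d) : Represents (rep G) G :=
  (exists_below G).choose_spec.exists_isL2Wave.choose_spec.2.1

theorem integrable_conj_mul {α : Type*} [MeasurableSpace α] {m : Measure α} {u h : α → ℂ}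
    (hu : MemLp u 2 m) (hh : MemLp h 2 m) : Integrable (fun z => conj (u z) * h z) m :=
  MemLp.integrable_mul (p := 2) (q := 2) hu.star hh

theorem pair_add {u : X d → ℂ} (hu : MemLp u 2 (μX d)) {h h' : X d → ℂ} (hh : MemLp h 2 (μX d))
    (hh' : MemLp h' 2 (μX d)) : pair u (fun z => h z + h' z) = pair u h + pair u h' := by
  simp only [pair, mul_add]
  exact integral_add (integrable_conj_mul hu hh) (integrable_conj_mul hu hh')

theorem annihilation_add_ae {u : X d → ℂ} (hu : MemLp u 2 (μX d)) {g h : Wave d}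
    (hg : IsL2Wave g) (hh : IsL2Wave h) (n : ℕ) :
    annihilation (pair u) (g + h) n
      =ᵐ[μ d n] (annihilation (pair u) g + annihilation (pair u) h) n := by
  filter_upwards [hg.ae_memLp_cons n, hh.ae_memLp_cons n] with y h1 h2
  simp only [annihilation, Pi.add_apply, pair_add hu h1 h2, mul_add]

theorem annihilation_smul (T : (X d → ℂ) → ℂ) (hT : ∀ (c : ℂ) h, T (fun z => c * h z) = c * T h)
    (c : ℂ) (g : Wave d) : annihilation T (c • g) = c • annihilation T g := by
  funext n y
  simp only [annihilation, Pi.smul_apply, smul_eq_mul, hT]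
  ring

theorem creation_add (u : X d → ℂ) (g h : Wave d) :
    creation u (g + h) = creation u g + creation u h := by
  funext n y
  cases n with
  | zero => simp [creation]
  | succ n => simp only [creation, Pi.add_apply, mul_add, Finset.sum_add_distrib]

theorem creation_smul (u : X d → ℂ) (c : ℂ) (g : Wave d) :
    creation u (c • g) = c • creation u g := by
  funext n y
  cases n with
  | zero => simp [creation]
  | succ n =>
    simp only [creation, Pi.smul_apply, smul_eq_mul, Finset.mul_sum]
    exact Finset.sum_congr rfl fun i _ => by ring

/-- The annihilation operator `a(u)` of a vector `u ∈ L²(X d)`. -/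
def ann (u : Lp ℂ 2 (μX d)) : FockFin d →ₗ[ℂ] FockFin d where
  toFun G := ((isL2Wave_rep G).annihilation (stronglyMeasurable_coe u) (Lp.memLp u)).vec
  map_add' G K := by
    refine Represents.ext (g := annihilation (pair u) (rep (G + K))) (IsL2Wave.represents_vec _) ?_
    refine ((IsL2Wave.represents_vec _).add (IsL2Wave.represents_vec _)).congr fun n => ?_
    refine (annihilation_add_ae (Lp.memLp u) (isL2Wave_rep G) (isL2Wave_rep K) n).symm.trans ?_
    exact annihilation_congr EventuallyEq.rfl
      (((represents_rep G).add (represents_rep K)).ae_eq (represents_rep (G + K))) n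
  map_smul' c G := by
    refine Represents.ext (g := annihilation (pair u) (rep (c • G))) (IsL2Wave.represents_vec _) ?_
    refine ((IsL2Wave.represents_vec _).smul c).congr fun n => ?_
    rw [← annihilation_smul _ (pair_smul _)]
    exact annihilation_congr EventuallyEq.rfl
      (((represents_rep G).smul c).ae_eq (represents_rep (c • G))) n

/-- The creation operator `a*(u)` of a vector `u ∈ L²(X d)`. -/
def cre (u : Lp ℂ 2 (μX d)) : FockFin d →ₗ[ℂ] FockFin d where
  toFun G := ((isL2Wave_rep G).creation (stronglyMeasurable_coe u) (Lp.memLp u)).vec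
  map_add' G K := by
    refine Represents.ext (g := creation u (rep (G + K))) (IsL2Wave.represents_vec _) ?_
    refine ((IsL2Wave.represents_vec _).add (IsL2Wave.represents_vec _)).congr fun n => ?_
    rw [← creation_add]
    exact creation_congr EventuallyEq.rfl
      (((represents_rep G).add (represents_rep K)).ae_eq (represents_rep (G + K))) n
  map_smul' c G := by
    refine Represents.ext (g := creation u (rep (c • G))) (IsL2Wave.represents_vec _) ?_
    refine ((IsL2Wave.represents_vec _).smul c).congr fun n => ?_
    rw [← creation_smul]
    exact creation_congr EventuallyEq.rfl
      (((represents_rep G).smul c).ae_eq (represents_rep (c • G))) n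

theorem represents_ann {u : Lp ℂ 2 (μX d)} {v : X d → ℂ} (hv : (u : X d → ℂ) =ᵐ[μX d] v)
    {g : Wave d} {G : FockFin d} (h : Represents g G) :
    Represents (annihilation (pair v) g) (ann u G) :=
  Represents.congr (G := ann u G) (IsL2Wave.represents_vec
    ((isL2Wave_rep G).annihilation (stronglyMeasurable_coe u) (Lp.memLp u)))
    (annihilation_congr hv ((represents_rep G).ae_eq h))

theorem represents_cre {u : Lp ℂ 2 (μX d)} {v : X d → ℂ} (hv : (u : X d → ℂ) =ᵐ[μX d] v)
    {g : Wave d} {G : FockFin d} (h : Represents g G) :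
    Represents (creation v g) (cre u G) :=
  Represents.congr (G := cre u G) (IsL2Wave.represents_vec
    ((isL2Wave_rep G).creation (stronglyMeasurable_coe u) (Lp.memLp u)))
    (creation_congr hv ((represents_rep G).ae_eq h))

/-! ### The canonical anticommutation relations -/

/-- The pointwise form of the relation `a(T) a*(v) + a*(v) a(T) = T v`, for functionals `T` which
are linear on a space `S` containing `v` and the slices of the wave function. -/
theorem annihilation_creation (S : Submodule ℂ (X d → ℂ)) {T : (X d → ℂ) → ℂ}
    (hadd : ∀ h ∈ S, ∀ h' ∈ S, T (fun z => h z + h' z) = T h + T h')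
    (hsmul : ∀ (c : ℂ) h, T (fun z => c * h z) = c * T h) {v : X d → ℂ} (hv : v ∈ S) {g : Wave d}
    (n : ℕ) (y : Fin n → X d) (hs : ∀ m (hm : n = m + 1) (j : Fin (m + 1)),
      (fun z => g (m + 1) (Fin.cons z (j.removeNth fun i => y (i.cast hm.symm)))) ∈ S) :
    annihilation T (creation v g) n y = T v * g n y - creation v (annihilation T g) n y := by
  have h0 : T (fun _ => 0) = 0 := by simpa using hsmul 0 (fun _ => 0)
  have hsum : ∀ (ι : Type) (s : Finset ι) (f : ι → X d → ℂ), (∀ i ∈ s, f i ∈ S) →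
      T (fun z => ∑ i ∈ s, f i z) = ∑ i ∈ s, T (f i) := by
    intro ι s f hf
    classical
    induction s using Finset.induction_on with
    | empty => simpa using h0
    | insert i s hi ih =>
      simp only [Finset.sum_insert hi]
      rw [hadd (f i) (hf i (by simp)) (fun z => ∑ i ∈ s, f i z), ih fun j hj => hf j (by simp [hj])]
      have : (fun z => ∑ i ∈ s, f i z) = ∑ i ∈ s, f i := by funext z; simp
      rw [this]
      exact S.sum_mem fun j hj => hf j (by simp [hj])
  have hn : (Real.sqrt ((n : ℝ) + 1) : ℂ) ≠ 0 := by
    rw [Ne, Complex.ofReal_eq_zero]; positivity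
  have hL : annihilation T (creation v g) n y = (Real.sqrt ((n : ℝ) + 1) : ℂ) *
      T (fun z => (Real.sqrt ((n : ℝ) + 1) : ℂ)⁻¹ * ∑ i : Fin (n + 1), (-1 : ℂ) ^ (i : ℕ) *
        v (Fin.cons (α := fun _ => X d) z y i) *
          g n (i.removeNth (Fin.cons (α := fun _ => X d) z y))) := rfl
  rw [hL, hsmul, ← mul_assoc, mul_inv_cancel₀ hn, one_mul]
  simp only [Fin.sum_univ_succ, Fin.cons_zero, Fin.val_zero, pow_zero, one_mul, Fin.removeNth_zero,
    Fin.tail_cons, Fin.cons_succ]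
  cases n with
  | zero =>
    simp only [Finset.univ_eq_empty, Finset.sum_empty, add_zero, creation, sub_zero, mul_comm (v _)]
    rw [hsmul, mul_comm]
  | succ m =>
    have hrem : ∀ (j : Fin (m + 1)) (z : X d),
        (j.succ).removeNth (α := fun _ => X d) (Fin.cons z y)
          = Fin.cons (α := fun _ => X d) z (j.removeNth y) := by
      intro j z
      funext i
      refine Fin.cases ?_ (fun i => ?_) i
      · simp [Fin.removeNth]
      · simp [Fin.removeNth]
    simp only [hrem, Fin.val_succ]
    have hS : ∀ j : Fin (m + 1), (fun z => ((-1 : ℂ) ^ ((j : ℕ) + 1) * v (y j))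
        * g (m + 1) (Fin.cons z (j.removeNth y))) ∈ S :=
      fun j => S.smul_mem ((-1 : ℂ) ^ ((j : ℕ) + 1) * v (y j)) (hs m rfl j)
    rw [hadd (fun z => v z * g (m + 1) y), hsum _ _ _ fun j _ => hS j]
    · simp only [mul_comm (v _) (g (m + 1) y)]
      rw [hsmul, mul_comm]
      simp only [hsmul, creation, annihilation, Finset.mul_sum]
      rw [sub_eq_add_neg, ← Finset.sum_neg_distrib]
      congr 1
      refine Finset.sum_congr rfl fun j _ => ?_
      have hm : (Real.sqrt ((m : ℝ) + 1) : ℂ) ≠ 0 := by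
        rw [Ne, Complex.ofReal_eq_zero]; positivity
      field_simp
      ring
    · have := S.smul_mem (g (m + 1) y) hv
      convert this using 1
      funext z; simp [mul_comm]
    · have : (fun z => ∑ j : Fin (m + 1), ((-1 : ℂ) ^ ((j : ℕ) + 1) * v (y j))
        * g (m + 1) (Fin.cons z (j.removeNth y))) = ∑ j : Fin (m + 1), fun z =>
        ((-1 : ℂ) ^ ((j : ℕ) + 1) * v (y j)) * g (m + 1) (Fin.cons z (j.removeNth y)) := by
        funext z; simp
      rw [this]
      exact S.sum_mem fun j _ => hS j

/-- The square-integrable functions on `X d`, as a space of functions. -/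
def squareIntegrable (d : ℕ) : Submodule ℂ (X d → ℂ) where
  carrier := {h | MemLp h 2 (μX d)}
  add_mem' := MemLp.add
  zero_mem' := MemLp.zero
  smul_mem' c _ h := h.const_smul c

theorem inner_eq_pair (u v : Lp ℂ 2 (μX d)) : inner ℂ u v = pair u v := by
  rw [L2.inner_def]
  simp only [RCLike.inner_apply, pair, mul_comm]

/-- The canonical anticommutation relation. It is the pointwise identity `annihilation_creation`
applied to a representing wave. -/
theorem ann_cre (u v : Lp ℂ 2 (μX d)) (G : FockFin d) :
    ann u (cre v G) + cre v (ann u G) = (inner ℂ u v : ℂ) • G := by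
  have hG := represents_rep G
  have hg := isL2Wave_rep G
  refine Represents.ext (g := annihilation (pair u) (creation v (rep G))
    + creation v (annihilation (pair u) (rep G))) ?_ ?_
  · exact (represents_ann EventuallyEq.rfl (represents_cre EventuallyEq.rfl hG)).add
      (represents_cre EventuallyEq.rfl (represents_ann EventuallyEq.rfl hG))
  · refine (hG.smul _).congr fun n => ?_
    have hs : ∀ᵐ y ∂(μ d n), ∀ m (hm : n = m + 1) (j : Fin (m + 1)),
        (fun z => rep G (m + 1) (Fin.cons z (j.removeNth fun i => y (i.cast hm.symm))))
          ∈ squareIntegrable d := by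
      cases n with
      | zero => exact Eventually.of_forall fun y m hm => by omega
      | succ n =>
        have h : ∀ j : Fin (n + 1), ∀ᵐ y ∂(μ d (n + 1)),
            MemLp (fun z => rep G (n + 1) (Fin.cons z (j.removeNth y))) 2 (μX d) := fun j =>
          (measurePreserving_removeNth d n j).ae
            (Measure.quasiMeasurePreserving_snd.ae (hg.ae_memLp_cons n))
        filter_upwards [ae_all_iff.2 h] with y hy m hm j
        obtain rfl : n = m := by omega
        exact hy j
    filter_upwards [hs] with y hy
    have := annihilation_creation (squareIntegrable d) (T := pair u)
      (fun h hh h' hh' => pair_add (Lp.memLp u) hh hh') (pair_smul u) (v := v) (Lp.memLp v) n y hy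
    simp only [Pi.add_apply, Pi.smul_apply, smul_eq_mul, this, inner_eq_pair]
    ring

theorem ann_ann (u v : Lp ℂ 2 (μX d)) (G : FockFin d) : ann u (ann v G) = - ann v (ann u G) := by
  have hG := represents_rep G
  have hg := isL2Wave_rep G
  rw [← neg_one_smul ℂ]
  refine Represents.ext (g := annihilation (pair u) (annihilation (pair v) (rep G)))
    (represents_ann EventuallyEq.rfl (represents_ann EventuallyEq.rfl hG)) ?_
  refine ((represents_ann EventuallyEq.rfl (represents_ann EventuallyEq.rfl hG)).smul
    (-1 : ℂ)).congr fun n => ?_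
  let F : (X d × X d) × (Fin n → X d) → ℂ := fun p =>
    rep G (n + 2) (Fin.cons p.1.1 (Fin.cons (α := fun _ => X d) p.1.2 p.2))
  have hmp : MeasurePreserving (fun p : (X d × X d) × (Fin n → X d) =>
      Fin.cons (α := fun _ => X d) p.1.1 (Fin.cons (α := fun _ => X d) p.1.2 p.2))
      (((μX d).prod (μX d)).prod (μ d n)) (μ d (n + 2)) :=
    (measurePreserving_cons d (n + 1)).comp (((MeasurePreserving.id (μX d)).prod
      (measurePreserving_cons d n)).comp (measurePreserving_prodAssoc (μX d) (μX d) (μ d n)))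
  have hF := ae_memLp_slice (F := F) ((hg.meas (n + 2)).comp_measurable hmp.measurable)
    ((hg.memLp (n + 2)).comp_measurePreserving hmp)
  filter_upwards [hF] with y hy
  simp only [annihilation, Pi.smul_apply, smul_eq_mul, pair]
  have hsw : ∀ z w, rep G (n + 2) (Fin.cons w (Fin.cons (α := fun _ => X d) z y))
      = - rep G (n + 2) (Fin.cons z (Fin.cons (α := fun _ => X d) w y)) := by
    intro z w
    have h := hg.anti (n + 2) (Equiv.swap 0 1) (Fin.cons z (Fin.cons (α := fun _ => X d) w y))
    have h2 : (Fin.cons z (Fin.cons (α := fun _ => X d) w y) : Fin (n + 2) → X d)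
        ∘ (Equiv.swap (0 : Fin (n + 2)) 1) = Fin.cons w (Fin.cons (α := fun _ => X d) z y) := by
      funext j
      refine Fin.cases ?_ (fun j => Fin.cases ?_ (fun j => ?_) j) j
      · simp
      · simp
      · rw [Function.comp_apply, Equiv.swap_apply_of_ne_of_ne]
        · simp
        · exact Fin.succ_ne_zero _
        · rw [← Fin.succ_zero_eq_one, Ne, Fin.succ_inj]; exact Fin.succ_ne_zero _
    rw [h2] at h
    rw [h, sgn, Equiv.Perm.sign_swap (by simp)]
    simp
  have hint : Integrable (fun p : X d × X d => conj (u p.1) * (conj (v p.2) * F ((p.2, p.1), y)))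
      ((μX d).prod (μX d)) := by
    have h1 : MemLp (fun p : X d × X d => F ((p.2, p.1), y)) 2 ((μX d).prod (μX d)) :=
      hy.comp_measurePreserving Measure.measurePreserving_swap
    have h2 := integrable_conj_mul (memLp_prod_mul (Lp.memLp u) (Lp.memLp v)) h1
    refine h2.congr (Eventually.of_forall fun p => ?_)
    simp only [map_mul, mul_assoc]
  have key : ∫ z, conj (u z) * ∫ w, conj (v w) * F ((w, z), y) ∂(μX d) ∂(μX d)
      = - ∫ z, conj (v z) * ∫ w, conj (u w) * F ((w, z), y) ∂(μX d) ∂(μX d) := by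
    simp only [← integral_const_mul]
    rw [integral_integral_swap (f := fun z w => conj (u z) * (conj (v w) * F ((w, z), y))) hint,
      ← integral_neg]
    refine integral_congr_ae (Eventually.of_forall fun w => ?_)
    simp only
    rw [← integral_neg]
    refine integral_congr_ae (Eventually.of_forall fun z => ?_)
    simp only [F, hsw z w]
    ring
  simp only [F] at key
  have e : ∀ (a b : ℂ) (f : X d → ℂ) (g : X d → X d → ℂ),
      ∫ z, conj (f z) * (b * ∫ w, g z w ∂(μX d)) ∂(μX d)
        = b * ∫ z, conj (f z) * ∫ w, g z w ∂(μX d) ∂(μX d) := by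
    intro a b f g
    rw [← integral_const_mul]
    exact integral_congr_ae (Eventually.of_forall fun z => by ring)
  rw [e 0, e 0, key]
  ring

/-- Creation is the adjoint of annihilation. -/
theorem inner_cre (u : Lp ℂ 2 (μX d)) (G K : FockFin d) :
    inner ℂ (cre u G) K = inner ℂ G (ann u K) := by
  have hG := represents_rep G
  have hg := isL2Wave_rep G
  have hK := represents_rep K
  have hk := isL2Wave_rep K
  rw [(represents_cre EventuallyEq.rfl hG).inner_eq hK,
    hG.inner_eq (represents_ann EventuallyEq.rfl hK)]
  have h0 : ∀ n, ∫ y, conj (creation u (rep G) (n + 1) y) * rep K (n + 1) y ∂(μ d (n + 1))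
      = ∫ y, conj (rep G n y) * annihilation (pair u) (rep K) n y ∂(μ d n) := by
    intro n
    have hI : ∀ i : Fin (n + 1), Integrable (fun y => conj (u (y i) * rep G n (i.removeNth y))
        * rep K (n + 1) y) (μ d (n + 1)) := fun i =>
      integrable_conj_mul ((memLp_prod_mul (Lp.memLp u) (hg.memLp n)).comp_measurePreserving
        (measurePreserving_piFinSuccAbove (fun _ : Fin (n + 1) => μX d) i)) (hk.memLp (n + 1))
    have hJ : ∀ i : Fin (n + 1), ∫ y, conj (u (y i) * rep G n (i.removeNth y))
        * rep K (n + 1) y ∂(μ d (n + 1))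
        = (-1) ^ (i : ℕ) * ∫ y, conj (rep G n y) * pair u (fun z => rep K (n + 1) (Fin.cons z y))
          ∂(μ d n) := by
      intro i
      have hI0 : Integrable (fun p : X d × (Fin n → X d) =>
          conj (u (i.insertNth (α := fun _ => X d) p.1 p.2 i) * rep G n
            (i.removeNth (i.insertNth (α := fun _ => X d) p.1 p.2)))
          * rep K (n + 1) (i.insertNth (α := fun _ => X d) p.1 p.2)) ((μX d).prod (μ d n)) :=
        ((measurePreserving_insertNth d n i).integrable_comp
          (hI i).aestronglyMeasurable).2 (hI i)
      rw [integral_insertNth i, integral_prod_symm _ hI0, ← integral_const_mul]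
      refine integral_congr_ae (Eventually.of_forall fun y => ?_)
      simp only [pair]
      rw [← integral_const_mul, ← integral_const_mul]
      refine integral_congr_ae (Eventually.of_forall fun z => ?_)
      simp only [Fin.insertNth_apply_same, Fin.removeNth_insertNth,
        IsL2Wave.insertNth hk.anti i z y, map_mul]
      ring
    have hn : (Real.sqrt ((n : ℝ) + 1) : ℂ) ≠ 0 := by
      rw [Ne, Complex.ofReal_eq_zero]; positivity
    have hs : (Real.sqrt ((n : ℝ) + 1) : ℂ) * (Real.sqrt ((n : ℝ) + 1) : ℂ) = n + 1 := by
      rw [← Complex.ofReal_mul, Real.mul_self_sqrt (by positivity)]; simp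
    calc ∫ y, conj (creation u (rep G) (n + 1) y) * rep K (n + 1) y ∂(μ d (n + 1))
        = ∫ y, ∑ i : Fin (n + 1), ((Real.sqrt ((n : ℝ) + 1) : ℂ)⁻¹ * (-1) ^ (i : ℕ)) *
            (conj (u (y i) * rep G n (i.removeNth y)) * rep K (n + 1) y) ∂(μ d (n + 1)) := by
          refine integral_congr_ae (Eventually.of_forall fun y => ?_)
          simp only [creation, map_mul, map_sum, map_inv₀, Complex.conj_ofReal, map_pow, map_neg,
            map_one, Finset.mul_sum, Finset.sum_mul]
          exact Finset.sum_congr rfl fun i _ => by ring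
      _ = ∑ i : Fin (n + 1), ((Real.sqrt ((n : ℝ) + 1) : ℂ)⁻¹ * (-1) ^ (i : ℕ)) *
            ((-1) ^ (i : ℕ) * ∫ y, conj (rep G n y) *
              pair u (fun z => rep K (n + 1) (Fin.cons z y)) ∂(μ d n)) := by
          rw [integral_finsetSum _ fun i _ => (hI i).const_mul _]
          exact Finset.sum_congr rfl fun i _ => by rw [integral_const_mul, hJ]
      _ = (Real.sqrt ((n : ℝ) + 1) : ℂ) * ∫ y, conj (rep G n y) *
              pair u (fun z => rep K (n + 1) (Fin.cons z y)) ∂(μ d n) := by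
          have h4 : ∀ i : Fin (n + 1), ((-1 : ℂ) ^ (i : ℕ)) * (-1) ^ (i : ℕ) = 1 := fun i => by
            rw [← mul_pow]; simp
          simp only [← mul_assoc, mul_assoc _ ((-1 : ℂ) ^ _) ((-1 : ℂ) ^ _), h4, mul_one]
          rw [Finset.sum_const, Finset.card_univ, Fintype.card_fin, nsmul_eq_mul, ← mul_assoc]
          congr 1
          field_simp
          push_cast
          rw [sq, hs]
      _ = _ := by
          rw [← integral_const_mul]
          refine integral_congr_ae (Eventually.of_forall fun y => ?_)
          simp only [annihilation]
          ring
  obtain ⟨N, hN⟩ := hg.fin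
  simp only [toGenVec]
  have hz : ∫ y, conj (creation u (rep G) 0 y) * rep K 0 y ∂(μ d 0) = 0 := by simp [creation]
  have hv : ∀ n ∉ Finset.range N, ∫ y, conj (rep G n y) * annihilation (pair u) (rep K) n y ∂(μ d n)
      = 0 := fun n hn => by simp [hN n (by simpa using hn)]
  rw [tsum_eq_sum hv, tsum_eq_sum (s := Finset.range (N + 1)) fun n hn => by
    have := creation_fin (u := u) hN n (by simpa using hn)
    simp [this]]
  rw [Finset.sum_range_succ', hz, add_zero]
  exact Finset.sum_congr rfl fun n _ => h0 n

theorem inner_ann (u : Lp ℂ 2 (μX d)) (G K : FockFin d) :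
    inner ℂ (ann u G) K = inner ℂ G (cre u K) := by
  rw [← inner_conj_symm, ← inner_cre, inner_conj_symm]

/-- Dual to `ann_ann`, so that no computation with permutations is needed. -/
theorem cre_cre (u v : Lp ℂ 2 (μX d)) (G : FockFin d) : cre u (cre v G) = - cre v (cre u G) := by
  refine ext_inner_right ℂ fun K => ?_
  rw [inner_neg_left, inner_cre, inner_cre, inner_cre, inner_cre, ann_ann, inner_neg_right]

/-! ### Bounds for creation and annihilation operators -/

theorem fock_inner_smul_left (c : ℂ) (G K : FockFin d) :
    inner ℂ (c • G) K = conj c * inner ℂ G K := inner_smul_left (𝕜 := ℂ) G K c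

theorem fock_inner_smul_right (c : ℂ) (G K : FockFin d) :
    inner ℂ G (c • K) = c * inner ℂ G K := inner_smul_right (𝕜 := ℂ) G K c

/-- The anticommutation relation in expectation; it bounds both operators by `‖u‖`, uniformly in
the number of particles. -/
theorem norm_cre_ann_sq (u : Lp ℂ 2 (μX d)) (G : FockFin d) :
    ‖cre u G‖ ^ 2 + ‖ann u G‖ ^ 2 = ‖u‖ ^ 2 * ‖G‖ ^ 2 := by
  have h := congrArg (fun K => inner ℂ G K) (ann_cre u u G)
  simp only [inner_add_right, fock_inner_smul_right] at h
  rw [← inner_cre u G (cre u G), ← inner_ann u G (ann u G), inner_self_eq_norm_sq_to_K,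
    inner_self_eq_norm_sq_to_K, inner_self_eq_norm_sq_to_K, inner_self_eq_norm_sq_to_K] at h
  exact_mod_cast h

theorem norm_cre_le (u : Lp ℂ 2 (μX d)) (G : FockFin d) : ‖cre u G‖ ≤ ‖u‖ * ‖G‖ := by
  refine le_of_sq_le_sq ?_ (by positivity)
  nlinarith [norm_cre_ann_sq u G, sq_nonneg ‖ann u G‖]

theorem norm_ann_le (u : Lp ℂ 2 (μX d)) (G : FockFin d) : ‖ann u G‖ ≤ ‖u‖ * ‖G‖ := by
  refine le_of_sq_le_sq ?_ (by positivity)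
  nlinarith [norm_cre_ann_sq u G, sq_nonneg ‖cre u G‖]

theorem cre_add_left (u v : Lp ℂ 2 (μX d)) (G : FockFin d) :
    cre (u + v) G = cre u G + cre v G := by
  have hG := represents_rep G
  refine Represents.ext (represents_cre (Lp.coeFn_add u v) hG) ?_
  refine ((represents_cre EventuallyEq.rfl hG).add (represents_cre EventuallyEq.rfl hG)).congr
    fun n => Eventually.of_forall fun y => ?_
  cases n with
  | zero => simp [creation]
  | succ n =>
    simp only [creation, Pi.add_apply, add_mul, mul_add, Finset.sum_add_distrib]

theorem cre_smul_left (c : ℂ) (u : Lp ℂ 2 (μX d)) (G : FockFin d) :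
    cre (c • u) G = c • cre u G := by
  have hG := represents_rep G
  refine Represents.ext (represents_cre (Lp.coeFn_smul c u) hG) ?_
  refine ((represents_cre EventuallyEq.rfl hG).smul c).congr
    fun n => Eventually.of_forall fun y => ?_
  cases n with
  | zero => simp [creation]
  | succ n =>
    simp only [creation, Pi.smul_apply, smul_eq_mul, Finset.mul_sum]
    exact Finset.sum_congr rfl fun i _ => by ring

theorem ann_add_left (u v : Lp ℂ 2 (μX d)) (G : FockFin d) :
    ann (u + v) G = ann u G + ann v G := by
  refine ext_inner_right ℂ fun K => ?_
  rw [inner_add_left, inner_ann, inner_ann, inner_ann, cre_add_left, inner_add_right]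

theorem ann_smul_left (c : ℂ) (u : Lp ℂ 2 (μX d)) (G : FockFin d) :
    ann (c • u) G = conj c • ann u G := by
  refine ext_inner_right ℂ fun K => ?_
  rw [fock_inner_smul_left, inner_ann, inner_ann, cre_smul_left, fock_inner_smul_right]
  simp

theorem Represents.below {g : Wave d} {G : FockFin d} (h : Represents g G) {N : ℕ}
    (hg : ∀ n, N ≤ n → g n = 0) : Below N G := fun n hn => by
  have h1 := h n
  rw [hg n hn] at h1
  exact Subtype.ext ((Lp.eq_zero_iff_ae_eq_zero).2 h1)

theorem Below.mono {M N : ℕ} (h : M ≤ N) {G : FockFin d} (hG : Below M G) : Below N G :=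
  fun n hn => hG n (h.trans hn)

theorem Below.add {N : ℕ} {G K : FockFin d} (hG : Below N G) (hK : Below N K) :
    Below N (G + K) := fun n hn => by
  rw [Submodule.coe_add, lp.coeFn_add, Pi.add_apply, hG n hn, hK n hn, add_zero]

theorem Below.smul {N : ℕ} {G : FockFin d} (hG : Below N G) (c : ℂ) : Below N (c • G) :=
  fun n hn => by
  rw [Submodule.coe_smul, lp.coeFn_smul, Pi.smul_apply, hG n hn, smul_zero]

theorem Below.ann {N : ℕ} {G : FockFin d} (hG : Below N G) (u : Lp ℂ 2 (μX d)) :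
    Below N (ann u G) := by
  obtain ⟨g, -, hr, hz⟩ := hG.exists_isL2Wave
  exact (represents_ann EventuallyEq.rfl hr).below fun n hn =>
    annihilation_fin (pair_smul u) hz n (by omega)

theorem Below.cre {N : ℕ} {G : FockFin d} (hG : Below N G) (u : Lp ℂ 2 (μX d)) :
    Below (N + 1) (cre u G) := by
  obtain ⟨g, -, hr, hz⟩ := hG.exists_isL2Wave
  exact (represents_cre EventuallyEq.rfl hr).below (creation_fin hz)

/-- A Bessel inequality for a family of one-particle vectors yields one for the annihilation
operators on vectors with fewer than `N` particles. -/
theorem Below.sum_norm_ann_sq_le {N : ℕ} {G : FockFin d} (hG : Below N G) {ι : Type*} (s : Finset ι)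
    (w : ι → Lp ℂ 2 (μX d)) {B : ℝ} (hB0 : 0 ≤ B)
    (hB : ∀ h : Lp ℂ 2 (μX d), ∑ j ∈ s, ‖(inner ℂ (w j) h : ℂ)‖ ^ 2 ≤ B * ‖h‖ ^ 2) :
    ∑ j ∈ s, ‖FermiGas.ann (w j) G‖ ^ 2 ≤ N * B * ‖G‖ ^ 2 := by
  obtain ⟨g, hg, hr, hz⟩ := hG.exists_isL2Wave
  have hmeas : ∀ n, StronglyMeasurable fun p : X d × (Fin n → X d) =>
      g (n + 1) (Fin.cons (α := fun _ => X d) p.1 p.2) := IsL2Wave.meas_cons hg.meas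
  have h1 : ∀ j n, ∫⁻ y, ‖annihilation (pair (w j)) g n y‖ₑ ^ 2 ∂(μ d n)
      = (n + 1) * ∫⁻ y, ‖pair (w j) fun z => g (n + 1) (Fin.cons z y)‖ₑ ^ 2 ∂(μ d n) := by
    intro j n
    rw [← lintegral_const_mul']
    · refine lintegral_congr fun y => ?_
      rw [annihilation, enorm_mul, mul_pow]
      congr 1
      rw [← ofReal_norm, ← ENNReal.ofReal_pow (norm_nonneg _), Complex.norm_real,
        Real.norm_eq_abs, sq_abs, Real.sq_sqrt (by positivity),
        ENNReal.ofReal_add (by positivity) (by positivity)]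
      simp
    · finiteness
  have hslice : ∀ n, ∫⁻ y, (∑ j ∈ s, ‖pair (w j) fun z => g (n + 1) (Fin.cons z y)‖ₑ ^ 2) ∂(μ d n)
      ≤ ENNReal.ofReal B * ∫⁻ y, ‖g (n + 1) y‖ₑ ^ 2 ∂(μ d (n + 1)) := by
    intro n
    rw [lintegral_cons, lintegral_prod_symm' _ ((hmeas n).enorm.pow_const 2),
      ← lintegral_const_mul' _ _ ENNReal.ofReal_ne_top]
    refine lintegral_mono_ae ?_
    filter_upwards [hg.ae_memLp_cons n] with y hy
    have h2 := hB (hy.toLp _)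
    have h3 : ∀ j, pair (w j) (fun z => g (n + 1) (Fin.cons z y)) = inner ℂ (w j) (hy.toLp _) := by
      intro j
      rw [inner_eq_pair]
      refine integral_congr_ae ?_
      filter_upwards [hy.coeFn_toLp] with z hz
      rw [hz]
    have h4 : ∫⁻ z, ‖g (n + 1) (Fin.cons z y)‖ₑ ^ 2 ∂(μX d)
        = ENNReal.ofReal (‖hy.toLp _‖ ^ 2) := by
      have h5 := Lp.enorm_def (hy.toLp _)
      rw [eLpNorm_congr_ae hy.coeFn_toLp,
        eLpNorm_eq_lintegral_rpow_enorm_toReal (by norm_num) (by norm_num)] at h5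
      rw [ENNReal.ofReal_pow (norm_nonneg _), ofReal_norm, h5, ← ENNReal.rpow_natCast,
        ← ENNReal.rpow_mul]
      norm_num
    rw [h4, ← ENNReal.ofReal_mul hB0]
    refine le_trans (le_of_eq ?_) (ENNReal.ofReal_le_ofReal h2)
    rw [ENNReal.ofReal_sum_of_nonneg fun _ _ => by positivity]
    refine Finset.sum_congr rfl fun j _ => ?_
    rw [h3, ENNReal.ofReal_pow (norm_nonneg _), ofReal_norm]
  have hpm : ∀ j n, Measurable fun y : Fin n → X d =>
      ‖pair (w j) fun z => g (n + 1) (Fin.cons z y)‖ₑ ^ 2 := by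
    intro j n
    have h : StronglyMeasurable fun p : X d × (Fin n → X d) =>
        conj (w j p.1) * g (n + 1) (Fin.cons (α := fun _ => X d) p.1 p.2) :=
      ((Complex.continuous_conj.comp_stronglyMeasurable
        (stronglyMeasurable_coe (w j))).comp_measurable measurable_fst).mul (hmeas n)
    exact h.integral_prod_left'.enorm.pow_const 2
  have key : ∑ j ∈ s, ‖FermiGas.ann (w j) G‖ₑ ^ 2
      ≤ N * ENNReal.ofReal B * ‖G‖ₑ ^ 2 := by
    calc ∑ j ∈ s, ‖FermiGas.ann (w j) G‖ₑ ^ 2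
        = ∑' n : ℕ, ∑ j ∈ s, ((n : ℝ≥0∞) + 1) *
            ∫⁻ y, ‖pair (w j) fun z => g (n + 1) (Fin.cons z y)‖ₑ ^ 2 ∂(μ d n) := by
          rw [Summable.tsum_finsetSum fun _ _ => ENNReal.summable]
          refine Finset.sum_congr rfl fun j _ => ?_
          rw [(represents_ann EventuallyEq.rfl hr).enorm_sq]
          exact tsum_congr fun n => h1 j n
      _ ≤ ∑' n : ℕ, N * ENNReal.ofReal B * ∫⁻ y, ‖g (n + 1) y‖ₑ ^ 2 ∂(μ d (n + 1)) := by
          refine ENNReal.tsum_le_tsum fun n => ?_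
          by_cases hn : N ≤ n + 1
          · have h0 : ∀ j, (pair (w j) fun _ => 0) = 0 := fun j => by simp [pair]
            simp [hz (n + 1) hn, h0]
          · rw [← Finset.mul_sum, ← lintegral_finsetSum _ fun j _ => hpm j n, mul_assoc]
            refine mul_le_mul' ?_ (hslice n)
            exact_mod_cast (by omega : n + 1 ≤ N)
      _ ≤ N * ENNReal.ofReal B * ‖G‖ₑ ^ 2 := by
          rw [ENNReal.tsum_mul_left, hr.enorm_sq]
          refine mul_le_mul' le_rfl ?_
          exact ENNReal.tsum_comp_le_tsum_of_injective (add_left_injective 1)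
            (fun n => ∫⁻ y, ‖g n y‖ₑ ^ 2 ∂(μ d n))
  have h6 : ∀ K : FockFin d, ‖K‖ₑ ^ 2 = ENNReal.ofReal (‖K‖ ^ 2) := fun K => by
    rw [ENNReal.ofReal_pow (norm_nonneg _), ofReal_norm]
  simp only [h6] at key
  rw [← ENNReal.ofReal_sum_of_nonneg fun _ _ => by positivity, ← ENNReal.ofReal_natCast,
    ← ENNReal.ofReal_mul (by positivity), ← ENNReal.ofReal_mul (by positivity),
    ENNReal.ofReal_le_ofReal_iff (by positivity)] at key
  exact key

/-! ### Fourier multipliers on the one-particle space -/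

/-- The one-particle space `L²(ℝ^d)`. -/
abbrev H1 (d : ℕ) : Type := Lp ℂ 2 (volume : Measure (E d))

/-- Bounded measurable functions, as multipliers of `L²(ℝ^d)`. -/
structure BddMul (d : ℕ) where
  toFun : E d → ℂ
  aesm : AEStronglyMeasurable toFun volume
  bdd : ∃ C : ℝ, 0 ≤ C ∧ ∀ x, ‖toFun x‖ ≤ C

namespace BddMul

theorem memLp (m : BddMul d) (u : H1 d) : MemLp (fun x => m.toFun x * u x) 2 volume := by
  obtain ⟨C, -, hC⟩ := m.bdd
  refine (Lp.memLp u).of_le_mul (c := C) (m.aesm.mul (Lp.aestronglyMeasurable u))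
    (Eventually.of_forall fun x => ?_)
  rw [norm_mul]
  exact mul_le_mul_of_nonneg_right (hC x) (norm_nonneg _)

/-- Multiplication by a bounded function. -/
def op (m : BddMul d) : H1 d →L[ℂ] H1 d :=
  LinearMap.mkContinuous
    { toFun := fun u => (m.memLp u).toLp _
      map_add' := fun u v => by
        rw [← MemLp.toLp_add]
        refine MemLp.toLp_congr _ _ ?_
        filter_upwards [Lp.coeFn_add u v] with x hx
        simp only [hx, Pi.add_apply, mul_add]
      map_smul' := fun c u => by
        rw [RingHom.id_apply, ← MemLp.toLp_const_smul]
        refine MemLp.toLp_congr _ _ ?_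
        filter_upwards [Lp.coeFn_smul c u] with x hx
        simp only [hx, Pi.smul_apply, smul_eq_mul]
        ring }
    m.bdd.choose fun u => by
      refine Lp.norm_le_mul_norm_of_ae_le_mul ?_
      filter_upwards [(m.memLp u).coeFn_toLp] with x hx
      change ‖(m.memLp u).toLp _ x‖ ≤ _
      rw [hx, norm_mul]
      exact mul_le_mul_of_nonneg_right (m.bdd.choose_spec.2 x) (norm_nonneg _)

theorem op_ae (m : BddMul d) (u : H1 d) : m.op u =ᵐ[volume] fun x => m.toFun x * u x :=
  (m.memLp u).coeFn_toLp

theorem inner_op (m : BddMul d) (hm : ∀ x, conj (m.toFun x) = m.toFun x) (u v : H1 d) :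
    inner ℂ (m.op u) v = inner ℂ u (m.op v) := by
  rw [L2.inner_def, L2.inner_def]
  refine integral_congr_ae ?_
  filter_upwards [m.op_ae u, m.op_ae v] with x h1 h2
  rw [h1, h2, RCLike.inner_apply, RCLike.inner_apply, map_mul, hm]
  ring

end BddMul

/-- The `L²` Fourier transform as an isometry. -/
abbrev FT (d : ℕ) : H1 d ≃ₗᵢ[ℂ] H1 d := Lp.fourierTransformₗᵢ (E d) ℂ

/-- The Fourier multiplier with a bounded symbol. -/
def fmul (m : BddMul d) : H1 d →L[ℂ] H1 d :=
  (FT d).symm.toContinuousLinearEquiv.toContinuousLinearMap ∘L m.op ∘L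
    (FT d).toContinuousLinearEquiv.toContinuousLinearMap

theorem fmul_apply (m : BddMul d) (u : H1 d) : fmul m u = (FT d).symm (m.op (FT d u)) := rfl

theorem inner_fmul (m : BddMul d) (hm : ∀ x, conj (m.toFun x) = m.toFun x) (u v : H1 d) :
    inner ℂ (fmul m u) v = inner ℂ u (fmul m v) := by
  rw [fmul_apply, fmul_apply, ← (FT d).inner_map_map ((FT d).symm _) v,
    ← (FT d).inner_map_map u, LinearIsometryEquiv.apply_symm_apply,
    LinearIsometryEquiv.apply_symm_apply, m.inner_op hm]

/-- The inverse `L²` Fourier transform of a function in `L¹ ∩ L²` is given by the Fourier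
integral. -/
theorem fourierInv_toLp_ae {θ : E d → ℂ} (h1 : Integrable θ) (h2 : MemLp θ 2 volume) :
    ((FT d).symm (h2.toLp θ) : E d → ℂ) =ᵐ[volume] 𝓕⁻ θ := by
  have hc : Continuous (𝓕⁻ θ) := by
    have := VectorFourier.fourierIntegral_continuous (L := -innerₗ (E d))
      Real.continuous_fourierChar
      (by simp only [LinearMap.neg_apply, innerₗ_apply_apply]; fun_prop) h1
    exact this
  refine ae_eq_of_integral_contDiff_smul_eq ((Lp.memLp _).locallyIntegrable (by norm_num))
    hc.locallyIntegrable fun g hg hs => ?_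
  have hs' : HasCompactSupport fun x => (g x : ℂ) := hs.comp_left (g := fun r : ℝ => (r : ℂ)) rfl
  have hg' : ContDiff ℝ (⊤ : ℕ∞) fun x => (g x : ℂ) := Complex.ofRealCLM.contDiff.comp hg
  let φ : 𝓢(E d, ℂ) := hs'.toSchwartzMap hg'
  have hφ : ∀ x, φ x = (g x : ℂ) := fun x => rfl
  have e1 := congrArg (fun T => T φ) (Lp.fourierInv_toTemperedDistribution_eq (h2.toLp θ))
  simp only [TemperedDistribution.fourierInv_apply, Lp.toTemperedDistribution_apply] at e1
  have e2 : ∫ x, g x • ((FT d).symm (h2.toLp θ) : E d → ℂ) x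
      = ∫ x, φ x • ((𝓕⁻ (h2.toLp θ) : H1 d) : E d → ℂ) x := by
    refine integral_congr_ae (Eventually.of_forall fun x => ?_)
    simp only [hφ]
    rfl
  rw [e2, ← e1]
  have e3 : ∫ x, 𝓕⁻ φ x • (h2.toLp θ : E d → ℂ) x = ∫ x, 𝓕⁻ (φ : E d → ℂ) x • θ x := by
    refine integral_congr_ae ?_
    filter_upwards [h2.coeFn_toLp] with x hx
    rw [hx, SchwartzMap.fourierInv_coe]
  rw [e3]
  have e4 := VectorFourier.integral_fourierIntegral_smul_eq_flip (L := -innerₗ (E d))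
    (μ := volume) (ν := volume) Real.continuous_fourierChar
    (by simp only [LinearMap.neg_apply, innerₗ_apply_apply]; fun_prop) φ.integrable h1
  have e5 : (-innerₗ (E d)).flip = -innerₗ (E d) := by
    ext x y; simp [real_inner_comm]
  rw [e5] at e4
  refine e4.trans (integral_congr_ae (Eventually.of_forall fun x => ?_))
  simp only [hφ]
  rfl

theorem integral_fourier_mul_toLp (θ u : H1 d) :
    ∫ x, θ x * FT d u x = ∫ x, FT d θ x * u x := by
  let B := ContinuousLinearMap.lpPairing (volume : Measure (E d)) 2 2 (ContinuousLinearMap.mul ℂ ℂ)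
  have hB : ∀ f g : H1 d, B f g = ∫ x, f x * g x := fun f g =>
    ContinuousLinearMap.lpPairing_eq_integral _ f g
  rw [← hB, ← hB]
  refine DenseRange.induction_on (p := fun u => B θ (FT d u) = B (FT d θ) u)
    (SchwartzMap.denseRange_toLpCLM (p := 2) ENNReal.ofNat_ne_top) u ?_ ?_
  · exact isClosed_eq ((B θ).continuous.comp (FT d).continuous) (B (FT d θ)).continuous
  · intro φ
    have e1 := congrArg (fun T => T φ) (Lp.fourier_toTemperedDistribution_eq θ)
    simp only [TemperedDistribution.fourier_apply, Lp.toTemperedDistribution_apply] at e1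
    have e0 : FT d (φ.toLp 2) = (𝓕 φ).toLp 2 := SchwartzMap.toLp_fourier_eq φ
    rw [SchwartzMap.toLpCLM_apply, e0, hB, hB]
    calc ∫ x, θ x * (𝓕 φ).toLp 2 volume x = ∫ x, (𝓕 φ) x • θ x := by
          refine integral_congr_ae ?_
          filter_upwards [(𝓕 φ).coeFn_toLp 2 volume] with x hx
          rw [hx, smul_eq_mul, mul_comm]
      _ = _ := e1
      _ = _ := by
          refine integral_congr_ae ?_
          filter_upwards [φ.coeFn_toLp 2 volume] with x hx
          rw [hx, smul_eq_mul, mul_comm]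
          rfl

/-- The multiplier `e^{2πi y·ξ}`. -/
def phase (y : E d) : BddMul d where
  toFun ξ := (Real.fourierChar (inner ℝ ξ y) : ℂ)
  aesm := (by fun_prop : Continuous fun ξ : E d =>
    (Real.fourierChar (inner ℝ ξ y) : ℂ)).aestronglyMeasurable
  bdd := ⟨1, zero_le_one, fun x => (Circle.norm_coe _).le⟩

theorem measurePreserving_sub_left (y : E d) :
    MeasurePreserving (fun x : E d => y - x) volume volume := by
  have h := (measurePreserving_add_left (volume : Measure (E d)) y).comp
    (Measure.measurePreserving_neg (volume : Measure (E d)))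
  convert h using 1
  funext x; simp [sub_eq_add_neg]

/-- The Fourier transform turns the phase `e^{2πi y·ξ}` into a reflected translation. -/
theorem fourier_phase (y : E d) (θ : H1 d) :
    FT d ((phase y).op θ)
      = Lp.compMeasurePreservingₗᵢ ℂ _ (measurePreserving_sub_left y) ((FT d).symm θ) := by
  refine DenseRange.induction_on (p := fun θ => FT d ((phase y).op θ)
      = Lp.compMeasurePreservingₗᵢ ℂ _ (measurePreserving_sub_left y) ((FT d).symm θ))
    (SchwartzMap.denseRange_toLpCLM (p := 2) ENNReal.ofNat_ne_top) θ ?_ ?_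
  · exact isClosed_eq ((FT d).continuous.comp (phase y).op.continuous)
      ((LinearIsometry.continuous _).comp (FT d).symm.continuous)
  · intro φ
    rw [SchwartzMap.toLpCLM_apply]
    have e0 : (FT d).symm (φ.toLp 2) = (𝓕⁻ φ).toLp 2 := SchwartzMap.toLp_fourierInv_eq φ
    rw [e0]
    have hi : Integrable fun x => 𝓕⁻ φ (y - x) :=
      ((measurePreserving_sub_left y).integrable_comp
        (𝓕⁻ φ).continuous.aestronglyMeasurable).2 (𝓕⁻ φ).integrable
    have h2 : MemLp (fun x => 𝓕⁻ φ (y - x)) 2 volume :=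
      ((𝓕⁻ φ).memLp 2).comp_measurePreserving (measurePreserving_sub_left y)
    have e1 : Lp.compMeasurePreservingₗᵢ ℂ _ (measurePreserving_sub_left y) ((𝓕⁻ φ).toLp 2)
        = h2.toLp _ := by
      refine Lp.ext ?_
      refine (Lp.coeFn_compMeasurePreserving _ (measurePreserving_sub_left y)).trans ?_
      refine EventuallyEq.trans ?_ h2.coeFn_toLp.symm
      exact (measurePreserving_sub_left y).quasiMeasurePreserving.ae ((𝓕⁻ φ).coeFn_toLp 2 volume)
    rw [e1, ← LinearIsometryEquiv.eq_symm_apply]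
    refine Lp.ext ?_
    refine EventuallyEq.trans ?_ (fourierInv_toLp_ae hi h2).symm
    refine ((phase y).op_ae _).trans ?_
    filter_upwards [φ.coeFn_toLp 2 volume] with ξ hξ
    have e2 : φ ξ = 𝓕 ((𝓕⁻ φ : 𝓢(E d, ℂ)) : E d → ℂ) ξ := by
      rw [← SchwartzMap.fourier_coe, FourierTransform.fourier_fourierInv_eq]
    rw [hξ, e2, Real.fourierInv_eq, Real.fourier_eq,
      ← (measurePreserving_sub_left y).integral_comp
        (MeasurableEquiv.subLeft y).measurableEmbedding, ← integral_const_mul]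
    refine integral_congr_ae (Eventually.of_forall fun x => ?_)
    simp only [phase, Circle.smul_def, smul_eq_mul, ← mul_assoc]
    congr 1
    rw [← Circle.coe_mul, ← AddChar.map_add_eq_mul]
    congr 3
    rw [inner_sub_left, real_inner_comm y ξ]
    ring

theorem enorm_sq_eq_lintegral {α : Type*} [MeasurableSpace α] {m : Measure α} (u : Lp ℂ 2 m) :
    ‖u‖ₑ ^ 2 = ∫⁻ x, ‖u x‖ₑ ^ 2 ∂m := by
  rw [Lp.enorm_def u, eLpNorm_eq_lintegral_rpow_enorm_toReal (by norm_num) (by norm_num),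
    ← ENNReal.rpow_natCast, ← ENNReal.rpow_mul]
  norm_num

theorem fourier_comp_add_left (h : E d → ℂ) (x ξ : E d) :
    𝓕 (fun z => h (x + z)) ξ = Real.fourierChar (inner ℝ ξ x) • 𝓕 h ξ := by
  rw [Real.fourier_eq, Real.fourier_eq]
  rw [← integral_add_left_eq_self (μ := volume)
    (fun v => Real.fourierChar (-inner ℝ v ξ) • h v) x, Circle.smul_def, ← integral_smul]
  refine integral_congr_ae (Eventually.of_forall fun z => ?_)
  simp only [Circle.smul_def, smul_smul]
  congr 1
  rw [← Circle.coe_mul, ← AddChar.map_add_eq_mul]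
  congr 2
  rw [inner_add_left, real_inner_comm x ξ]
  ring

namespace MomentumDensity

variable (k : MomentumDensity d)

theorem aesm_scaled : AEStronglyMeasurable (fun ξ : E d => k.toFun ((2 * Real.pi) • ξ)) volume :=
  (k.integrable.comp_smul (by positivity)).aestronglyMeasurable

/-- The symbol `k̂^{1/2}`. -/
def mul1 : BddMul d where
  toFun := k.sqrtDensity
  aesm := k.memLp_sqrtDensity.1
  bdd := ⟨1, zero_le_one, fun ξ => by
    rw [sqrtDensity, Complex.norm_real, Real.norm_eq_abs, abs_of_nonneg (Real.sqrt_nonneg _)]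
    exact Real.sqrt_le_one.2 (k.le_one _)⟩

/-- The symbol `(1 - k̂)^{1/2}`. -/
def mul2 : BddMul d where
  toFun := k.sqrtCoDensity
  aesm := (Complex.continuous_ofReal.comp Real.continuous_sqrt).comp_aestronglyMeasurable
    (aestronglyMeasurable_const.sub k.aesm_scaled)
  bdd := ⟨1, zero_le_one, fun ξ => by
    rw [sqrtCoDensity, Complex.norm_real, Real.norm_eq_abs, abs_of_nonneg (Real.sqrt_nonneg _)]
    exact Real.sqrt_le_one.2 (by linarith [k.nonneg ((2 * Real.pi) • ξ)])⟩

/-- The operator `k̂^{1/2}`, the convolution with `κ₁`. -/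
def K1 : H1 d →L[ℂ] H1 d := fmul k.mul1

/-- The operator `(1 - k̂)^{1/2}`, formally the convolution with `κ₂`. -/
def K2 : H1 d →L[ℂ] H1 d := fmul k.mul2

theorem inner_K2 (u v : H1 d) : inner ℂ (k.K2 u) v = inner ℂ u (k.K2 v) :=
  inner_fmul _ (fun _ => Complex.conj_ofReal _) u v

/-- The Fourier multipliers `k̂^{1/2}` and `(1 - k̂)^{1/2}` have squares adding up to one. -/
theorem inner_K1_add_inner_K2 (u v : H1 d) :
    inner ℂ (k.K2 u) (k.K2 v) + inner ℂ (k.K1 u) (k.K1 v) = (inner ℂ u v : ℂ) := by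
  rw [K1, K2, fmul_apply, fmul_apply, fmul_apply, fmul_apply, LinearIsometryEquiv.inner_map_map,
    LinearIsometryEquiv.inner_map_map, ← (FT d).inner_map_map u v, L2.inner_def, L2.inner_def,
    L2.inner_def, ← integral_add (L2.integrable_inner _ _) (L2.integrable_inner _ _)]
  refine integral_congr_ae ?_
  filter_upwards [k.mul1.op_ae (FT d u), k.mul1.op_ae (FT d v), k.mul2.op_ae (FT d u),
    k.mul2.op_ae (FT d v)] with ξ h1 h2 h3 h4
  rw [h1, h2, h3, h4]
  simp only [RCLike.inner_apply, map_mul, mul1, mul2, sqrtDensity, sqrtCoDensity,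
    Complex.conj_ofReal]
  have e1 : (Real.sqrt (k.toFun ((2 * Real.pi) • ξ)) : ℂ)
      * Real.sqrt (k.toFun ((2 * Real.pi) • ξ)) = k.toFun ((2 * Real.pi) • ξ) := by
    rw [← Complex.ofReal_mul, Real.mul_self_sqrt (k.nonneg _)]
  have e2 : (Real.sqrt (1 - k.toFun ((2 * Real.pi) • ξ)) : ℂ)
      * Real.sqrt (1 - k.toFun ((2 * Real.pi) • ξ)) = 1 - k.toFun ((2 * Real.pi) • ξ) := by
    rw [← Complex.ofReal_mul, Real.mul_self_sqrt (by linarith [k.le_one ((2 * Real.pi) • ξ)])]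
    simp
  linear_combination (FT d v ξ * conj (FT d u ξ)) * (e1 + e2)

theorem norm_K2_le (u : H1 d) : ‖k.K2 u‖ ≤ ‖u‖ := by
  have h := k.inner_K1_add_inner_K2 u u
  rw [inner_self_eq_norm_sq_to_K, inner_self_eq_norm_sq_to_K, inner_self_eq_norm_sq_to_K] at h
  have h' : ‖k.K2 u‖ ^ 2 + ‖k.K1 u‖ ^ 2 = ‖u‖ ^ 2 := by exact_mod_cast h
  exact le_of_sq_le_sq (by nlinarith [sq_nonneg ‖k.K1 u‖]) (norm_nonneg _)

theorem norm_K1_le (u : H1 d) : ‖k.K1 u‖ ≤ ‖u‖ := by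
  have h := k.inner_K1_add_inner_K2 u u
  rw [inner_self_eq_norm_sq_to_K, inner_self_eq_norm_sq_to_K, inner_self_eq_norm_sq_to_K] at h
  have h' : ‖k.K2 u‖ ^ 2 + ‖k.K1 u‖ ^ 2 = ‖u‖ ^ 2 := by exact_mod_cast h
  exact le_of_sq_le_sq (by nlinarith [sq_nonneg ‖k.K2 u‖]) (norm_nonneg _)

/-- The pairing with `κ_{2,x}` of a Schwartz function `h` is `(K₂ h)(x)`. -/
theorem kappa2_ae (h : 𝓢(E d, ℂ)) :
    (k.K2 (h.toLp 2) : E d → ℂ) =ᵐ[volume] fun x => k.kappa2 fun z => h (x + z) := by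
  have hi : Integrable fun ξ => k.sqrtCoDensity ξ * 𝓕 h ξ :=
    (𝓕 h).integrable.bdd_mul k.mul2.aesm (Eventually.of_forall k.mul2.bdd.choose_spec.2)
  have h2 : MemLp (fun ξ => k.sqrtCoDensity ξ * 𝓕 h ξ) 2 volume := by
    refine (memLp_congr_ae ?_).1 (k.mul2.memLp ((𝓕 h).toLp 2))
    filter_upwards [(𝓕 h).coeFn_toLp 2 volume] with ξ hξ
    rw [hξ]; rfl
  have e0 : FT d (h.toLp 2) = (𝓕 h).toLp 2 := SchwartzMap.toLp_fourier_eq h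
  have e1 : k.mul2.op (FT d (h.toLp 2)) = h2.toLp _ := by
    refine Lp.ext ((k.mul2.op_ae _).trans (EventuallyEq.trans ?_ h2.coeFn_toLp.symm))
    rw [e0]
    filter_upwards [(𝓕 h).coeFn_toLp 2 volume] with ξ hξ
    rw [hξ]; rfl
  rw [K2, fmul_apply, e1]
  refine (fourierInv_toLp_ae hi h2).trans (Eventually.of_forall fun x => ?_)
  rw [Real.fourierInv_eq]
  change _ = ∫ ξ, k.sqrtCoDensity ξ * 𝓕 (fun z => h (x + z)) ξ
  refine integral_congr_ae (Eventually.of_forall fun ξ => ?_)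
  have e3 : 𝓕 (fun z => h (x + z)) ξ = Real.fourierChar (inner ℝ ξ x) • 𝓕 h ξ := by
    rw [fourier_comp_add_left h x ξ, SchwartzMap.fourier_coe]
  simp only [e3, Circle.smul_def, smul_eq_mul]
  ring

theorem kappa1_stronglyMeasurable : StronglyMeasurable k.kappa1 := Lp.stronglyMeasurable _

theorem kappa1_memLp : MemLp k.kappa1 2 volume := Lp.memLp _

theorem kappa1_sub_memLp (y : E d) : MemLp (fun x => k.kappa1 (y - x)) 2 volume :=
  k.kappa1_memLp.comp_measurePreserving (measurePreserving_sub_left y)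

/-- `K₁` is the convolution with `κ₁`. -/
theorem K1_ae (u : H1 d) :
    (k.K1 u : E d → ℂ) =ᵐ[volume] fun y => ∫ x, k.kappa1 (y - x) * u x := by
  let S : H1 d := k.memLp_sqrtDensity.toLp k.sqrtDensity
  have h2 : MemLp (fun ξ => k.sqrtDensity ξ * FT d u ξ) 2 volume := k.mul1.memLp (FT d u)
  have hi : Integrable fun ξ => k.sqrtDensity ξ * FT d u ξ :=
    MemLp.integrable_mul (p := 2) (q := 2) k.memLp_sqrtDensity (Lp.memLp _)
  have e1 : k.mul1.op (FT d u) = h2.toLp _ := rfl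
  rw [K1, fmul_apply, e1]
  refine (fourierInv_toLp_ae hi h2).trans (Eventually.of_forall fun y => ?_)
  have e2 : 𝓕⁻ (fun ξ => k.sqrtDensity ξ * FT d u ξ) y
      = ∫ ξ, (phase y).op S ξ * FT d u ξ := by
    rw [Real.fourierInv_eq]
    refine integral_congr_ae ?_
    filter_upwards [(phase y).op_ae S, k.memLp_sqrtDensity.coeFn_toLp] with ξ h3 h4
    rw [h3, h4]
    simp only [phase, Circle.smul_def, smul_eq_mul, mul_assoc]
  rw [e2, integral_fourier_mul_toLp, fourier_phase]
  refine integral_congr_ae ?_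
  filter_upwards [Lp.coeFn_compMeasurePreserving ((FT d).symm S) (measurePreserving_sub_left y)]
    with x hx
  have : (Lp.compMeasurePreservingₗᵢ ℂ _ (measurePreserving_sub_left y) ((FT d).symm S)
    : E d → ℂ) x = k.kappa1 (y - x) := hx
  rw [this]

/-- Composed with the multiplication by a square-integrable bounded function, `K₁` is a
Hilbert–Schmidt operator. -/
theorem sum_norm_K1_sq_le {ι : Type*} {e : ι → H1 d} (he : Orthonormal ℂ e)
    (p : BddMul d) (hp : MemLp p.toFun 2 volume) :
    ∃ C : ℝ, 0 ≤ C ∧ ∀ s : Finset ι, ∑ j ∈ s, ‖k.K1 (p.op (e j))‖ ^ 2 ≤ C := by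
  have hk := lintegral_enorm_sq_lt_top k.kappa1_memLp
  have hp' := lintegral_enorm_sq_lt_top hp
  obtain ⟨Cp, hCp0, hCp⟩ := p.bdd
  have hg : ∀ y, MemLp (fun x => conj (k.kappa1 (y - x) * p.toFun x)) 2 volume := by
    intro y
    refine (k.kappa1_sub_memLp y).of_le_mul (c := Cp)
      (Complex.continuous_conj.comp_aestronglyMeasurable ((k.kappa1_sub_memLp y).1.mul p.aesm))
      (Eventually.of_forall fun x => ?_)
    rw [RCLike.norm_conj, norm_mul, mul_comm]
    exact mul_le_mul_of_nonneg_right (hCp x) (norm_nonneg _)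
  have hin : ∀ j, (k.K1 (p.op (e j)) : E d → ℂ) =ᵐ[volume]
      fun y => inner ℂ ((hg y).toLp _) (e j) := by
    intro j
    refine (k.K1_ae _).trans (Eventually.of_forall fun y => ?_)
    dsimp only
    rw [L2.inner_def]
    refine integral_congr_ae ?_
    filter_upwards [p.op_ae (e j), (hg y).coeFn_toLp] with x h1 h2
    rw [h1, h2, RCLike.inner_apply, Complex.conj_conj]
    ring
  have hn : ∀ y, ‖(hg y).toLp _‖ₑ ^ 2
      = ∫⁻ x, ‖k.kappa1 (y - x)‖ₑ ^ 2 * ‖p.toFun x‖ₑ ^ 2 := by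
    intro y
    rw [enorm_sq_eq_lintegral]
    refine lintegral_congr_ae ?_
    filter_upwards [(hg y).coeFn_toLp] with x hx
    rw [hx, RCLike.enorm_conj, enorm_mul, mul_pow]
  have htot : ∫⁻ y, ∫⁻ x, ‖k.kappa1 (y - x)‖ₑ ^ 2 * ‖p.toFun x‖ₑ ^ 2
      = (∫⁻ x, ‖k.kappa1 x‖ₑ ^ 2) * ∫⁻ x, ‖p.toFun x‖ₑ ^ 2 := by
    rw [lintegral_lintegral_swap]
    · have h1 : ∀ x, ∫⁻ y, ‖k.kappa1 (y - x)‖ₑ ^ 2 * ‖p.toFun x‖ₑ ^ 2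
          = (∫⁻ x, ‖k.kappa1 x‖ₑ ^ 2) * ‖p.toFun x‖ₑ ^ 2 := by
        intro x
        rw [lintegral_mul_const' _ _ (by finiteness),
          lintegral_sub_right_eq_self (fun y => ‖k.kappa1 y‖ₑ ^ 2) x]
      simp only [h1]
      rw [lintegral_const_mul' _ _ hk.ne]
    · have h1 : AEMeasurable (fun q : E d × E d => ‖k.kappa1 (q.1 - q.2)‖ₑ ^ 2)
          (volume.prod volume) := ((k.kappa1_stronglyMeasurable.comp_measurable
          (measurable_fst.sub measurable_snd)).enorm.pow_const 2).aemeasurable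
      have h2 : AEMeasurable (fun q : E d × E d => ‖p.toFun q.2‖ₑ ^ 2)
          (volume.prod volume) := p.aesm.comp_snd.enorm.pow_const 2
      exact h1.mul h2
  refine ⟨((∫⁻ x, ‖k.kappa1 x‖ₑ ^ 2) * ∫⁻ x, ‖p.toFun x‖ₑ ^ 2).toReal, ENNReal.toReal_nonneg,
    fun s => ?_⟩
  rw [← ENNReal.ofReal_le_iff_le_toReal (ENNReal.mul_ne_top hk.ne hp'.ne),
    ENNReal.ofReal_sum_of_nonneg fun _ _ => by positivity]
  have h6 : ∀ K : H1 d, ENNReal.ofReal (‖K‖ ^ 2) = ∫⁻ x, ‖K x‖ₑ ^ 2 := fun K => by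
    rw [ENNReal.ofReal_pow (norm_nonneg _), ofReal_norm, enorm_sq_eq_lintegral]
  simp only [h6]
  rw [← lintegral_finsetSum _ fun j _ => (Lp.stronglyMeasurable _).enorm.pow_const 2, ← htot]
  refine lintegral_mono_ae ?_
  have hall : ∀ᵐ y, ∀ j ∈ s, (k.K1 (p.op (e j)) : E d → ℂ) y
      = inner ℂ ((hg y).toLp _) (e j) := (ae_ball_iff s.countable_toSet).2 fun j _ => hin j
  filter_upwards [hall] with y hy
  rw [← hn]
  have hb := he.sum_inner_products_le ((hg y).toLp _) (s := s)
  calc ∑ j ∈ s, ‖(k.K1 (p.op (e j)) : E d → ℂ) y‖ₑ ^ 2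
      = ENNReal.ofReal (∑ j ∈ s, ‖(inner ℂ (e j) ((hg y).toLp _) : ℂ)‖ ^ 2) := by
        rw [ENNReal.ofReal_sum_of_nonneg fun _ _ => by positivity]
        refine Finset.sum_congr rfl fun j hj => ?_
        rw [hy j hj, ENNReal.ofReal_pow (norm_nonneg _), norm_inner_symm, ofReal_norm]
    _ ≤ _ := by
        rw [← ofReal_norm, ← ENNReal.ofReal_pow (norm_nonneg _)]
        exact ENNReal.ofReal_le_ofReal hb

end MomentumDensity

/-! ### The smeared fields -/

theorem lintegral_μX {F : X d → ℝ≥0∞} (hF : AEMeasurable F (μX d)) :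
    ∫⁻ z, F z ∂(μX d) = ∑ s, ∫⁻ x, F (s, x) := by
  rw [μX, lintegral_prod _ hF, lintegral_count, tsum_fintype]

/-- The function supported on the copy with label `s`, where it equals `u`. -/
def onLabel (s : Fin 2) (u : E d → ℂ) : X d → ℂ := fun z => if z.1 = s then u z.2 else 0

theorem onLabel_stronglyMeasurable (s : Fin 2) {u : E d → ℂ} (hu : StronglyMeasurable u) :
    StronglyMeasurable (onLabel s u) :=
  StronglyMeasurable.ite (measurable_fst (measurableSet_singleton s))
    (hu.comp_measurable measurable_snd) stronglyMeasurable_const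

theorem onLabel_ae {s : Fin 2} {u v : E d → ℂ} (h : u =ᵐ[volume] v) :
    onLabel s u =ᵐ[μX d] onLabel s v := by
  have h' : ∀ᵐ z ∂(μX d), u z.2 = v z.2 := Measure.quasiMeasurePreserving_snd.ae h
  filter_upwards [h'] with z hz
  simp only [onLabel, hz]

theorem lintegral_onLabel (s : Fin 2) {u : E d → ℂ} (hu : AEStronglyMeasurable u volume) :
    ∫⁻ z, ‖onLabel s u z‖ₑ ^ 2 ∂(μX d) = ∫⁻ x, ‖u x‖ₑ ^ 2 := by
  have h1 : AEStronglyMeasurable (onLabel s u) (μX d) :=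
    (onLabel_stronglyMeasurable s hu.stronglyMeasurable_mk).aestronglyMeasurable.congr
      (onLabel_ae hu.ae_eq_mk.symm)
  rw [lintegral_μX (h1.enorm.pow_const 2), Finset.sum_eq_single s]
  · simp [onLabel]
  · intro t _ hts
    simp [onLabel, hts]
  · simp

theorem onLabel_memLp (s : Fin 2) {u : E d → ℂ} (hu : MemLp u 2 volume) :
    MemLp (onLabel s u) 2 (μX d) := by
  refine memLp_two_of_lintegral ?_ ?_
  · exact (onLabel_stronglyMeasurable s hu.1.stronglyMeasurable_mk).aestronglyMeasurable.congr
      (onLabel_ae hu.1.ae_eq_mk.symm)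
  · rw [lintegral_onLabel s hu.1]
    exact lintegral_enorm_sq_lt_top hu

/-- The embedding of `L²(ℝ^d)` as the copy with label `s`. -/
def emb (s : Fin 2) : H1 d →ₗᵢ[ℂ] Lp ℂ 2 (μX d) where
  toFun u := (onLabel_memLp s (Lp.memLp u)).toLp _
  map_add' u v := by
    rw [← MemLp.toLp_add]
    refine MemLp.toLp_congr _ _ ((onLabel_ae (Lp.coeFn_add u v)).trans
      (Eventually.of_forall fun z => ?_))
    by_cases h : z.1 = s <;> simp [onLabel, h]
  map_smul' c u := by
    rw [RingHom.id_apply, ← MemLp.toLp_const_smul]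
    refine MemLp.toLp_congr _ _ ((onLabel_ae (Lp.coeFn_smul c u)).trans
      (Eventually.of_forall fun z => ?_))
    by_cases h : z.1 = s <;> simp [onLabel, h]
  norm_map' u := by
    have h : ‖(onLabel_memLp s (Lp.memLp u)).toLp _‖ₑ ^ 2 = ‖u‖ₑ ^ 2 := by
      rw [enorm_sq_eq_lintegral, enorm_sq_eq_lintegral,
        ← lintegral_onLabel s (Lp.aestronglyMeasurable u)]
      refine lintegral_congr_ae ?_
      filter_upwards [(onLabel_memLp s (Lp.memLp u)).coeFn_toLp] with z hz
      rw [hz]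
    rw [← ofReal_norm, ← ofReal_norm, ← ENNReal.ofReal_pow (norm_nonneg _),
      ← ENNReal.ofReal_pow (norm_nonneg _),
      ENNReal.ofReal_eq_ofReal_iff (by positivity) (by positivity)] at h
    exact (pow_left_inj₀ (norm_nonneg _) (norm_nonneg _) two_ne_zero).1 h

theorem emb_ae (s : Fin 2) (u : H1 d) : (emb s u : X d → ℂ) =ᵐ[μX d] onLabel s u :=
  (onLabel_memLp s (Lp.memLp u)).coeFn_toLp

theorem inner_emb_of_ne {s t : Fin 2} (h : s ≠ t) (u v : H1 d) :
    inner ℂ (emb s u) (emb t v) = (0 : ℂ) := by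
  rw [L2.inner_def]
  refine integral_eq_zero_of_ae ?_
  filter_upwards [emb_ae s u, emb_ae t v] with z h1 h2
  rw [h1, h2]
  by_cases hz : z.1 = s
  · simp [onLabel, hz, h]
  · simp [onLabel, hz]

theorem inner_star_star (u v : H1 d) : inner ℂ (star u) (star v) = (inner ℂ v u : ℂ) := by
  rw [L2.inner_def, L2.inner_def]
  refine integral_congr_ae ?_
  filter_upwards [Lp.coeFn_star u, Lp.coeFn_star v] with x h1 h2
  rw [h1, h2]
  simp only [Pi.star_apply, RCLike.inner_apply, RCLike.star_def, Complex.conj_conj]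
  ring

theorem star_add_H1 (u v : H1 d) : star (u + v) = star u + star v := by
  refine Lp.ext ?_
  filter_upwards [Lp.coeFn_star (u + v), Lp.coeFn_star u, Lp.coeFn_star v, Lp.coeFn_add u v,
    Lp.coeFn_add (star u) (star v)] with x h1 h2 h3 h4 h5
  rw [h1, h5, Pi.star_apply, Pi.add_apply, h4, h2, h3]
  simp

theorem star_smul_H1 (c : ℂ) (u : H1 d) : star (c • u) = conj c • star u := by
  refine Lp.ext ?_
  filter_upwards [Lp.coeFn_star (c • u), Lp.coeFn_star u, Lp.coeFn_smul c u,
    Lp.coeFn_smul (conj c) (star u)] with x h1 h2 h3 h4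
  rw [h1, h4, Pi.star_apply, Pi.smul_apply, h3, h2]
  simp

theorem norm_star_H1 (u : H1 d) : ‖star u‖ = ‖u‖ := by
  have h := inner_star_star u u
  rw [inner_self_eq_norm_sq_to_K, inner_self_eq_norm_sq_to_K] at h
  have h' : ‖star u‖ ^ 2 = ‖u‖ ^ 2 := by exact_mod_cast h
  exact (pow_left_inj₀ (norm_nonneg _) (norm_nonneg _) two_ne_zero).1 h'

namespace MomentumDensity

variable (k : MomentumDensity d)

/-- The one-particle vector `(0, K₂ u)`. -/
def alpha (u : H1 d) : Lp ℂ 2 (μX d) := emb 1 (k.K2 u)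

/-- The one-particle vector `(conj (K₁ u), 0)`. -/
def beta (u : H1 d) : Lp ℂ 2 (μX d) := emb 0 (star (k.K1 u))

theorem inner_alpha_beta (u v : H1 d) : inner ℂ (k.alpha u) (k.beta v) = (0 : ℂ) :=
  inner_emb_of_ne (by decide) _ _

theorem inner_beta_alpha (u v : H1 d) : inner ℂ (k.beta u) (k.alpha v) = (0 : ℂ) :=
  inner_emb_of_ne (by decide) _ _

theorem norm_alpha_le (u : H1 d) : ‖k.alpha u‖ ≤ ‖u‖ := by
  rw [alpha, LinearIsometry.norm_map]; exact k.norm_K2_le u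

theorem norm_beta (u : H1 d) : ‖k.beta u‖ = ‖k.K1 u‖ := by
  rw [beta, LinearIsometry.norm_map, norm_star_H1]

theorem norm_beta_le (u : H1 d) : ‖k.beta u‖ ≤ ‖u‖ := by
  rw [norm_beta]; exact k.norm_K1_le u

/-- The field `ψ` smeared with the complex conjugate of `u`. -/
def b (u : H1 d) : FockFin d →ₗ[ℂ] FockFin d := ann (k.alpha u) + cre (k.beta u)

/-- The field `ψ*` smeared with `u`. -/
def c (u : H1 d) : FockFin d →ₗ[ℂ] FockFin d := cre (k.alpha u) + ann (k.beta u)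

theorem b_apply (u : H1 d) (G : FockFin d) :
    k.b u G = ann (k.alpha u) G + cre (k.beta u) G := rfl

theorem c_apply (u : H1 d) (G : FockFin d) :
    k.c u G = cre (k.alpha u) G + ann (k.beta u) G := rfl

theorem inner_c (u : H1 d) (G K : FockFin d) : inner ℂ (k.c u G) K = inner ℂ G (k.b u K) := by
  rw [c_apply, b_apply, inner_add_left, inner_add_right, inner_cre, inner_ann]

theorem c_add (u v : H1 d) (G : FockFin d) : k.c (u + v) G = k.c u G + k.c v G := by
  simp only [c_apply, alpha, beta, map_add, star_add_H1, cre_add_left, ann_add_left]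
  abel

theorem c_smul (a : ℂ) (u : H1 d) (G : FockFin d) : k.c (a • u) G = a • k.c u G := by
  simp only [c_apply, alpha, beta, map_smul, star_smul_H1, cre_smul_left, ann_smul_left,
    Complex.conj_conj, smul_add]

/-- The smeared fields satisfy the canonical anticommutation relations of the one-particle space
`L²(ℝ^d)`: the scalar products of the two summands add up to `⟨u, v⟩`. -/
theorem b_c (u v : H1 d) (G : FockFin d) :
    k.b u (k.c v G) + k.c v (k.b u G) = (inner ℂ u v : ℂ) • G := by
  have h1 := ann_cre (k.alpha u) (k.alpha v) G
  have h2 := ann_cre (k.beta v) (k.beta u) G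
  have h3 := ann_ann (k.alpha u) (k.beta v) G
  have h4 := cre_cre (k.beta u) (k.alpha v) G
  have h5 : (inner ℂ (k.alpha u) (k.alpha v) + inner ℂ (k.beta v) (k.beta u) : ℂ)
      = inner ℂ u v := by
    rw [alpha, alpha, beta, beta, LinearIsometry.inner_map_map, LinearIsometry.inner_map_map,
      inner_star_star, k.inner_K1_add_inner_K2]
  rw [← h5, add_smul]
  refine Eq.trans ?_ (congrArg₂ (· + ·) h1 h2)
  simp only [c_apply, b_apply, LinearMap.map_add, h3, h4]
  abel

theorem c_c (u v : H1 d) (G : FockFin d) : k.c u (k.c v G) = - k.c v (k.c u G) := by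
  have h1 := ann_cre (k.beta u) (k.alpha v) G
  have h2 := ann_cre (k.beta v) (k.alpha u) G
  have h3 := ann_ann (k.beta u) (k.beta v) G
  have h4 := cre_cre (k.alpha u) (k.alpha v) G
  rw [k.inner_beta_alpha, zero_smul] at h1 h2
  simp only [c_apply, LinearMap.map_add, h3, h4, eq_neg_of_add_eq_zero_left h1,
    eq_neg_of_add_eq_zero_left h2, neg_add]
  abel

theorem b_b (u v : H1 d) (G : FockFin d) : k.b u (k.b v G) = - k.b v (k.b u G) := by
  have h1 := ann_cre (k.alpha u) (k.beta v) G
  have h2 := ann_cre (k.alpha v) (k.beta u) G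
  have h3 := ann_ann (k.alpha u) (k.alpha v) G
  have h4 := cre_cre (k.beta u) (k.beta v) G
  rw [k.inner_alpha_beta, zero_smul] at h1 h2
  simp only [b_apply, LinearMap.map_add, h3, h4, eq_neg_of_add_eq_zero_left h1,
    eq_neg_of_add_eq_zero_left h2, neg_add]
  abel

theorem norm_c_le (u : H1 d) (G : FockFin d) : ‖k.c u G‖ ≤ 2 * ‖u‖ * ‖G‖ := by
  refine (norm_add_le _ _).trans ?_
  have h1 := (norm_cre_le (k.alpha u) G).trans
    (mul_le_mul_of_nonneg_right (k.norm_alpha_le u) (norm_nonneg _))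
  have h2 := (norm_ann_le (k.beta u) G).trans
    (mul_le_mul_of_nonneg_right (k.norm_beta_le u) (norm_nonneg _))
  linarith

theorem below_b {N : ℕ} {G : FockFin d} (hG : Below N G) (u : H1 d) : Below (N + 1) (k.b u G) :=
  ((hG.ann _).mono (Nat.le_succ N)).add (hG.cre _)

theorem below_c {N : ℕ} {G : FockFin d} (hG : Below N G) (u : H1 d) : Below (N + 1) (k.c u G) :=
  (hG.cre _).add ((hG.ann _).mono (Nat.le_succ N))

attribute [irreducible] b c

/-- The Bessel type inequality for the fields smeared with an orthonormal system times a bounded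
square-integrable function. -/
theorem sum_norm_b_sq_le {ι : Type*} {e : ι → H1 d} (he : Orthonormal ℂ e) (p : BddMul d)
    (hp : MemLp p.toFun 2 volume) (N : ℕ) :
    ∃ C : ℝ, 0 ≤ C ∧ ∀ (G : FockFin d), Below N G → ∀ s : Finset ι,
      ∑ j ∈ s, ‖k.b (p.op (e j)) G‖ ^ 2 ≤ C * ‖G‖ ^ 2 := by
  obtain ⟨C, hC0, hC⟩ := k.sum_norm_K1_sq_le he p hp
  let A : H1 d →L[ℂ] Lp ℂ 2 (μX d) := (emb 1).toContinuousLinearMap ∘L k.K2 ∘L p.op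
  refine ⟨2 * (N * ‖A.adjoint‖ ^ 2) + 2 * C, by positivity, fun G hG s => ?_⟩
  have h1 : ∑ j ∈ s, ‖ann (k.alpha (p.op (e j))) G‖ ^ 2 ≤ N * ‖A.adjoint‖ ^ 2 * ‖G‖ ^ 2 := by
    refine hG.sum_norm_ann_sq_le s _ (by positivity) fun h => ?_
    calc ∑ j ∈ s, ‖(inner ℂ (k.alpha (p.op (e j))) h : ℂ)‖ ^ 2
        = ∑ j ∈ s, ‖(inner ℂ (e j) (A.adjoint h) : ℂ)‖ ^ 2 := by
          refine Finset.sum_congr rfl fun j _ => ?_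
          rw [ContinuousLinearMap.adjoint_inner_right]
          rfl
      _ ≤ ‖A.adjoint h‖ ^ 2 := he.sum_inner_products_le _
      _ ≤ (‖A.adjoint‖ * ‖h‖) ^ 2 := by gcongr; exact A.adjoint.le_opNorm h
      _ = _ := by ring
  have h2 : ∑ j ∈ s, ‖cre (k.beta (p.op (e j))) G‖ ^ 2 ≤ C * ‖G‖ ^ 2 := by
    calc ∑ j ∈ s, ‖cre (k.beta (p.op (e j))) G‖ ^ 2
        ≤ ∑ j ∈ s, ‖k.K1 (p.op (e j))‖ ^ 2 * ‖G‖ ^ 2 := by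
          refine Finset.sum_le_sum fun j _ => ?_
          rw [← mul_pow, ← norm_beta]
          gcongr
          exact norm_cre_le _ _
      _ ≤ C * ‖G‖ ^ 2 := by
          rw [← Finset.sum_mul]
          exact mul_le_mul_of_nonneg_right (hC s) (by positivity)
  calc ∑ j ∈ s, ‖k.b (p.op (e j)) G‖ ^ 2
      ≤ ∑ j ∈ s, (2 * ‖ann (k.alpha (p.op (e j))) G‖ ^ 2
          + 2 * ‖cre (k.beta (p.op (e j))) G‖ ^ 2) := by
        refine Finset.sum_le_sum fun j _ => ?_
        have h := norm_add_le (ann (k.alpha (p.op (e j))) G) (cre (k.beta (p.op (e j))) G)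
        rw [b_apply]
        have h0 := norm_nonneg (ann (k.alpha (p.op (e j))) G + cre (k.beta (p.op (e j))) G)
        nlinarith [sq_nonneg (‖ann (k.alpha (p.op (e j))) G‖ - ‖cre (k.beta (p.op (e j))) G‖)]
    _ ≤ _ := by
        rw [Finset.sum_add_distrib, ← Finset.mul_sum, ← Finset.mul_sum]
        linarith

end MomentumDensity

/-! ### Completeness of the sectors -/

theorem isClosed_NParticle (d n : ℕ) : IsClosed (NParticle d n : Set (Lp ℂ 2 (μ d n))) := by
  have h : (NParticle d n : Set (Lp ℂ 2 (μ d n))) = ⋂ σ : Equiv.Perm (Fin n),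
      {F | Lp.compMeasurePreservingₗᵢ ℂ _ (measurePreserving_perm d n σ) F = sgn σ • F} := by
    ext F
    simp only [Set.mem_iInter, Set.mem_ofPred_eq]
    refine forall_congr' fun σ => ?_
    have h1 : (Lp.compMeasurePreservingₗᵢ ℂ _ (measurePreserving_perm d n σ) F
        : (Fin n → X d) → ℂ) =ᵐ[μ d n] fun y => F (y ∘ σ) :=
      Lp.coeFn_compMeasurePreserving F (measurePreserving_perm d n σ)
    constructor
    · intro hF
      refine Lp.ext ?_
      filter_upwards [h1, hF, Lp.coeFn_smul (sgn σ) F] with y e1 e2 e3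
      rw [e1, e2, e3, Pi.smul_apply, smul_eq_mul]
    · intro hF
      rw [hF] at h1
      filter_upwards [h1, Lp.coeFn_smul (sgn σ) F] with y e1 e3
      rw [← e1, e3, Pi.smul_apply, smul_eq_mul]
  rw [h]
  exact isClosed_iInter fun σ =>
    isClosed_eq (LinearIsometry.continuous _) (continuous_const_smul _)

instance (d n : ℕ) : CompleteSpace (NParticle d n) :=
  (isClosed_NParticle d n).completeSpace_coe

theorem norm_coe_apply_le (G : FockFin d) (n : ℕ) : ‖(G : Fock d) n‖ ≤ ‖G‖ :=
  lp.norm_apply_le_norm (by norm_num) (G : Fock d) n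

theorem Below.neg {N : ℕ} {G : FockFin d} (hG : Below N G) : Below N (-G) := fun n hn => by
  have := hG n hn
  simp [this]

theorem Below.sub {N : ℕ} {G K : FockFin d} (hG : Below N G) (hK : Below N K) :
    Below N (G - K) := by
  rw [sub_eq_add_neg]; exact hG.add hK.neg

theorem below_zero (N : ℕ) : Below N (0 : FockFin d) := fun _ _ => rfl

theorem Below.sum {ι : Type*} {N : ℕ} {x : ι → FockFin d} (s : Finset ι) (h : ∀ j, Below N (x j)) :
    Below N (∑ j ∈ s, x j) := by
  classical
  induction s using Finset.induction_on with
  | empty => rw [Finset.sum_empty]; exact below_zero N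
  | insert a s ha ih => rw [Finset.sum_insert ha]; exact (h a).add ih

/-- Series of vectors with uniformly bounded particle number converge in the finite-particle space
under the Cauchy criterion. -/
theorem exists_hasSum_of_vanishing {ι : Type*} {N : ℕ} {x : ι → FockFin d}
    (hx : ∀ j, Below N (x j))
    (h : ∀ ε > 0, ∃ s : Finset ι, ∀ t, Disjoint t s → ‖∑ j ∈ t, x j‖ < ε) :
    ∃ S : FockFin d, Below N S ∧ HasSum x S := by
  have hs : Summable fun j => (x j : Fock d) := by
    rw [summable_iff_vanishing_norm]
    intro ε hε
    obtain ⟨s, hs⟩ := h ε hε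
    refine ⟨s, fun t ht => ?_⟩
    have := hs t ht
    rwa [Submodule.coe_norm, Submodule.coe_sum] at this
  obtain ⟨S, hS⟩ := hs
  have hSN : ∀ n, N ≤ n → S n = 0 := by
    intro n hn
    have h1 : ∀ t : Finset ι, ‖S n‖ ≤ ‖S - ∑ j ∈ t, (x j : Fock d)‖ := by
      intro t
      have h2 : (∑ j ∈ t, (x j : Fock d)) n = 0 := by
        rw [← Submodule.coe_sum]
        exact Below.sum t hx n hn
      have h3 := lp.norm_apply_le_norm (p := 2) (by norm_num) (S - ∑ j ∈ t, (x j : Fock d)) n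
      rwa [lp.coeFn_sub, Pi.sub_apply, h2, sub_zero] at h3
    have h4 : Tendsto (fun t : Finset ι => ‖S - ∑ j ∈ t, (x j : Fock d)‖) atTop (𝓝 0) := by
      have : Tendsto (fun t : Finset ι => ‖S - ∑ j ∈ t, (x j : Fock d)‖) atTop (𝓝 ‖S - S‖) :=
        (tendsto_const_nhds.sub hS).norm
      simpa using this
    exact norm_le_zero_iff.1 (ge_of_tendsto' h4 h1)
  refine ⟨⟨S, N, hSN⟩, hSN, ?_⟩
  have hi : Topology.IsInducing ((FockFin d).subtype : FockFin d → Fock d) :=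
    Topology.IsInducing.subtypeVal
  exact (hi.hasSum_iff (g := (FockFin d).subtype) x ⟨S, N, hSN⟩).1 hS

/-! ### Locally bounded operators -/

/-- Operators which are bounded on vectors with bounded particle number, and which increase the
particle number in a controlled way. -/
def LocBdd (T : FockFin d →ₗ[ℂ] FockFin d) : Prop :=
  ∀ N : ℕ, ∃ M : ℕ, ∃ C : ℝ, 0 ≤ C ∧ ∀ G, Below N G → Below M (T G) ∧ ‖T G‖ ≤ C * ‖G‖

/-- Locally bounded operators with a locally bounded formal adjoint. -/
def Adjointable (T : FockFin d →ₗ[ℂ] FockFin d) : Prop :=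
  LocBdd T ∧ ∃ S : FockFin d →ₗ[ℂ] FockFin d, LocBdd S ∧
    ∀ G K, inner ℂ (T G) K = inner ℂ G (S K)

theorem locBdd_id : LocBdd (LinearMap.id : FockFin d →ₗ[ℂ] FockFin d) :=
  fun N => ⟨N, 1, zero_le_one, fun G hG => ⟨hG, by simp⟩⟩

theorem adjointable_id : Adjointable (LinearMap.id : FockFin d →ₗ[ℂ] FockFin d) :=
  ⟨locBdd_id, LinearMap.id, locBdd_id, fun _ _ => rfl⟩

theorem LocBdd.comp {T S : FockFin d →ₗ[ℂ] FockFin d} (hT : LocBdd T) (hS : LocBdd S) :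
    LocBdd (T ∘ₗ S) := by
  intro N
  obtain ⟨M, C, hC, h1⟩ := hS N
  obtain ⟨M', C', hC', h2⟩ := hT M
  refine ⟨M', C' * C, mul_nonneg hC' hC, fun G hG => ?_⟩
  obtain ⟨h3, h4⟩ := h1 G hG
  obtain ⟨h5, h6⟩ := h2 _ h3
  refine ⟨h5, h6.trans ?_⟩
  rw [mul_assoc]
  exact mul_le_mul_of_nonneg_left h4 hC'

/-- Locally bounded operators respect sums of series with bounded particle number. -/
theorem LocBdd.hasSum {T : FockFin d →ₗ[ℂ] FockFin d} (hT : LocBdd T) {ι : Type*} {N : ℕ}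
    {x : ι → FockFin d} {S : FockFin d} (hx : ∀ j, Below N (x j)) (hS : Below N S)
    (h : HasSum x S) : HasSum (fun j => T (x j)) (T S) := by
  obtain ⟨M, C, hC, hTN⟩ := hT N
  have h1 : ∀ t : Finset ι, ‖∑ j ∈ t, T (x j) - T S‖ ≤ C * ‖∑ j ∈ t, x j - S‖ := by
    intro t
    rw [← map_sum, ← map_sub]
    exact (hTN _ ((Below.sum t hx).sub hS)).2
  have h2 : Tendsto (fun t : Finset ι => C * ‖∑ j ∈ t, x j - S‖) atTop (𝓝 0) := by
    have : Tendsto (fun t : Finset ι => C * ‖∑ j ∈ t, x j - S‖) atTop (𝓝 (C * ‖S - S‖)) :=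
      (Tendsto.sub h tendsto_const_nhds).norm.const_mul C
    simpa using this
  exact tendsto_iff_norm_sub_tendsto_zero.2
    (squeeze_zero (fun _ => norm_nonneg _) h1 h2)

theorem Below.norm_sq {N : ℕ} {G : FockFin d} (hG : Below N G) :
    ‖G‖ ^ 2 = ∑ n ∈ Finset.range N, ‖(G : Fock d) n‖ ^ 2 := by
  have h1 : HasSum (fun n => ‖(G : Fock d) n‖ ^ 2) (‖(G : Fock d)‖ ^ 2) := by
    have := lp.hasSum_norm (p := 2) (by norm_num) (G : Fock d)
    simpa using this
  rw [Submodule.coe_norm]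
  refine h1.unique (hasSum_sum_of_ne_finset_zero fun n hn => ?_)
  rw [hG n (by simpa using hn)]
  simp

theorem FinTendsto.below {u : ℕ → FockFin d} {v : FockFin d} {N : ℕ} (h : FinTendsto u v)
    (hN : ∀ j, Below N (u j)) : Below N v := fun n hn => by
  have h1 := h.2 n
  simp only [fun j => hN j n hn] at h1
  exact tendsto_nhds_unique h1 tendsto_const_nhds

theorem FinTendsto.tendsto {u : ℕ → FockFin d} {v : FockFin d} (h : FinTendsto u v) :
    Tendsto u atTop (𝓝 v) := by
  obtain ⟨N, hN⟩ := h.1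
  have hv := h.below (N := N) hN
  rw [tendsto_iff_norm_sub_tendsto_zero]
  have h1 : Tendsto (fun j => ‖u j - v‖ ^ 2) atTop (𝓝 0) := by
    have h2 : ∀ j, ‖u j - v‖ ^ 2
        = ∑ n ∈ Finset.range N, ‖(u j : Fock d) n - (v : Fock d) n‖ ^ 2 := by
      intro j
      rw [Below.norm_sq (Below.sub (hN j) hv)]
      rfl
    simp only [h2]
    have h3 : ∀ n ∈ Finset.range N,
        Tendsto (fun j => ‖(u j : Fock d) n - (v : Fock d) n‖ ^ 2) atTop (𝓝 0) := by
      intro n _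
      have := (tendsto_iff_norm_sub_tendsto_zero.1 (h.2 n)).pow 2
      simpa using this
    simpa using tendsto_finsetSum _ h3
  have h4 := h1.sqrt
  simpa [Real.sqrt_sq] using h4

theorem finTendsto_of_tendsto {u : ℕ → FockFin d} {v : FockFin d} {N : ℕ}
    (hN : ∀ j, Below N (u j)) (h : Tendsto u atTop (𝓝 v)) : FinTendsto u v := by
  refine ⟨⟨N, hN⟩, fun n => ?_⟩
  rw [tendsto_iff_norm_sub_tendsto_zero] at h ⊢
  exact squeeze_zero (fun _ => norm_nonneg _) (fun j => norm_coe_apply_le (u j - v) n) h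

theorem LocBdd.finContinuous {T : FockFin d →ₗ[ℂ] FockFin d} (hT : LocBdd T) :
    FinContinuous T := by
  intro u v h
  obtain ⟨N, hN⟩ := h.1
  have hv := h.below (N := N) hN
  obtain ⟨M, C, hC, hTN⟩ := hT N
  refine finTendsto_of_tendsto (fun j => (hTN _ (hN j)).1) ?_
  have h1 := h.tendsto
  rw [tendsto_iff_norm_sub_tendsto_zero] at h1 ⊢
  refine squeeze_zero (fun _ => norm_nonneg _) (fun j => ?_) (by simpa using h1.const_mul C)
  rw [← map_sub]
  exact (hTN _ (Below.sub (hN j) hv)).2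

/-! ### Sandwiching an operator between smeared fields -/

/-- Real-valued bounded square-integrable functions. -/
structure Weight (d : ℕ) extends BddMul d where
  memLp_toFun : MemLp toFun 2 volume
  conj_toFun : ∀ x, conj (toFun x) = toFun x

/-- The index set of a Hilbert basis of `L²(ℝ^d)`. -/
def basisSet (d : ℕ) : Set (H1 d) := (exists_hilbertBasis ℂ (H1 d)).choose

/-- A Hilbert basis of `L²(ℝ^d)`. -/
def basis (d : ℕ) : HilbertBasis (basisSet d) ℂ (H1 d) :=
  (exists_hilbertBasis ℂ (H1 d)).choose_spec.choose

/-- A synthesis bound follows from the analysis bound for the adjoint family: test `∑ y j` against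
itself. -/
theorem norm_sum_sq_le_of_dual {V ι : Type*} [NormedAddCommGroup V] [InnerProductSpace ℂ V]
    {t : Finset ι} {x y : ι → V} {B : V → ι → V} {C : ℝ} (hC : 0 ≤ C)
    (h : ∀ j ∈ t, ∀ P, (inner ℂ (y j) P : ℂ) = inner ℂ (x j) (B P j))
    (hB : ∑ j ∈ t, ‖B (∑ j ∈ t, y j) j‖ ^ 2 ≤ C * ‖∑ j ∈ t, y j‖ ^ 2) :
    ‖∑ j ∈ t, y j‖ ^ 2 ≤ C * ∑ j ∈ t, ‖x j‖ ^ 2 := by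
  set P := ∑ j ∈ t, y j with hP
  have h1 : ‖P‖ ^ 2 ≤ ∑ j ∈ t, ‖x j‖ * ‖B P j‖ := by
    have h2 : (inner ℂ P P : ℂ) = ∑ j ∈ t, inner ℂ (x j) (B P j) := by
      conv_lhs => arg 2; rw [hP]
      rw [sum_inner]
      exact Finset.sum_congr rfl fun j hj => h j hj P
    have h3 : ‖(inner ℂ P P : ℂ)‖ = ‖P‖ ^ 2 := by
      rw [inner_self_eq_norm_sq_to_K]; simp
    rw [← h3, h2]
    exact (norm_sum_le _ _).trans (Finset.sum_le_sum fun j _ => norm_inner_le_norm _ _)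
  have h4 := Finset.sum_mul_sq_le_sq_mul_sq t (fun j => ‖x j‖) fun j => ‖B P j‖
  have h8 : 0 ≤ ∑ j ∈ t, ‖x j‖ ^ 2 := Finset.sum_nonneg fun _ _ => sq_nonneg _
  have h6 : (‖P‖ ^ 2) ^ 2 ≤ (∑ j ∈ t, ‖x j‖ ^ 2) * (C * ‖P‖ ^ 2) :=
    (pow_le_pow_left₀ (sq_nonneg _) h1 2).trans
      (h4.trans (mul_le_mul_of_nonneg_left hB h8))
  by_contra hlt
  rw [not_le] at hlt
  have h9 : 0 < ‖P‖ ^ 2 := (mul_nonneg hC h8).trans_lt hlt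
  nlinarith

/-- The pointwise sum of a series of linear operators. -/
def pointwiseSum {V ι : Type*} [NormedAddCommGroup V] [NormedSpace ℂ V]
    (t : ι → V →ₗ[ℂ] V) (h : ∀ G, Summable fun j => t j G) : V →ₗ[ℂ] V where
  toFun G := ∑' j, t j G
  map_add' G K := by
    rw [← (h G).tsum_add (h K)]
    exact tsum_congr fun j => map_add _ _ _
  map_smul' a G := by
    rw [RingHom.id_apply, ← (h G).tsum_const_smul]
    exact tsum_congr fun j => map_smul _ _ _

theorem hasSum_inner_left {V ι : Type*} [NormedAddCommGroup V] [InnerProductSpace ℂ V]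
    {x : ι → V} {S : V} (h : HasSum x S) (K : V) :
    HasSum (fun j => (inner ℂ (x j) K : ℂ)) (inner ℂ S K) := by
  have h1 := (h.mapL (innerSL ℂ K)).star
  simpa [innerSL_apply_apply] using h1

namespace MomentumDensity

variable (k : MomentumDensity d)

/-- The field `ψ` smeared with the complex conjugate of `p e_j`. -/
def bj (p : Weight d) (j : basisSet d) : FockFin d →ₗ[ℂ] FockFin d := k.b (p.op (basis d j))

/-- The field `ψ*` smeared with `p e_j`. -/
def cj (p : Weight d) (j : basisSet d) : FockFin d →ₗ[ℂ] FockFin d := k.c (p.op (basis d j))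

theorem inner_cj (p : Weight d) (j : basisSet d) (G K : FockFin d) :
    inner ℂ (k.cj p j G) K = inner ℂ G (k.bj p j K) := k.inner_c _ G K

theorem below_bj {N : ℕ} {G : FockFin d} (hG : Below N G) (p : Weight d) (j : basisSet d) :
    Below (N + 1) (k.bj p j G) := k.below_b hG _

theorem below_cj {N : ℕ} {G : FockFin d} (hG : Below N G) (p : Weight d) (j : basisSet d) :
    Below (N + 1) (k.cj p j G) := k.below_c hG _

theorem sum_norm_bj_sq_le (p : Weight d) (N : ℕ) :
    ∃ C : ℝ, 0 ≤ C ∧ ∀ (G : FockFin d), Below N G → ∀ s : Finset (basisSet d),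
      ∑ j ∈ s, ‖k.bj p j G‖ ^ 2 ≤ C * ‖G‖ ^ 2 :=
  k.sum_norm_b_sq_le (basis d).orthonormal p.toBddMul p.memLp_toFun N

theorem summable_norm_bj_sq (p : Weight d) (N : ℕ) :
    ∃ C : ℝ, 0 ≤ C ∧ ∀ (G : FockFin d), Below N G →
      (Summable fun j => ‖k.bj p j G‖ ^ 2) ∧ ∑' j, ‖k.bj p j G‖ ^ 2 ≤ C * ‖G‖ ^ 2 := by
  obtain ⟨C, hC, h⟩ := k.sum_norm_bj_sq_le p N
  refine ⟨C, hC, fun G hG => ?_⟩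
  have hs : Summable fun j => ‖k.bj p j G‖ ^ 2 :=
    summable_of_sum_le (fun _ => by positivity) (h G hG)
  exact ⟨hs, hs.tsum_le_of_sum_le (h G hG)⟩

/-- The dual of the Bessel type inequality, for finite families. -/
theorem norm_sum_cj_sq_le (q : Weight d) (N : ℕ) :
    ∃ C : ℝ, 0 ≤ C ∧ ∀ x : basisSet d → FockFin d, (∀ j, Below N (x j)) →
      ∀ t : Finset (basisSet d), ‖∑ j ∈ t, k.cj q j (x j)‖ ^ 2 ≤ C * ∑ j ∈ t, ‖x j‖ ^ 2 := by
  obtain ⟨C, hC, hb⟩ := k.sum_norm_bj_sq_le q (N + 1)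
  refine ⟨C, hC, fun x hx t => ?_⟩
  exact norm_sum_sq_le_of_dual hC (B := fun P j => k.bj q j P) (fun j _ P => k.inner_cj q j (x j) P)
    (hb _ (Below.sum t fun j => k.below_cj (hx j) _ _) t)

/-- The dual of the Bessel type inequality: the smeared fields `ψ*` synthesize square-summable
families. -/
theorem exists_hasSum_cj (q : Weight d) (N : ℕ) :
    ∃ C : ℝ, 0 ≤ C ∧ ∀ x : basisSet d → FockFin d, (∀ j, Below N (x j)) →
      (Summable fun j => ‖x j‖ ^ 2) →
      ∃ S, Below (N + 1) S ∧ HasSum (fun j => k.cj q j (x j)) S ∧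
        ‖S‖ ^ 2 ≤ C * ∑' j, ‖x j‖ ^ 2 := by
  obtain ⟨C, hC, hfin⟩ := k.norm_sum_cj_sq_le q N
  refine ⟨C, hC, fun x hx hs => ?_⟩
  have hv : ∀ ε > 0, ∃ s : Finset (basisSet d), ∀ t, Disjoint t s →
      ‖∑ j ∈ t, k.cj q j (x j)‖ < ε := by
    intro ε hε
    obtain ⟨s, h⟩ := summable_iff_vanishing_norm.1 hs (ε ^ 2 / (C + 1)) (by positivity)
    refine ⟨s, fun t ht => ?_⟩
    have h1 := h t ht
    have h3 : 0 ≤ ∑ j ∈ t, ‖x j‖ ^ 2 := Finset.sum_nonneg fun _ _ => sq_nonneg _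
    rw [Real.norm_of_nonneg h3, lt_div_iff₀ (by positivity)] at h1
    have h2 := hfin x hx t
    refine lt_of_pow_lt_pow_left₀ 2 hε.le (h2.trans_lt ?_)
    nlinarith
  obtain ⟨S, hS, hsum⟩ := exists_hasSum_of_vanishing (fun j => k.below_cj (hx j) _ _) hv
  refine ⟨S, hS, hsum, ?_⟩
  have h1 : Tendsto (fun t : Finset (basisSet d) => ‖∑ j ∈ t, k.cj q j (x j)‖ ^ 2) atTop
      (𝓝 (‖S‖ ^ 2)) := (Tendsto.norm hsum).pow 2
  have h2 : Tendsto (fun t : Finset (basisSet d) => C * ∑ j ∈ t, ‖x j‖ ^ 2) atTop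
      (𝓝 (C * ∑' j, ‖x j‖ ^ 2)) := Tendsto.const_mul C hs.hasSum
  exact le_of_tendsto_of_tendsto' h1 h2 (hfin x hx)

/-- The terms `R b(p e_j) G` form a square-summable family. -/
theorem locBdd_summable (p : Weight d) {R : FockFin d →ₗ[ℂ] FockFin d} (hR : LocBdd R) (N : ℕ) :
    ∃ M : ℕ, ∃ C : ℝ, 0 ≤ C ∧ ∀ G, Below N G → (∀ j, Below M (R (k.bj p j G))) ∧
      (Summable fun j => ‖R (k.bj p j G)‖ ^ 2) ∧
      ∑' j, ‖R (k.bj p j G)‖ ^ 2 ≤ C * ‖G‖ ^ 2 := by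
  obtain ⟨C, hC, h1⟩ := k.summable_norm_bj_sq p N
  obtain ⟨M, C', hC', h2⟩ := hR (N + 1)
  refine ⟨M, C' ^ 2 * C, by positivity, fun G hG => ?_⟩
  obtain ⟨h3, h4⟩ := h1 G hG
  have h5 : ∀ j, ‖R (k.bj p j G)‖ ^ 2 ≤ C' ^ 2 * ‖k.bj p j G‖ ^ 2 := fun j => by
    rw [← mul_pow]
    exact pow_le_pow_left₀ (norm_nonneg _) (h2 _ (k.below_bj hG _ _)).2 2
  have h6 : Summable fun j => ‖R (k.bj p j G)‖ ^ 2 :=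
    Summable.of_nonneg_of_le (fun _ => by positivity) h5 (h3.mul_left _)
  refine ⟨fun j => (h2 _ (k.below_bj hG _ _)).1, h6, ?_⟩
  refine (h6.tsum_le_tsum h5 (h3.mul_left _)).trans ?_
  rw [tsum_mul_left, mul_assoc]
  exact mul_le_mul_of_nonneg_left h4 (by positivity)

theorem exists_sandwich (p q : Weight d) {R : FockFin d →ₗ[ℂ] FockFin d} (hR : LocBdd R) (N : ℕ) :
    ∃ M : ℕ, ∃ C : ℝ, 0 ≤ C ∧ ∀ G, Below N G →
      ∃ S, Below M S ∧ HasSum (fun j => k.cj q j (R (k.bj p j G))) S ∧ ‖S‖ ≤ C * ‖G‖ := by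
  obtain ⟨M, C, hC, h1⟩ := k.locBdd_summable p hR N
  obtain ⟨C', hC', h2⟩ := k.exists_hasSum_cj q M
  refine ⟨M + 1, Real.sqrt (C' * C), by positivity, fun G hG => ?_⟩
  obtain ⟨h3, h4, h5⟩ := h1 G hG
  obtain ⟨S, h6, h7, h8⟩ := h2 _ h3 h4
  refine ⟨S, h6, h7, le_of_sq_le_sq ?_ (by positivity)⟩
  rw [mul_pow, Real.sq_sqrt (by positivity)]
  nlinarith [mul_le_mul_of_nonneg_left h5 hC']

theorem summable_sandwich (p q : Weight d) {R : FockFin d →ₗ[ℂ] FockFin d} (hR : LocBdd R)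
    (G : FockFin d) : Summable fun j => (k.cj q j ∘ₗ R ∘ₗ k.bj p j) G := by
  obtain ⟨N, hG⟩ := exists_below G
  obtain ⟨M, C, hC, h⟩ := k.exists_sandwich p q hR N
  obtain ⟨S, -, hS, -⟩ := h G hG
  exact hS.summable

/-- The operator `∑ⱼ c(q e_j) R b(p e_j)`, formally `∫ p(x) q(x) ψ*(x) R ψ(x) dx`. -/
def sandwich (p q : Weight d) (R : FockFin d →ₗ[ℂ] FockFin d) (hR : LocBdd R) :
    FockFin d →ₗ[ℂ] FockFin d :=
  pointwiseSum (fun j => k.cj q j ∘ₗ R ∘ₗ k.bj p j) (k.summable_sandwich p q hR)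

theorem hasSum_sandwich (p q : Weight d) {R : FockFin d →ₗ[ℂ] FockFin d} (hR : LocBdd R)
    (G : FockFin d) :
    HasSum (fun j => k.cj q j (R (k.bj p j G))) (k.sandwich p q R hR G) :=
  (k.summable_sandwich p q hR G).hasSum

attribute [irreducible] sandwich

theorem locBdd_sandwich (p q : Weight d) {R : FockFin d →ₗ[ℂ] FockFin d} (hR : LocBdd R) :
    LocBdd (k.sandwich p q R hR) := by
  intro N
  obtain ⟨M, C, hC, h⟩ := k.exists_sandwich p q hR N
  refine ⟨M, C, hC, fun G hG => ?_⟩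
  obtain ⟨S, h1, hS, h2⟩ := h G hG
  rw [(k.hasSum_sandwich p q hR G).unique hS]
  exact ⟨h1, h2⟩

/-- The sandwich as a form. Here only the fields `b` occur, so that it also is what integration of
`⟨R ψ(x) G, ψ(x) K⟩` produces. -/
theorem hasSum_inner_sandwich (p q : Weight d) {R : FockFin d →ₗ[ℂ] FockFin d} (hR : LocBdd R)
    (G K : FockFin d) :
    HasSum (fun j => (inner ℂ (R (k.bj p j G)) (k.bj q j K) : ℂ))
      (inner ℂ (k.sandwich p q R hR G) K) := by
  simpa only [inner_cj] using hasSum_inner_left (k.hasSum_sandwich p q hR G) K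

/-- Sandwiching with the two weights exchanged gives the adjoint. -/
theorem adjointable_sandwich (p q : Weight d) {R : FockFin d →ₗ[ℂ] FockFin d}
    (hR : Adjointable R) : Adjointable (k.sandwich p q R hR.1) := by
  obtain ⟨h1, R', h2, h3⟩ := hR
  refine ⟨k.locBdd_sandwich p q h1, k.sandwich q p R' h2, k.locBdd_sandwich q p h2,
    fun G K => ?_⟩
  refine (k.hasSum_inner_sandwich p q h1 G K).unique ?_
  have h4 := (k.hasSum_inner_sandwich q p h2 K G).star
  simp only [RCLike.star_def, inner_conj_symm] at h4
  simpa only [h3] using h4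

end MomentumDensity

/-! ### The algebra of the smeared densities -/

theorem summable_inner_of_summable_sq {V ι : Type*} [NormedAddCommGroup V] [InnerProductSpace ℂ V]
    {x y : ι → V} (hx : Summable fun i => ‖x i‖ ^ 2) (hy : Summable fun i => ‖y i‖ ^ 2) :
    Summable fun i => (inner ℂ (x i) (y i) : ℂ) := by
  refine Summable.of_norm_bounded (hx.add hy) fun i => ?_
  refine (norm_inner_le_norm _ _).trans ?_
  nlinarith [sq_nonneg (‖x i‖ - ‖y i‖), sq_nonneg (‖x i‖ + ‖y i‖)]

theorem eq_of_forall_inner {G K : FockFin d}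
    (h : ∀ L : FockFin d, (inner ℂ G L : ℂ) = inner ℂ K L) : G = K :=
  ext_inner_right ℂ h

/-- Parseval: `∑ⱼ ⟨p e_j, v⟩ L (q e_j) = L (q p v)`. This is the discrete form of the smeared
delta function in the anticommutator of `ψ` and `ψ*`. -/
theorem hasSum_inner_smul {V : Type*} [NormedAddCommGroup V] [NormedSpace ℂ V] (p q : Weight d)
    (v : H1 d) (L : H1 d →L[ℂ] V) :
    HasSum (fun j => (inner ℂ (p.op (basis d j)) v : ℂ) • L (q.op (basis d j)))
      (L (q.op (p.op v))) := by
  have h := ((basis d).hasSum_repr (p.op v)).mapL (L ∘L q.op)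
  have e : (fun j => (inner ℂ (p.op (basis d j)) v : ℂ) • L (q.op (basis d j)))
      = fun j => (L ∘L q.op) ((basis d).repr (p.op v) j • basis d j) := by
    funext j
    rw [HilbertBasis.repr_apply_apply, ← p.inner_op p.conj_toFun, map_smul]
    rfl
  rw [e]
  exact h

theorem hasSum_eq_add {V ι : Type*} [NormedAddCommGroup V] {x y z : ι → V} {a b c : V}
    (hx : HasSum x a) (hy : HasSum y b) (hz : HasSum z c) (h : ∀ j, x j = y j + z j) :
    a = b + c := by
  rw [funext h] at hx
  exact hx.unique (hy.add hz)

/-- Moving `A` to the left through `C B`: the two sign changes cancel, and the contraction with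
`B` remains. -/
theorem comp_comp_of_anticomm {V : Type*} [AddCommGroup V] [Module ℂ V] {A B C : V →ₗ[ℂ] V}
    {G : V} {a : ℂ} (h1 : B (A G) + A (B G) = a • G) (h2 : ∀ K, C (A K) = - A (C K)) :
    C (B (A G)) = A (C (B G)) + a • C G := by
  rw [eq_sub_of_add_eq h1, map_sub, map_smul, h2]
  abel

namespace MomentumDensity

variable (k : MomentumDensity d)

theorem bj_bj (p p' : Weight d) (j l : basisSet d) (G : FockFin d) :
    k.bj p j (k.bj p' l G) = - k.bj p' l (k.bj p j G) := k.b_b _ _ G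

theorem summable_norm_bj_bj_sq (p p' : Weight d) (G : FockFin d) :
    Summable fun jl : basisSet d × basisSet d => ‖k.bj p' jl.2 (k.bj p jl.1 G)‖ ^ 2 := by
  obtain ⟨N, hG⟩ := exists_below G
  obtain ⟨C, hC, h1⟩ := k.summable_norm_bj_sq p N
  obtain ⟨C', hC', h2⟩ := k.summable_norm_bj_sq p' (N + 1)
  rw [summable_prod_of_nonneg fun _ => by positivity]
  refine ⟨fun j => (h2 _ (k.below_bj hG _ _)).1, ?_⟩
  exact Summable.of_nonneg_of_le (fun j => tsum_nonneg fun _ => by positivity)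
    (fun j => (h2 (k.bj p j G) (k.below_bj hG _ _)).2) ((h1 G hG).1.mul_left C')

theorem summable_inner_bj_bj (p q p' q' : Weight d) {R : FockFin d →ₗ[ℂ] FockFin d}
    (hR : LocBdd R) (G K : FockFin d) :
    Summable (Function.uncurry fun j l : basisSet d =>
      (inner ℂ (R (k.bj p' l (k.bj p j G))) (k.bj q' l (k.bj q j K)) : ℂ)) := by
  obtain ⟨N, hG⟩ := exists_below G
  obtain ⟨M, C, hC, h⟩ := hR (N + 1 + 1)
  refine summable_inner_of_summable_sq (x := fun jl : basisSet d × basisSet d =>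
    R (k.bj p' jl.2 (k.bj p jl.1 G))) ?_ (k.summable_norm_bj_bj_sq q q' K)
  refine Summable.of_nonneg_of_le (fun _ => by positivity) (fun jl => ?_)
    ((k.summable_norm_bj_bj_sq p p' G).mul_left (C ^ 2))
  rw [← mul_pow]
  exact pow_le_pow_left₀ (norm_nonneg _)
    (h _ (k.below_bj (k.below_bj hG p jl.1) p' jl.2)).2 2

/-- Two nested sandwiches as an absolutely convergent double series, which can be summed in either
order. -/
theorem inner_sandwich_sandwich (p q p' q' : Weight d) {R : FockFin d →ₗ[ℂ] FockFin d}
    (hR : LocBdd R) (G K : FockFin d) :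
    inner ℂ (k.sandwich p q (k.sandwich p' q' R hR) (k.locBdd_sandwich p' q' hR) G) K
      = ∑' j, ∑' l, (inner ℂ (R (k.bj p' l (k.bj p j G))) (k.bj q' l (k.bj q j K)) : ℂ) := by
  rw [← (k.hasSum_inner_sandwich p q (k.locBdd_sandwich p' q' hR) G K).tsum_eq]
  exact tsum_congr fun j => (k.hasSum_inner_sandwich p' q' hR _ _).tsum_eq.symm

/-- Sandwiching operations commute, as the fields `ψ` anticommute among themselves. -/
theorem sandwich_comm (p q p' q' : Weight d) {R : FockFin d →ₗ[ℂ] FockFin d} (hR : LocBdd R) :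
    k.sandwich p q (k.sandwich p' q' R hR) (k.locBdd_sandwich p' q' hR)
      = k.sandwich p' q' (k.sandwich p q R hR) (k.locBdd_sandwich p q hR) := by
  refine LinearMap.ext fun G => eq_of_forall_inner fun K => ?_
  have h0 := Summable.tsum_comm (f := fun j l : basisSet d =>
    (inner ℂ (R (k.bj p' l (k.bj p j G))) (k.bj q' l (k.bj q j K)) : ℂ))
    (k.summable_inner_bj_bj p q p' q' hR G K)
  refine (k.inner_sandwich_sandwich p q p' q' hR G K).trans (h0.symm.trans
    (Eq.trans ?_ (k.inner_sandwich_sandwich p' q' p q hR G K).symm))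
  refine tsum_congr fun l => tsum_congr fun j => ?_
  have e1 : R (k.bj p' l (k.bj p j G)) = - R (k.bj p j (k.bj p' l G)) :=
    (congrArg R (k.bj_bj p' p l j G)).trans (LinearMap.map_neg R _)
  exact (congrArg₂ (fun a b => (inner ℂ a b : ℂ)) e1 (k.bj_bj q' q l j K)).trans
    (inner_neg_neg _ _)

/-- The smeared density `∑ⱼ c(q e_j) b(p e_j)`. -/
def dens (p q : Weight d) : FockFin d →ₗ[ℂ] FockFin d := k.sandwich p q LinearMap.id locBdd_id

theorem hasSum_dens (p q : Weight d) (G : FockFin d) :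
    HasSum (fun j => k.cj q j (k.bj p j G)) (k.dens p q G) := k.hasSum_sandwich p q locBdd_id G

theorem locBdd_dens (p q : Weight d) : LocBdd (k.dens p q) := k.locBdd_sandwich p q locBdd_id

theorem locBdd_c (u : H1 d) : LocBdd (k.c u) := fun N =>
  ⟨N + 1, 2 * ‖u‖, by positivity, fun G hG => ⟨k.below_c hG u, k.norm_c_le u G⟩⟩

/-- The smeared fields `ψ*` as a continuous function of the smearing function. -/
def cCLM (G : FockFin d) : H1 d →L[ℂ] FockFin d :=
  LinearMap.mkContinuous
    { toFun := fun u => k.c u G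
      map_add' := fun u v => k.c_add u v G
      map_smul' := fun a u => k.c_smul a u G }
    (2 * ‖G‖) fun u => (k.norm_c_le u G).trans_eq (by ring)

theorem hasSum_smul_cj (p q : Weight d) (v : H1 d) (G : FockFin d) :
    HasSum (fun j => (inner ℂ (p.op (basis d j)) v : ℂ) • k.cj q j G)
      (k.c (q.op (p.op v)) G) :=
  hasSum_inner_smul p q v (k.cCLM G)

/-- The commutation relation of the smeared density with the smeared field `ψ*`. -/
theorem dens_c (p q : Weight d) (v : H1 d) (G : FockFin d) :
    k.dens p q (k.c v G) = k.c v (k.dens p q G) + k.c (q.op (p.op v)) G := by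
  obtain ⟨N, hG⟩ := exists_below G
  obtain ⟨M, C, hC, hM⟩ := k.locBdd_dens p q N
  have h1 := k.hasSum_dens p q (k.c v G)
  have h2 : HasSum (fun j => k.c v (k.cj q j (k.bj p j G))) (k.c v (k.dens p q G)) :=
    (k.locBdd_c v).hasSum (N := max M (N + 1 + 1))
      (fun j => (k.below_cj (k.below_bj hG _ _) _ _).mono (le_max_right _ _))
      ((hM G hG).1.mono (le_max_left _ _)) (k.hasSum_dens p q G)
  refine hasSum_eq_add h1 h2 (k.hasSum_smul_cj p q v G) fun j => ?_
  exact comp_comp_of_anticomm (k.b_c _ v G) fun K => k.c_c _ v K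

theorem sandwich_congr (p q : Weight d) {R R' : FockFin d →ₗ[ℂ] FockFin d} (hR : LocBdd R)
    (hR' : LocBdd R') (h : R = R') : k.sandwich p q R hR = k.sandwich p q R' hR' := by
  subst h; rfl

/-- The product of a smeared density with a sandwiched operator. -/
theorem dens_comp_sandwich (p q p' q' q'' : Weight d)
    (hq : ∀ u, q''.op u = q'.op (p'.op (q.op u)))
    {R : FockFin d →ₗ[ℂ] FockFin d} (hR : LocBdd R) :
    k.dens p' q' ∘ₗ k.sandwich p q R hR
      = k.sandwich p q (k.dens p' q' ∘ₗ R) ((k.locBdd_dens p' q').comp hR)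
        + k.sandwich p q'' R hR := by
  refine LinearMap.ext fun G => ?_
  rw [LinearMap.comp_apply, LinearMap.add_apply]
  obtain ⟨N, hG⟩ := exists_below G
  obtain ⟨M, C, hC, hM⟩ := hR (N + 1)
  obtain ⟨M', C', hC', hM'⟩ := k.locBdd_sandwich p q hR N
  have h1 : HasSum (fun j => k.dens p' q' (k.cj q j (R (k.bj p j G))))
      (k.dens p' q' (k.sandwich p q R hR G)) :=
    (k.locBdd_dens p' q').hasSum (N := max M' (M + 1))
      (fun j => (k.below_cj (hM _ (k.below_bj hG _ _)).1 _ _).mono (le_max_right _ _))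
      ((hM' G hG).1.mono (le_max_left _ _)) (k.hasSum_sandwich p q hR G)
  refine hasSum_eq_add h1 (k.hasSum_sandwich p q ((k.locBdd_dens p' q').comp hR) G)
    (k.hasSum_sandwich p q'' hR G) fun j => ?_
  have e := k.dens_c p' q' (q.op (basis d j)) (R (k.bj p j G))
  exact e.trans (congrArg (fun u => k.c (q.op (basis d j)) (k.dens p' q' (R (k.bj p j G)))
    + k.c u (R (k.bj p j G))) (hq _).symm)

end MomentumDensity

/-! ### Normal-ordered products as iterated sandwiches -/

theorem decay_pos (d : ℕ) (x : E d) : 0 < (1 + ‖x‖) ^ (d + 1) := by positivity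

theorem integrable_decay (d : ℕ) : Integrable fun x : E d => ((1 + ‖x‖) ^ (d + 1))⁻¹ := by
  have h := integrable_one_add_norm (E := E d) (μ := volume) (r := (d + 1 : ℕ)) (by simp)
  refine h.congr (Eventually.of_forall fun x => ?_)
  simp only [Real.rpow_neg (by positivity : (0 : ℝ) ≤ 1 + ‖x‖), Real.rpow_natCast]

theorem one_le_decay_inv (x : E d) : 1 ≤ (1 + ‖x‖) ^ (d + 1) :=
  one_le_pow₀ (by linarith [norm_nonneg x])

/-- A continuous function dominated by `(1 + |x|)^{-d-1}` is a weight. -/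
def Weight.ofDecay (f : E d → ℝ) (hf : Continuous f)
    (h : ∃ C : ℝ, 0 ≤ C ∧ ∀ x, |f x| ≤ C * ((1 + ‖x‖) ^ (d + 1))⁻¹) : Weight d where
  toFun x := (f x : ℂ)
  aesm := (Complex.continuous_ofReal.comp hf).aestronglyMeasurable
  bdd := by
    obtain ⟨C, hC, h⟩ := h
    refine ⟨C, hC, fun x => ?_⟩
    rw [Complex.norm_real, Real.norm_eq_abs]
    exact (h x).trans (mul_le_of_le_one_right hC (inv_le_one_of_one_le₀ (one_le_decay_inv x)))
  memLp_toFun := by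
    obtain ⟨C, hC, h⟩ := h
    have hm : AEStronglyMeasurable (fun x => (f x : ℂ)) (volume : Measure (E d)) :=
      (Complex.continuous_ofReal.comp hf).aestronglyMeasurable
    refine (memLp_two_iff_integrable_sq_norm hm).2 (((integrable_decay d).const_mul (C ^ 2)).mono'
      (hm.norm.pow 2) (Eventually.of_forall fun x => ?_))
    have h1 := h x
    have h2 : ((1 + ‖x‖) ^ (d + 1))⁻¹ ≤ 1 := inv_le_one_of_one_le₀ (one_le_decay_inv x)
    have h3 : 0 < ((1 + ‖x‖) ^ (d + 1))⁻¹ := inv_pos.2 (decay_pos d x)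
    simp only [norm_pow, Complex.norm_real, Real.norm_eq_abs, abs_abs]
    calc |f x| ^ 2 ≤ (C * ((1 + ‖x‖) ^ (d + 1))⁻¹) ^ 2 := by gcongr
      _ = C ^ 2 * (((1 + ‖x‖) ^ (d + 1))⁻¹ * ((1 + ‖x‖) ^ (d + 1))⁻¹) := by ring
      _ ≤ C ^ 2 * (((1 + ‖x‖) ^ (d + 1))⁻¹ * 1) := by gcongr
      _ = _ := by ring
  conj_toFun x := Complex.conj_ofReal _

/-- The weight `p(x) = (1 + |x|)^{-d-1}`. -/
def decay (d : ℕ) : Weight d :=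
  Weight.ofDecay (fun x => ((1 + ‖x‖) ^ (d + 1))⁻¹)
    (Continuous.inv₀ (by fun_prop) fun x => (decay_pos d x).ne')
    ⟨1, zero_le_one, fun x => by rw [one_mul, abs_of_pos (inv_pos.2 (decay_pos d x))]⟩

/-- The weight `f/p` for a Schwartz function `f`, where `p` is the weight `decay`. -/
def overDecay (f : 𝓢(E d, ℝ)) : Weight d :=
  Weight.ofDecay (fun x => f x * (1 + ‖x‖) ^ (d + 1)) (by fun_prop) (by
    have h := SchwartzMap.one_add_le_sup_seminorm_apply (𝕜 := ℝ) (m := (2 * (d + 1), 0))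
      (k := 2 * (d + 1)) (n := 0) le_rfl le_rfl f
    refine ⟨_, le_trans (by positivity) (h 0), fun x => ?_⟩
    rw [← div_eq_mul_inv, le_div_iff₀ (decay_pos d x), abs_mul, abs_of_pos (decay_pos d x),
      mul_assoc, ← pow_add, ← two_mul]
    refine le_trans (le_of_eq ?_) (h x)
    rw [norm_iteratedFDeriv_zero, Real.norm_eq_abs, mul_comm])

theorem decay_mul_overDecay (f : 𝓢(E d, ℝ)) (x : E d) :
    (decay d).toFun x * (overDecay f).toFun x = (f x : ℂ) := by
  simp only [decay, overDecay, Weight.ofDecay]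
  rw [← Complex.ofReal_mul]
  congr 1
  field_simp [(decay_pos d x).ne']

/-- The product of two real-valued Schwartz functions. -/
def smul (h f : 𝓢(E d, ℝ)) : 𝓢(E d, ℝ) := SchwartzMap.smulLeftCLM ℝ h f

theorem smul_apply (h f : 𝓢(E d, ℝ)) (x : E d) : smul h f x = h x * f x :=
  SchwartzMap.smulLeftCLM_apply_apply h.hasTemperateGrowth f x

/-- The weights attached to a product of test functions; they match the product that the
contraction in `dens_comp_sandwich` produces. -/
theorem overDecay_smul (h f : 𝓢(E d, ℝ)) (u : H1 d) :
    (overDecay (smul h f)).op u = (overDecay h).op ((decay d).op ((overDecay f).op u)) := by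
  refine Lp.ext ?_
  filter_upwards [(overDecay (smul h f)).op_ae u,
    (overDecay h).op_ae ((decay d).op ((overDecay f).op u)),
    (decay d).op_ae ((overDecay f).op u), (overDecay f).op_ae u] with x h1 h2 h3 h4
  rw [h1, h2, h3, h4, ← mul_assoc, ← mul_assoc, mul_comm ((overDecay h).toFun x),
    decay_mul_overDecay]
  simp only [overDecay, Weight.ofDecay, smul_apply]
  push_cast
  ring

theorem eq_add_of_eq_add_add {A : Type*} [AddCommMonoid A] {x y z t s c : A} (h1 : x = y + z)
    (h2 : y = c + s) (h3 : t = z + s) : x = c + t := by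
  rw [h1, h2, h3, add_assoc, add_comm s z]

theorem inv_factorial_smul_sum {V : Type*} [AddCommGroup V] [Module ℂ V] {n : ℕ}
    {x : Equiv.Perm (Fin n) → V} {T : V} (h : ∀ σ, x σ = T) :
    ((Nat.factorial n : ℂ))⁻¹ • ∑ σ, x σ = T := by
  rw [Finset.sum_congr rfl fun σ _ => h σ, Finset.sum_const, Finset.card_univ,
    Fintype.card_perm, Fintype.card_fin, ← Nat.cast_smul_eq_nsmul ℂ, smul_smul,
    inv_mul_cancel₀ (by exact_mod_cast Nat.factorial_ne_zero _), one_smul]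

namespace MomentumDensity

variable (k : MomentumDensity d)

/-- The adjointable operators. -/
abbrev _root_.FermiGas.Op (d : ℕ) : Type := {T : FockFin d →ₗ[ℂ] FockFin d // Adjointable T}

/-- The operation `R ↦ ∫ f(x) ψ*(x) R ψ(x) dx`. -/
def dress (f : 𝓢(E d, ℝ)) (R : Op d) : Op d :=
  ⟨k.sandwich (decay d) (overDecay f) R.1 R.2.1, k.adjointable_sandwich _ _ R.2⟩

/-- The operator `∫ f₁(x₁) ⋯ fₙ(xₙ) ψ*(xₙ) ⋯ ψ*(x₁) ψ(x₁) ⋯ ψ(xₙ) dx`. -/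
def densProd (l : List 𝓢(E d, ℝ)) : Op d := l.foldr k.dress ⟨LinearMap.id, adjointable_id⟩

theorem densProd_cons (f : 𝓢(E d, ℝ)) (l : List 𝓢(E d, ℝ)) :
    k.densProd (f :: l) = k.dress f (k.densProd l) := rfl

theorem dress_comm (f h : 𝓢(E d, ℝ)) (R : Op d) :
    k.dress f (k.dress h R) = k.dress h (k.dress f R) :=
  Subtype.ext (k.sandwich_comm _ _ _ _ R.2.1)

theorem densProd_perm {l l' : List 𝓢(E d, ℝ)} (h : l.Perm l') : k.densProd l = k.densProd l' :=
  h.foldr_eq' (fun f _ g _ R => k.dress_comm g f R) _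

theorem sandwich_add (p q : Weight d) {R R' : FockFin d →ₗ[ℂ] FockFin d} (hR : LocBdd R)
    (hR' : LocBdd R') (h : LocBdd (R + R')) :
    k.sandwich p q (R + R') h = k.sandwich p q R hR + k.sandwich p q R' hR' := by
  refine LinearMap.ext fun G => ?_
  refine hasSum_eq_add (k.hasSum_sandwich p q h G) (k.hasSum_sandwich p q hR G)
    (k.hasSum_sandwich p q hR' G) fun j => ?_
  exact LinearMap.map_add (k.cj q j) _ _

theorem _root_.FermiGas.LocBdd.add {R R' : FockFin d →ₗ[ℂ] FockFin d} (hR : LocBdd R)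
    (hR' : LocBdd R') : LocBdd (R + R') := by
  intro N
  obtain ⟨M, C, hC, h⟩ := hR N
  obtain ⟨M', C', hC', h'⟩ := hR' N
  refine ⟨max M M', C + C', add_nonneg hC hC', fun G hG => ⟨?_, ?_⟩⟩
  · exact ((h G hG).1.mono (le_max_left _ _)).add ((h' G hG).1.mono (le_max_right _ _))
  · refine (norm_add_le _ _).trans ?_
    rw [add_mul]
    exact add_le_add (h G hG).2 (h' G hG).2

theorem _root_.FermiGas.locBdd_zero : LocBdd (0 : FockFin d →ₗ[ℂ] FockFin d) :=
  fun N => ⟨0, 0, le_rfl, fun G _ => ⟨below_zero 0, by simp⟩⟩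

theorem _root_.FermiGas.LocBdd.sum {ι : Type*} (s : Finset ι) {R : ι → FockFin d →ₗ[ℂ] FockFin d}
    (h : ∀ i, LocBdd (R i)) : LocBdd (∑ i ∈ s, R i) := by
  classical
  induction s using Finset.induction_on with
  | empty => rw [Finset.sum_empty]; exact locBdd_zero
  | insert a s ha ih => rw [Finset.sum_insert ha]; exact (h a).add ih

theorem sandwich_zero (p q : Weight d) (h : LocBdd (0 : FockFin d →ₗ[ℂ] FockFin d)) :
    k.sandwich p q 0 h = 0 := by
  have h1 := k.sandwich_add p q h h (by rw [add_zero]; exact h)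
  rw [k.sandwich_congr p q (R := 0 + 0) (R' := 0) _ h (add_zero _)] at h1
  exact left_eq_add.1 h1

theorem sandwich_sum (p q : Weight d) {ι : Type*} (s : Finset ι)
    {R : ι → FockFin d →ₗ[ℂ] FockFin d} (hR : ∀ i, LocBdd (R i)) :
    k.sandwich p q (∑ i ∈ s, R i) (LocBdd.sum s hR) = ∑ i ∈ s, k.sandwich p q (R i) (hR i) := by
  classical
  induction s using Finset.induction_on with
  | empty =>
    rw [k.sandwich_congr p q _ locBdd_zero Finset.sum_empty, Finset.sum_empty, k.sandwich_zero]
  | insert a s ha ih =>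
    rw [k.sandwich_congr p q _ ((hR a).add (LocBdd.sum s hR)) (Finset.sum_insert ha),
      Finset.sum_insert ha, ← ih, k.sandwich_add p q (hR a) (LocBdd.sum s hR)]

/-- The smeared density times a normal-ordered product: the contractions produce the terms in
which two test functions are multiplied. -/
theorem dens_comp_densProd (h : 𝓢(E d, ℝ)) (n : ℕ) (g : Fin n → 𝓢(E d, ℝ)) :
    k.dens (decay d) (overDecay h) ∘ₗ (k.densProd (List.ofFn g)).1
      = (k.densProd (h :: List.ofFn g)).1
        + ∑ i, (k.densProd (List.ofFn (Function.update g i (smul h (g i))))).1 := by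
  induction n with
  | zero =>
    rw [Finset.univ_eq_empty, Finset.sum_empty, add_zero, List.ofFn_zero]
    rfl
  | succ n ih =>
    set l := List.ofFn (Fin.tail g) with hl
    have hg : List.ofFn g = g 0 :: l := List.ofFn_succ
    have hb : ∀ i, LocBdd (k.densProd (List.ofFn
        (Function.update (Fin.tail g) i (smul h (Fin.tail g i))))).1 := fun i =>
      (k.densProd (List.ofFn (Function.update (Fin.tail g) i (smul h (Fin.tail g i))))).2.1
    have h1 : k.dens (decay d) (overDecay h) ∘ₗ (k.densProd (g 0 :: l)).1
        = k.sandwich (decay d) (overDecay (g 0)) (k.dens (decay d) (overDecay h)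
            ∘ₗ (k.densProd l).1) ((k.locBdd_dens _ _).comp (k.densProd l).2.1)
          + (k.densProd (smul h (g 0) :: l)).1 :=
      k.dens_comp_sandwich _ _ _ _ _ (overDecay_smul h (g 0)) (k.densProd l).2.1
    have h2 : k.sandwich (decay d) (overDecay (g 0)) (k.dens (decay d) (overDecay h)
            ∘ₗ (k.densProd l).1) ((k.locBdd_dens _ _).comp (k.densProd l).2.1)
        = (k.densProd (h :: g 0 :: l)).1 + ∑ i : Fin n, (k.densProd (g 0 :: List.ofFn
            (Function.update (Fin.tail g) i (smul h (Fin.tail g i))))).1 := by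
      refine (k.sandwich_congr _ _ _ ((k.densProd (h :: l)).2.1.add (LocBdd.sum _ hb))
        (ih (Fin.tail g))).trans ?_
      refine (k.sandwich_add _ _ (k.densProd (h :: l)).2.1 (LocBdd.sum _ hb) _).trans ?_
      exact congrArg₂ (· + ·) (congrArg Subtype.val (k.dress_comm (g 0) h (k.densProd l)))
        (k.sandwich_sum _ _ _ hb)
    have h3 : ∑ i, (k.densProd (List.ofFn (Function.update g i (smul h (g i))))).1
        = (k.densProd (smul h (g 0) :: l)).1 + ∑ i : Fin n, (k.densProd (g 0 :: List.ofFn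
            (Function.update (Fin.tail g) i (smul h (Fin.tail g i))))).1 := by
      have e0 : List.ofFn (Function.update g 0 (smul h (g 0))) = smul h (g 0) :: l := by
        rw [List.ofFn_succ, Function.update_self]
        simp only [Function.update_of_ne (Fin.succ_ne_zero _)]
        rfl
      have e1 : ∀ i : Fin n, List.ofFn (Function.update g i.succ (smul h (g i.succ)))
          = g 0 :: List.ofFn (Function.update (Fin.tail g) i (smul h (Fin.tail g i))) := by
        intro i
        rw [List.ofFn_succ, Function.update_of_ne (Fin.succ_ne_zero i).symm]
        exact congrArg (fun t => g 0 :: List.ofFn t) (Fin.tail_update_succ g i _)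
      refine (Fin.sum_univ_succ _).trans (congrArg₂ (· + ·) ?_ ?_)
      · exact congrArg (fun l => (k.densProd l).1) e0
      · exact Finset.sum_congr rfl fun i _ => congrArg (fun l => (k.densProd l).1) (e1 i)
    rw [hg]
    exact eq_add_of_eq_add_add h1 h2 h3

theorem densProd_perm_comp {n : ℕ} (f : Fin n → 𝓢(E d, ℝ)) (σ : Equiv.Perm (Fin n)) :
    k.densProd (List.ofFn (f ∘ σ)) = k.densProd (List.ofFn f) :=
  k.densProd_perm (σ.ofFn_comp_perm f)

/-- The recursion multiplies by the density of the last test function, which the list puts in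
front. -/
theorem densProd_last_cons {n : ℕ} (f : Fin (n + 1) → 𝓢(E d, ℝ)) :
    k.densProd (f (Fin.last n) :: List.ofFn fun j : Fin n => f j.castSucc)
      = k.densProd (List.ofFn f) := by
  refine k.densProd_perm ?_
  rw [List.ofFn_succ' f, List.concat_eq_append]
  exact (List.perm_append_singleton _ _).symm

/-- The recursion for the normal-ordered products, given the smeared densities. -/
theorem wick_eq_densProd
    (hrho : ∀ f : 𝓢(E d, ℝ), k.rho f = (k.densProd [f]).1) (n : ℕ)
    (f : Fin (n + 1) → 𝓢(E d, ℝ)) : k.wick (n + 1) f = (k.densProd (List.ofFn f)).1 := by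
  induction n with
  | zero =>
    change k.rho (f 0) = _
    rw [hrho]
    simp
  | succ n ih =>
    have hterm : ∀ σ : Equiv.Perm (Fin (n + 2)),
        (k.rho (f (σ (Fin.last (n + 1)))) ∘ₗ k.wick (n + 1) (fun j => f (σ j.castSucc))
        - ∑ i : Fin (n + 1), k.wick (n + 1)
            (Function.update (fun j => f (σ j.castSucc)) i
              (SchwartzMap.smulLeftCLM ℝ (f (σ (Fin.last (n + 1)))) (f (σ i.castSucc)))))
        = (k.densProd (List.ofFn f)).1 := by
      intro σ
      have h1 := k.dens_comp_densProd (f (σ (Fin.last (n + 1)))) (n + 1)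
        fun j => f (σ j.castSucc)
      rw [ih, hrho, Finset.sum_congr rfl fun i _ => ih _]
      refine (sub_eq_of_eq_add (h1.trans ?_))
      refine congrArg₂ (· + ·) ?_ rfl
      exact congrArg Subtype.val
        ((k.densProd_last_cons (f ∘ σ)).trans (k.densProd_perm_comp f σ))
    exact inv_factorial_smul_sum hterm

end MomentumDensity

/-! ### Parseval's identity for functions with values in the finite-particle space -/

theorem countable_of_orthonormal {V ι : Type*} [NormedAddCommGroup V] [InnerProductSpace ℂ V]
    [TopologicalSpace.SeparableSpace V] {e : ι → V} (he : Orthonormal ℂ e) : Countable ι := by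
  have h1 : ∀ i j, i ≠ j → (1 : ℝ) < dist (e i) (e j) := by
    intro i j hij
    have h2 : ‖e i - e j‖ ^ 2 = 2 := by
      have h := norm_sub_sq (𝕜 := ℂ) (e i) (e j)
      rw [he.2 hij, he.1, he.1] at h
      rw [h]; simp; norm_num
    rw [dist_eq_norm]
    nlinarith [norm_nonneg (e i - e j)]
  have h2 : (Set.univ : Set ι).PairwiseDisjoint fun i => Metric.ball (e i) (1 / 2) := by
    intro i _ j _ hij
    refine Metric.ball_disjoint_ball ?_
    have := h1 i j hij
    norm_num
    exact this.le
  have h3 := h2.countable_of_isOpen (fun i _ => Metric.isOpen_ball) fun i _ =>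
    ⟨e i, Metric.mem_ball_self (by norm_num)⟩
  exact Set.countable_univ_iff.1 h3

theorem enorm_sq_eq_tsum_inner {V ι : Type*} [NormedAddCommGroup V] [InnerProductSpace ℂ V]
    (e : HilbertBasis ι ℂ V) (x : V) :
    ‖x‖ₑ ^ 2 = ∑' i, ‖(inner ℂ (e i) x : ℂ)‖ₑ ^ 2 := by
  have h1 : HasSum (fun i => ‖(inner ℂ (e i) x : ℂ)‖ ^ 2) (‖x‖ ^ 2) := by
    have := lp.hasSum_norm (p := 2) (by norm_num) (e.repr x)
    simpa [HilbertBasis.repr_apply_apply] using this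
  rw [← ofReal_norm, ← ENNReal.ofReal_pow (norm_nonneg _), ← h1.tsum_eq,
    ENNReal.ofReal_tsum_of_nonneg (fun _ => by positivity) h1.summable]
  refine tsum_congr fun i => ?_
  rw [ENNReal.ofReal_pow (norm_nonneg _), ofReal_norm]

/-- The vector with a single nonzero component. -/
def single (n : ℕ) (F : NParticle d n) : FockFin d :=
  ⟨lp.single 2 n F, n + 1, fun m hm =>
    lp.single_apply_ne (E := fun n => NParticle d n) 2 n F (show m ≠ n by omega)⟩

instance instInnerNParticle (d n : ℕ) : Inner ℂ (NParticle d n) :=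
  (Submodule.innerProductSpace (NParticle d n)).toInner

theorem inner_single (n : ℕ) (F : NParticle d n) (G : FockFin d) :
    (inner ℂ (single n F) G : ℂ) = inner ℂ F ((G : Fock d) n) := by
  rw [Submodule.coe_inner]
  exact lp.inner_single_left (𝕜 := ℂ) n F (G : Fock d)

instance (d n : ℕ) : TopologicalSpace.SeparableSpace (NParticle d n) := by
  have : Fact ((2 : ℝ≥0∞) ≠ ∞) := ⟨ENNReal.ofNat_ne_top⟩
  have : SecondCountableTopology (Lp ℂ 2 (μ d n)) := inferInstance
  infer_instance

/-- The Fock space is separable with an orthonormal basis of vectors of fixed particle number.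
This reduces measurability of norms to measurability of countably many scalar products. -/
theorem exists_countable_parseval (d : ℕ) : ∃ (ι : Type) (_ : Countable ι) (ε : ι → FockFin d),
    ∀ G, ‖G‖ₑ ^ 2 = ∑' m, ‖(inner ℂ (ε m) G : ℂ)‖ₑ ^ 2 := by
  choose w e _ using fun n => exists_hilbertBasis ℂ (NParticle d n)
  have hc : ∀ n, Countable (w n) := fun n => countable_of_orthonormal (e n).orthonormal
  refine ⟨Σ n, w n, inferInstance, fun m => single m.1 (e m.1 m.2), fun G => ?_⟩
  have h1 : HasSum (fun n => ‖(G : Fock d) n‖ ^ 2) (‖(G : Fock d)‖ ^ 2) := by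
    have := lp.hasSum_norm (p := 2) (by norm_num) (G : Fock d)
    simpa using this
  have h2 : ‖G‖ₑ ^ 2 = ENNReal.ofReal (‖(G : Fock d)‖ ^ 2) := by
    rw [ENNReal.ofReal_pow (norm_nonneg _), ofReal_norm]
    rfl
  have h3 : ENNReal.ofReal (‖(G : Fock d)‖ ^ 2)
      = ∑' n, ENNReal.ofReal (‖(G : Fock d) n‖ ^ 2) :=
    (congrArg ENNReal.ofReal h1.tsum_eq.symm).trans
      (ENNReal.ofReal_tsum_of_nonneg (fun _ => sq_nonneg _) h1.summable)
  have h4 : ∀ n, ENNReal.ofReal (‖(G : Fock d) n‖ ^ 2)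
      = ∑' i, ‖(inner ℂ (single n (e n i)) G : ℂ)‖ₑ ^ 2 := by
    intro n
    rw [ENNReal.ofReal_pow (norm_nonneg _), ofReal_norm]
    refine (enorm_sq_eq_tsum_inner (e n) ((G : Fock d) n)).trans (tsum_congr fun i => ?_)
    exact congrArg (fun z : ℂ => ‖z‖ₑ ^ 2) (inner_single n (e n i) G).symm
  exact h2.trans (h3.trans ((tsum_congr h4).trans (ENNReal.tsum_sigma
    fun n i => ‖(inner ℂ (single n (e n i)) G : ℂ)‖ₑ ^ 2).symm))

theorem aemeasurable_enorm_sq_of_inner {T : Type} [MeasurableSpace T] {ν : Measure T}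
    {F : T → FockFin d} (hF : ∀ η, AEStronglyMeasurable (fun t => (inner ℂ η (F t) : ℂ)) ν) :
    AEMeasurable (fun t => ‖F t‖ₑ ^ 2) ν := by
  obtain ⟨ι, _, ε, hε⟩ := exists_countable_parseval d
  simp only [hε]
  exact AEMeasurable.tsum fun m => (hF (ε m)).enorm.pow_const 2

theorem norm_add_smul_sq (c : ℂ) (G K : FockFin d) :
    ‖G + c • K‖ ^ 2 = ‖G‖ ^ 2 + 2 * (c * inner ℂ G K).re + ‖c‖ ^ 2 * ‖K‖ ^ 2 := by
  have h := norm_add_sq (𝕜 := ℂ) G (c • K)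
  rw [fock_inner_smul_right, norm_smul, mul_pow] at h
  exact h

theorem fock_polarization (G K : FockFin d) :
    (inner ℂ G K : ℂ) = 4⁻¹ * (((‖G + (1 : ℂ) • K‖ ^ 2 : ℝ) : ℂ)
      - ((‖G + (-1 : ℂ) • K‖ ^ 2 : ℝ) : ℂ) + ((‖G + (-Complex.I) • K‖ ^ 2 : ℝ) : ℂ) * Complex.I
      - ((‖G + Complex.I • K‖ ^ 2 : ℝ) : ℂ) * Complex.I) := by
  simp only [norm_add_smul_sq]
  generalize (inner ℂ G K : ℂ) = z
  generalize ‖G‖ = a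
  generalize ‖K‖ = b
  refine Complex.ext ?_ ?_
  · simp [-Complex.ofReal_pow]
    ring
  · simp [-Complex.ofReal_pow]
    ring

/-- Polarization of an identity between an integral and a sum, with the coefficients of
`fock_polarization`. -/
theorem hasSum_polarization {α ι : Type*} [MeasurableSpace α] {m : Measure α}
    {a b c e : α → ℂ} {a' b' c' e' : ι → ℂ} (ha : Integrable a m) (hb : Integrable b m)
    (hc : Integrable c m) (he : Integrable e m) (ha' : HasSum a' (∫ x, a x ∂m))
    (hb' : HasSum b' (∫ x, b x ∂m)) (hc' : HasSum c' (∫ x, c x ∂m))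
    (he' : HasSum e' (∫ x, e x ∂m)) :
    Integrable (fun x => 4⁻¹ * (a x - b x + c x * Complex.I - e x * Complex.I)) m ∧
      HasSum (fun j => 4⁻¹ * (a' j - b' j + c' j * Complex.I - e' j * Complex.I))
        (∫ x, 4⁻¹ * (a x - b x + c x * Complex.I - e x * Complex.I) ∂m) := by
  have h1 := ha.sub hb
  have h2 := hc.mul_const Complex.I
  have h3 := he.mul_const Complex.I
  have h4 := h1.add h2
  refine ⟨(h4.sub h3).const_mul _, ?_⟩
  have e1 : ∫ x, 4⁻¹ * (a x - b x + c x * Complex.I - e x * Complex.I) ∂m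
      = 4⁻¹ * (∫ x, a x ∂m - ∫ x, b x ∂m + (∫ x, c x ∂m) * Complex.I
        - (∫ x, e x ∂m) * Complex.I) := by
    rw [integral_const_mul, ← integral_mul_const, ← integral_mul_const, ← integral_sub ha hb]
    exact congrArg _ ((integral_sub h4 h3).trans (congrArg (· - _) (integral_add h1 h2)))
  rw [e1]
  exact ((((ha'.sub hb').add (hc'.mul_right _)).sub (he'.mul_right _)).mul_left _)

/-- The function `F` with values in the finite-particle space is weakly measurable and
square-integrable with at most `N` particles, and `f j` is its coefficient with respect to the
basis vector `e_j`. -/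
structure IsField (N : ℕ) (F : E d → FockFin d) (f : basisSet d → FockFin d) : Prop where
  below : ∀ x, Below N (F x)
  meas : ∀ η, AEStronglyMeasurable (fun x => (inner ℂ η (F x) : ℂ)) volume
  lintegral_lt : ∫⁻ x, ‖F x‖ₑ ^ 2 < ∞
  coeff : ∀ η j, ∫ x, conj (basis d j x) * (inner ℂ η (F x) : ℂ) = inner ℂ η (f j)

namespace IsField

variable {N : ℕ} {F : E d → FockFin d} {f : basisSet d → FockFin d}

theorem aemeasurable_enorm_sq (h : IsField N F f) : AEMeasurable fun x => ‖F x‖ₑ ^ 2 :=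
  aemeasurable_enorm_sq_of_inner h.meas

theorem memLp_inner (h : IsField N F f) (η : FockFin d) :
    MemLp (fun x => (inner ℂ η (F x) : ℂ)) 2 volume := by
  refine memLp_two_of_lintegral (h.meas η) ?_
  calc ∫⁻ x, ‖(inner ℂ η (F x) : ℂ)‖ₑ ^ 2 ≤ ∫⁻ x, ‖η‖ₑ ^ 2 * ‖F x‖ₑ ^ 2 := by
        refine lintegral_mono fun x => ?_
        rw [← mul_pow]
        refine pow_le_pow_left' ?_ 2
        rw [← ofReal_norm, ← ofReal_norm, ← ofReal_norm, ← ENNReal.ofReal_mul (norm_nonneg _)]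
        exact ENNReal.ofReal_le_ofReal (norm_inner_le_norm _ _)
    _ < ∞ := by
        rw [lintegral_const_mul' _ _ (by finiteness)]
        exact ENNReal.mul_lt_top (by finiteness) h.lintegral_lt

/-- Parseval for a vector-valued function, from Parseval for its countably many scalar
coefficients and an interchange of sums. -/
theorem lintegral_eq (h : IsField N F f) : ∫⁻ x, ‖F x‖ₑ ^ 2 = ∑' j, ‖f j‖ₑ ^ 2 := by
  obtain ⟨ι, _, ε, hε⟩ := exists_countable_parseval d
  simp only [hε]
  rw [lintegral_tsum fun m => (h.meas (ε m)).enorm.pow_const 2, ENNReal.tsum_comm]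
  refine tsum_congr fun m => ?_
  have h1 := h.memLp_inner (ε m)
  have h2 := enorm_sq_eq_tsum_inner (basis d) (h1.toLp _)
  rw [enorm_sq_eq_lintegral] at h2
  have h3 : ∫⁻ x, ‖(inner ℂ (ε m) (F x) : ℂ)‖ₑ ^ 2 = ∫⁻ x, ‖h1.toLp _ x‖ₑ ^ 2 := by
    refine lintegral_congr_ae ?_
    filter_upwards [h1.coeFn_toLp] with x hx
    rw [hx]
  rw [h3, h2]
  refine tsum_congr fun j => ?_
  rw [← h.coeff, L2.inner_def]
  congr 2
  refine integral_congr_ae ?_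
  filter_upwards [h1.coeFn_toLp] with x hx
  rw [hx, RCLike.inner_apply, mul_comm]

theorem integrable_norm_sq (h : IsField N F f) : Integrable fun x => ‖F x‖ ^ 2 := by
  have h1 : ∀ x, ‖F x‖ ^ 2 = (‖F x‖ₑ ^ 2).toReal := fun x => by
    rw [ENNReal.toReal_pow, toReal_enorm]
  simp only [h1]
  exact integrable_toReal_of_lintegral_ne_top h.aemeasurable_enorm_sq h.lintegral_lt.ne

theorem hasSum_norm_sq (h : IsField N F f) : HasSum (fun j => ‖f j‖ ^ 2) (∫ x, ‖F x‖ ^ 2) := by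
  have h1 : ∀ G : FockFin d, ‖G‖ ^ 2 = (‖G‖ₑ ^ 2).toReal := fun x => by
    rw [ENNReal.toReal_pow, toReal_enorm]
  have h2 := h.lintegral_lt.ne
  simp only [h1]
  rw [integral_toReal h.aemeasurable_enorm_sq (Eventually.of_forall fun x => by finiteness),
    h.lintegral_eq]
  rw [h.lintegral_eq] at h2
  have h3 := ENNReal.hasSum_toReal h2
  rwa [← ENNReal.tsum_toReal_eq fun j => by finiteness] at h3

theorem smul (h : IsField N F f) (c : ℂ) : IsField N (fun x => c • F x) fun j => c • f j where
  below x := (h.below x).smul c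
  meas η := by
    simp only [fock_inner_smul_right]
    exact (h.meas η).const_mul c
  lintegral_lt := by
    simp only [enorm_smul, mul_pow]
    rw [lintegral_const_mul' _ _ (by finiteness)]
    exact ENNReal.mul_lt_top (by finiteness) h.lintegral_lt
  coeff η j := by
    simp only [fock_inner_smul_right]
    rw [← h.coeff, ← integral_const_mul]
    exact integral_congr_ae (Eventually.of_forall fun x => by ring)

theorem add {F' : E d → FockFin d} {f' : basisSet d → FockFin d} (h : IsField N F f)
    (h' : IsField N F' f') : IsField N (fun x => F x + F' x) fun j => f j + f' j where
  below x := (h.below x).add (h'.below x)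
  meas η := by
    simp only [inner_add_right]
    exact (h.meas η).add (h'.meas η)
  lintegral_lt := by
    have h1 : ∀ x, ‖F x + F' x‖ₑ ^ 2 ≤ 2 * ‖F x‖ₑ ^ 2 + 2 * ‖F' x‖ₑ ^ 2 := by
      intro x
      have h3 : ‖F x + F' x‖ ^ 2 ≤ 2 * ‖F x‖ ^ 2 + 2 * ‖F' x‖ ^ 2 := by
        have := norm_add_le (F x) (F' x)
        nlinarith [sq_nonneg (‖F x‖ - ‖F' x‖), norm_nonneg (F x + F' x)]
      have h4 := ENNReal.ofReal_le_ofReal h3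
      rw [ENNReal.ofReal_add (by positivity) (by positivity), ENNReal.ofReal_mul zero_le_two,
        ENNReal.ofReal_mul zero_le_two, ENNReal.ofReal_pow (norm_nonneg _),
        ENNReal.ofReal_pow (norm_nonneg _), ENNReal.ofReal_pow (norm_nonneg _)] at h4
      simpa only [ofReal_norm, ENNReal.ofReal_ofNat] using h4
    refine (lintegral_mono h1).trans_lt ?_
    rw [lintegral_add_left' (h.aemeasurable_enorm_sq.const_mul 2),
      lintegral_const_mul' _ _ (by finiteness), lintegral_const_mul' _ _ (by finiteness)]
    exact ENNReal.add_lt_top.2 ⟨ENNReal.mul_lt_top (by finiteness) h.lintegral_lt,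
      ENNReal.mul_lt_top (by finiteness) h'.lintegral_lt⟩
  coeff η j := by
    simp only [inner_add_right, mul_add]
    rw [← h.coeff, ← h'.coeff, integral_add]
    · exact integrable_conj_mul (Lp.memLp _) (h.memLp_inner η)
    · exact integrable_conj_mul (Lp.memLp _) (h'.memLp_inner η)

/-- Adjointable operators act on such functions. -/
theorem map (h : IsField N F f) {R : FockFin d →ₗ[ℂ] FockFin d} (hR : Adjointable R) :
    ∃ M, IsField M (fun x => R (F x)) fun j => R (f j) := by
  obtain ⟨hR1, R', -, hR'⟩ := hR
  obtain ⟨M, C, hC, hM⟩ := hR1 N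
  have hadj : ∀ η G, (inner ℂ η (R G) : ℂ) = inner ℂ (R' η) G := by
    intro η G
    rw [← inner_conj_symm, hR', inner_conj_symm]
  refine ⟨M, fun x => (hM _ (h.below x)).1, fun η => ?_, ?_, fun η j => ?_⟩
  · simp only [hadj]
    exact h.meas _
  · have h1 : ∀ x, ‖R (F x)‖ₑ ^ 2 ≤ ENNReal.ofReal (C ^ 2) * ‖F x‖ₑ ^ 2 := by
      intro x
      rw [ENNReal.ofReal_pow hC, ← mul_pow]
      refine pow_le_pow_left' ?_ 2
      rw [← ofReal_norm, ← ofReal_norm, ← ENNReal.ofReal_mul hC]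
      exact ENNReal.ofReal_le_ofReal (hM _ (h.below x)).2
    refine (lintegral_mono h1).trans_lt ?_
    rw [lintegral_const_mul' _ _ ENNReal.ofReal_ne_top]
    exact ENNReal.mul_lt_top ENNReal.ofReal_lt_top h.lintegral_lt
  · simp only [hadj]
    exact h.coeff _ _

theorem mono (h : IsField N F f) {M : ℕ} (hM : N ≤ M) : IsField M F f :=
  ⟨fun x => (h.below x).mono hM, h.meas, h.lintegral_lt, h.coeff⟩

/-- Parseval's identity. -/
theorem hasSum_inner {N' : ℕ} {F' : E d → FockFin d} {f' : basisSet d → FockFin d}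
    (h₁ : IsField N F f) (h₂ : IsField N' F' f') :
    Integrable (fun x => (inner ℂ (F x) (F' x) : ℂ)) ∧
      HasSum (fun j => (inner ℂ (f j) (f' j) : ℂ)) (∫ x, (inner ℂ (F x) (F' x) : ℂ)) := by
  have h := h₁.mono (le_max_left N N')
  have h' := h₂.mono (le_max_right N N')
  have hf : ∀ c : ℂ, IsField (max N N') (fun x => F x + c • F' x) fun j => f j + c • f' j :=
    fun c => h.add (h'.smul c)
  have hi : ∀ c : ℂ, Integrable fun x => ((‖F x + c • F' x‖ ^ 2 : ℝ) : ℂ) := fun c =>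
    (hf c).integrable_norm_sq.ofReal
  have hs : ∀ c : ℂ, HasSum (fun j => ((‖f j + c • f' j‖ ^ 2 : ℝ) : ℂ))
      (∫ x, ((‖F x + c • F' x‖ ^ 2 : ℝ) : ℂ)) := fun c => by
    rw [integral_complex_ofReal]
    exact Complex.hasSum_ofReal.2 (hf c).hasSum_norm_sq
  have key := hasSum_polarization (hi 1) (hi (-1)) (hi (-Complex.I)) (hi Complex.I)
    (hs 1) (hs (-1)) (hs (-Complex.I)) (hs Complex.I)
  refine ⟨key.1.congr (Eventually.of_forall fun x => (fock_polarization (F x) (F' x)).symm), ?_⟩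
  have e : ∫ x, (inner ℂ (F x) (F' x) : ℂ) = _ := integral_congr_ae
    (Eventually.of_forall fun x => fock_polarization (F x) (F' x))
  rw [e]
  exact key.2.congr_fun fun j => fock_polarization (f j) (f' j)

end IsField

/-! ### Partial Fourier transforms of Schwartz functions -/

section PartialFourier

section Slice

variable {A B W : Type} [NormedAddCommGroup A] [NormedSpace ℝ A] [NormedAddCommGroup B]
  [NormedSpace ℝ B] [NormedAddCommGroup W] [NormedSpace ℂ W]

theorem exists_bound_iteratedFDeriv_slice (φ : 𝓢(A × B, W)) (j k n : ℕ) :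
    ∃ C, ∀ y z, ‖y‖ ^ j * (‖z‖ ^ k * ‖iteratedFDeriv ℝ n (fun z => φ (z, y)) z‖) ≤ C := by
  obtain ⟨C, hC⟩ := φ.decay' (j + k) n
  refine ⟨C, fun y z => le_trans ?_ (hC (z, y))⟩
  have h0 : (fun z => φ (z, y))
      = (fun w => φ (w + (0, y))) ∘ (ContinuousLinearMap.inl ℝ A B) := by
    funext z; simp
  have hs : ContDiff ℝ (n : ℕ) (fun w => φ (w + (0, y))) :=
    (φ.smooth n).comp (contDiff_id.add contDiff_const)
  have h1 : ‖iteratedFDeriv ℝ n (fun z => φ (z, y)) z‖ ≤ ‖iteratedFDeriv ℝ n φ (z, y)‖ := by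
    rw [h0, ContinuousLinearMap.iteratedFDeriv_comp_right _ hs z le_rfl,
      iteratedFDeriv_comp_add_right]
    refine (ContinuousMultilinearMap.norm_compContinuousLinearMap_le _ _).trans ?_
    have h2 : ContinuousLinearMap.inl ℝ A B z + (0, y) = (z, y) := by simp
    rw [h2]
    refine mul_le_of_le_one_right (norm_nonneg _) (Finset.prod_le_one (fun _ _ => norm_nonneg _)
      fun _ _ => ?_)
    refine ContinuousLinearMap.opNorm_le_bound _ zero_le_one fun z => ?_
    simp
  have h3 : ‖y‖ ^ j * ‖z‖ ^ k ≤ ‖(z, y)‖ ^ (j + k) := by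
    rw [pow_add]
    exact mul_le_mul (pow_le_pow_left₀ (norm_nonneg _) (norm_snd_le (z, y)) _)
      (pow_le_pow_left₀ (norm_nonneg _) (norm_fst_le (z, y)) _) (by positivity) (by positivity)
  rw [← mul_assoc]
  exact mul_le_mul h3 h1 (norm_nonneg _) (by positivity)

/-- The slice `z ↦ φ (z, y)` of a Schwartz function of two variables. -/
def slice (φ : 𝓢(A × B, W)) (y : B) : 𝓢(A, W) where
  toFun z := φ (z, y)
  smooth' := (φ.smooth _).comp (contDiff_id.prodMk contDiff_const)
  decay' k n := by
    obtain ⟨C, hC⟩ := exists_bound_iteratedFDeriv_slice φ 0 k n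
    exact ⟨C, fun z => by simpa using hC y z⟩

theorem slice_apply (φ : 𝓢(A × B, W)) (y : B) (z : A) : slice φ y z = φ (z, y) := rfl

/-- All Schwartz seminorms of the slices decay faster than any power of the frozen variable. -/
theorem exists_bound_seminorm_slice (φ : 𝓢(A × B, W)) (j : ℕ) (s : Finset (ℕ × ℕ)) :
    ∃ C, ∀ y, ‖y‖ ^ j * (s.sup (schwartzSeminormFamily ℂ A W)) (slice φ y) ≤ C := by
  have h1 : ∀ m : ℕ × ℕ, ∃ C, ∀ y, ‖y‖ ^ j * schwartzSeminormFamily ℂ A W m (slice φ y) ≤ C := by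
    intro m
    obtain ⟨C, hC⟩ := exists_bound_iteratedFDeriv_slice φ j m.1 m.2
    refine ⟨C, fun y => ?_⟩
    have hC0 : 0 ≤ C := le_trans (by positivity) (hC y 0)
    rcases eq_or_lt_of_le (pow_nonneg (norm_nonneg y) j) with h | h
    · rw [← h, zero_mul]; exact hC0
    · rw [mul_comm, ← le_div_iff₀ h]
      refine SchwartzMap.seminorm_le_bound ℂ m.1 m.2 _ (by positivity) fun z => ?_
      rw [le_div_iff₀ h, mul_comm]
      exact hC y z
  choose C hC using h1
  refine ⟨∑ m ∈ s, C m, fun y => ?_⟩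
  have h2 : (s.sup (schwartzSeminormFamily ℂ A W)) (slice φ y)
      ≤ ∑ m ∈ s, schwartzSeminormFamily ℂ A W m (slice φ y) :=
    Seminorm.finset_sup_apply_le (Finset.sum_nonneg fun m _ => apply_nonneg _ _) fun m hm =>
      Finset.single_le_sum (f := fun m => schwartzSeminormFamily ℂ A W m (slice φ y))
        (fun m _ => apply_nonneg _ _) hm
  refine (mul_le_mul_of_nonneg_left h2 (by positivity)).trans ?_
  rw [Finset.mul_sum]
  exact Finset.sum_le_sum fun m _ => hC m y

theorem exists_bound_slice (φ : 𝓢(A × B, W)) (j K : ℕ) :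
    ∃ C, ∀ y z, ‖y‖ ^ j * ((1 + ‖z‖) ^ K * ‖φ (z, y)‖) ≤ C := by
  obtain ⟨C, hC⟩ := exists_bound_seminorm_slice φ j (Finset.Iic (K, 0))
  refine ⟨2 ^ K * C, fun y z => ?_⟩
  have h := SchwartzMap.one_add_le_sup_seminorm_apply (𝕜 := ℂ) (m := (K, 0)) (k := K) (n := 0)
    le_rfl le_rfl (slice φ y) z
  rw [norm_iteratedFDeriv_zero] at h
  refine (mul_le_mul_of_nonneg_left h (by positivity)).trans ?_
  rw [mul_left_comm]
  exact mul_le_mul_of_nonneg_left (hC y) (by positivity)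

/-- The derivative of a Schwartz function of two variables in the second variable. -/
def derivSnd (φ : 𝓢(A × B, W)) : 𝓢(A × B, B →L[ℝ] W) :=
  SchwartzMap.postcompCLM ((ContinuousLinearMap.compL ℝ B (A × B) W).flip
    (ContinuousLinearMap.inr ℝ A B)) (SchwartzMap.fderivCLM ℝ (A × B) W φ)

theorem hasFDerivAt_derivSnd (φ : 𝓢(A × B, W)) (z : A) (y : B) :
    HasFDerivAt (fun y => φ (z, y)) (derivSnd φ (z, y)) y := by
  have h1 : HasFDerivAt φ (fderiv ℝ φ (z, y)) (z, y) :=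
    ((φ.smooth 1).differentiable one_ne_zero).differentiableAt.hasFDerivAt
  exact h1.comp y (hasFDerivAt_prodMk_right z y)

end Slice

variable {A B W : Type} [NormedAddCommGroup A] [InnerProductSpace ℝ A] [FiniteDimensional ℝ A]
  [MeasurableSpace A] [BorelSpace A] [NormedAddCommGroup B] [NormedSpace ℝ B]
  [NormedAddCommGroup W] [NormedSpace ℂ W]

/-- The Fourier transform in the first variable of a Schwartz function decays rapidly in both
variables jointly, by continuity of the Fourier transform on Schwartz space. -/
theorem exists_bound_fourier_slice (φ : 𝓢(A × B, W)) (j K : ℕ) :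
    ∃ C, ∀ y ξ, ‖y‖ ^ j * ((1 + ‖ξ‖) ^ K * ‖𝓕 (fun z => φ (z, y)) ξ‖) ≤ C := by
  have hcont : Continuous (((Finset.Iic (K, 0)).sup
      (schwartzSeminormFamily ℂ A W : SeminormFamily ℂ 𝓢(A, W) (ℕ × ℕ))).comp
      (FourierTransform.fourierCLM ℂ 𝓢(A, W)).toLinearMap) :=
    ((schwartz_withSeminorms ℂ A W).finset_sups.continuous_seminorm (Finset.Iic (K, 0))).comp
      (FourierTransform.fourierCLM ℂ 𝓢(A, W)).continuous
  obtain ⟨s, D, -, hD⟩ := Seminorm.bound_of_continuous (schwartz_withSeminorms ℂ A W) _ hcont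
  obtain ⟨C, hC⟩ := exists_bound_seminorm_slice φ j s
  refine ⟨2 ^ K * (D * C), fun y ξ => ?_⟩
  have h := SchwartzMap.one_add_le_sup_seminorm_apply (𝕜 := ℂ) (m := (K, 0)) (k := K) (n := 0)
    le_rfl le_rfl (𝓕 (slice φ y)) ξ
  rw [norm_iteratedFDeriv_zero, SchwartzMap.fourier_coe] at h
  have h2 := Seminorm.le_def.1 hD (slice φ y)
  refine (mul_le_mul_of_nonneg_left (h.trans (mul_le_mul_of_nonneg_left h2 (by positivity)))
    (by positivity)).trans ?_
  rw [mul_left_comm]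
  refine mul_le_mul_of_nonneg_left ?_ (by positivity)
  rw [_root_.smul_apply, NNReal.smul_def, smul_eq_mul, mul_left_comm]
  exact mul_le_mul_of_nonneg_left (hC y) D.2

/-- A majorant of functions on `A`, integrable because `A` is finite-dimensional. -/
theorem integrable_inv_one_add_norm_pow :
    Integrable (fun a : A => ((1 + ‖a‖) ^ (Module.finrank ℝ A + 1))⁻¹) := by
  refine (integrable_one_add_norm (E := A) (μ := volume) (r := (Module.finrank ℝ A + 1 : ℕ))
    (by exact_mod_cast Nat.lt_succ_self _)).congr (Eventually.of_forall fun a => ?_)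
  simp only
  rw [Real.rpow_neg (by positivity), Real.rpow_natCast]

/-- Differentiation under the integral sign, with the integrable majorant `(1 + ‖a‖)^{-(dim A +
1)}`. -/
theorem hasFDerivAt_integral_of_bound {F : B → A → W} {F' : B → A → B →L[ℝ] W} {C C' : ℝ}
    (hm : ∀ y, AEStronglyMeasurable (F y)) (hm' : ∀ y, AEStronglyMeasurable (F' y))
    (hF : ∀ y a, (1 + ‖a‖) ^ (Module.finrank ℝ A + 1) * ‖F y a‖ ≤ C)
    (hF' : ∀ y a, (1 + ‖a‖) ^ (Module.finrank ℝ A + 1) * ‖F' y a‖ ≤ C')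
    (hd : ∀ y a, HasFDerivAt (fun y => F y a) (F' y a) y) (y : B) :
    HasFDerivAt (fun y => ∫ a, F y a) (∫ a, F' y a) y := by
  have hp : ∀ a : A, 0 < (1 + ‖a‖) ^ (Module.finrank ℝ A + 1) := fun a => by positivity
  refine hasFDerivAt_integral_of_dominated_of_fderiv_le (𝕜 := ℝ)
    (bound := fun a => C' * ((1 + ‖a‖) ^ (Module.finrank ℝ A + 1))⁻¹) univ_mem
    (Eventually.of_forall hm) ?_ (hm' y) (Eventually.of_forall fun a y _ => ?_)
    (integrable_inv_one_add_norm_pow.const_mul C') (Eventually.of_forall fun a y _ => hd y a)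
  · refine (integrable_inv_one_add_norm_pow.const_mul C).mono' (hm y)
      (Eventually.of_forall fun a => ?_)
    rw [← div_eq_mul_inv, le_div_iff₀ (hp a), mul_comm]
    exact hF y a
  · rw [← div_eq_mul_inv, le_div_iff₀ (hp a), mul_comm]
    exact hF' y a

theorem hasFDerivAt_fourier_slice (φ : 𝓢(A × B, W)) (ξ : A) (y : B) :
    HasFDerivAt (fun y => 𝓕 (fun z => φ (z, y)) ξ) (𝓕 (fun z => derivSnd φ (z, y)) ξ) y := by
  simp only [Real.fourier_eq]
  obtain ⟨C, hC⟩ := exists_bound_slice φ 0 (Module.finrank ℝ A + 1)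
  obtain ⟨C', hC'⟩ := exists_bound_slice (derivSnd φ) 0 (Module.finrank ℝ A + 1)
  have hc : Continuous fun v : A => Real.fourierChar (-inner ℝ v ξ) :=
    Real.continuous_fourierChar.comp (continuous_id.inner continuous_const).neg
  refine hasFDerivAt_integral_of_bound (C := C) (C' := C')
    (F := fun y v => Real.fourierChar (-inner ℝ v ξ) • φ (v, y))
    (F' := fun y v => Real.fourierChar (-inner ℝ v ξ) • derivSnd φ (v, y))
    (fun y => (hc.smul (slice φ y).continuous).aestronglyMeasurable)
    (fun y => (hc.smul (slice (derivSnd φ) y).continuous).aestronglyMeasurable)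
    (fun y a => ?_) (fun y a => ?_) (fun y a => ?_) y
  · rw [Circle.norm_smul]; simpa using hC y a
  · have h : ‖Real.fourierChar (-inner ℝ a ξ) • derivSnd φ (a, y)‖ = ‖derivSnd φ (a, y)‖ := by
      rw [show Real.fourierChar (-inner ℝ a ξ) • derivSnd φ (a, y)
        = (Real.fourierChar (-inner ℝ a ξ) : ℂ) • derivSnd φ (a, y) from rfl, norm_smul,
        Circle.norm_coe, one_mul]
    rw [h]; simpa using hC' y a
  · exact (hasFDerivAt_derivSnd φ a y).const_smul (Real.fourierChar (-inner ℝ a ξ))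

variable {m : A → ℂ} {c : ℝ}

theorem hasFDerivAt_integral_fourier_slice (hm : AEStronglyMeasurable m) (hc : ∀ ξ, ‖m ξ‖ ≤ c)
    (φ : 𝓢(A × B, W)) (y : B) :
    HasFDerivAt (fun y => ∫ ξ, m ξ • 𝓕 (fun z => φ (z, y)) ξ)
      (∫ ξ, m ξ • 𝓕 (fun z => derivSnd φ (z, y)) ξ) y := by
  obtain ⟨C, hC⟩ := exists_bound_fourier_slice φ 0 (Module.finrank ℝ A + 1)
  obtain ⟨C', hC'⟩ := exists_bound_fourier_slice (derivSnd φ) 0 (Module.finrank ℝ A + 1)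
  have hc0 : 0 ≤ c := (norm_nonneg _).trans (hc 0)
  refine hasFDerivAt_integral_of_bound (C := c * C) (C' := c * C')
    (F := fun y ξ => m ξ • 𝓕 (fun z => φ (z, y)) ξ)
    (F' := fun y ξ => m ξ • 𝓕 (fun z => derivSnd φ (z, y)) ξ)
    (fun y => hm.smul (𝓕 (slice φ y)).continuous.aestronglyMeasurable)
    (fun y => hm.smul (𝓕 (slice (derivSnd φ) y)).continuous.aestronglyMeasurable)
    (fun y a => ?_) (fun y a => ?_) (fun y a => ?_) y
  · rw [norm_smul, mul_left_comm]
    exact mul_le_mul (hc a) (by simpa using hC y a) (by positivity) hc0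
  · rw [norm_smul, mul_left_comm]
    exact mul_le_mul (hc a) (by simpa using hC' y a) (by positivity) hc0
  · exact (hasFDerivAt_fourier_slice φ a y).const_smul (m a)

theorem exists_bound_integral_fourier_slice (hc : ∀ ξ, ‖m ξ‖ ≤ c)
    (φ : 𝓢(A × B, W)) (j : ℕ) :
    ∃ C, ∀ y, ‖y‖ ^ j * ‖∫ ξ, m ξ • 𝓕 (fun z => φ (z, y)) ξ‖ ≤ C := by
  obtain ⟨C, hC⟩ := exists_bound_fourier_slice φ j (Module.finrank ℝ A + 1)
  have hc0 : 0 ≤ c := (norm_nonneg _).trans (hc 0)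
  refine ⟨∫ ξ : A, c * C * ((1 + ‖ξ‖) ^ (Module.finrank ℝ A + 1))⁻¹, fun y => ?_⟩
  have hp : ∀ a : A, 0 < (1 + ‖a‖) ^ (Module.finrank ℝ A + 1) := fun a => by positivity
  have h1 : ‖y‖ ^ j * ‖∫ ξ, m ξ • 𝓕 (fun z => φ (z, y)) ξ‖
      = ‖∫ ξ, ‖y‖ ^ j • (m ξ • 𝓕 (fun z => φ (z, y)) ξ)‖ := by
    rw [integral_smul, norm_smul, norm_pow, norm_norm]
  rw [h1]
  refine norm_integral_le_of_norm_le (integrable_inv_one_add_norm_pow.const_mul _)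
    (Eventually.of_forall fun a => ?_)
  rw [← div_eq_mul_inv, le_div_iff₀ (hp a), norm_smul, norm_smul, norm_pow, norm_norm]
  have h2 := mul_le_mul (hc a) (hC y a) (by positivity) hc0
  linarith

/-- If `m` is bounded and `φ` is a Schwartz function of two variables, then applying the functional
`h ↦ ∫ m 𝓕h` to the first variable leaves a Schwartz function of the second variable. -/
theorem exists_schwartz_integral_fourier_slice (hm : AEStronglyMeasurable m)
    (hc : ∀ ξ, ‖m ξ‖ ≤ c) (φ : 𝓢(A × B, ℂ)) :
    ∃ χ : 𝓢(B, ℂ), ∀ y, χ y = ∫ ξ, m ξ * 𝓕 (fun z => φ (z, y)) ξ := by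
  have hsm : ∀ (n : ℕ) (W : Type) [NormedAddCommGroup W] [NormedSpace ℂ W] (φ : 𝓢(A × B, W)),
      ContDiff ℝ n fun y => ∫ ξ, m ξ • 𝓕 (fun z => φ (z, y)) ξ := by
    intro n
    induction n with
    | zero =>
      intro W _ _ φ
      refine contDiff_zero.2 (continuous_iff_continuousAt.2 fun y => ?_)
      exact (hasFDerivAt_integral_fourier_slice hm hc φ y).continuousAt
    | succ n ih =>
      intro W _ _ φ
      refine contDiff_succ_iff_hasFDerivAt.2 ⟨_, ih _ (derivSnd φ), fun y => ?_⟩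
      exact hasFDerivAt_integral_fourier_slice hm hc φ y
  have hdec : ∀ (n : ℕ) (W : Type) [NormedAddCommGroup W] [NormedSpace ℂ W] (φ : 𝓢(A × B, W))
      (j : ℕ), ∃ C, ∀ y, ‖y‖ ^ j *
        ‖iteratedFDeriv ℝ n (fun y => ∫ ξ, m ξ • 𝓕 (fun z => φ (z, y)) ξ) y‖ ≤ C := by
    intro n
    induction n with
    | zero =>
      intro W _ _ φ j
      simp only [norm_iteratedFDeriv_zero]
      exact exists_bound_integral_fourier_slice hc φ j
    | succ n ih =>
      intro W _ _ φ j
      obtain ⟨C, hC⟩ := ih _ (derivSnd φ) j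
      refine ⟨C, fun y => ?_⟩
      rw [← norm_iteratedFDeriv_fderiv,
        funext fun y => (hasFDerivAt_integral_fourier_slice hm hc φ y).fderiv]
      exact hC y
  refine ⟨⟨fun y => ∫ ξ, m ξ • 𝓕 (fun z => φ (z, y)) ξ, ?_, fun j n => hdec n ℂ φ j⟩, fun y => rfl⟩
  exact contDiff_infty.2 fun n => hsm n ℂ φ

end PartialFourier

/-! ### Test waves -/

/-- The configuration with labels `s` and positions `y`. -/
def withLabels {n : ℕ} (s : Fin n → Fin 2) (y : Fin n → E d) : Fin n → X d := fun i => (s i, y i)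

theorem withLabels_eta {n : ℕ} (y : Fin n → X d) :
    withLabels (fun i => (y i).1) (fun i => (y i).2) = y := rfl

theorem measurable_withLabels {n : ℕ} (s : Fin n → Fin 2) :
    Measurable (withLabels s : (Fin n → E d) → Fin n → X d) :=
  measurable_pi_lambda _ fun i => measurable_const.prodMk (measurable_pi_apply i)

theorem cons_withLabels {n : ℕ} (a : Fin 2) (s : Fin n → Fin 2) (w : E d) (y : Fin n → E d) :
    (Fin.cons (α := fun _ => X d) (a, w) (withLabels s y))
      = withLabels (Fin.cons (α := fun _ => Fin 2) a s) (Fin.cons (α := fun _ => E d) w y) := by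
  funext i
  refine Fin.cases rfl (fun i => rfl) i

/-- The measure on labelled configurations is the sum over the labels of the Lebesgue measures. -/
theorem μ_eq_sum (d n : ℕ) :
    μ d n = Measure.sum fun s : Fin n → Fin 2 => Measure.map (withLabels s) volume := by
  refine Measure.pi_eq fun S hS => ?_
  rw [Measure.sum_apply _ (MeasurableSet.univ_pi hS), tsum_fintype]
  have h1 : ∀ i, μX d (S i) = ∑ a : Fin 2, volume (Prod.mk a ⁻¹' S i) := fun i => by
    rw [μX, Measure.prod_apply (hS i), lintegral_count, tsum_fintype]
  simp only [h1]
  rw [Finset.prod_univ_sum, Fintype.piFinset_univ]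
  refine Finset.sum_congr rfl fun s _ => ?_
  rw [Measure.map_apply (measurable_withLabels s) (MeasurableSet.univ_pi hS)]
  have h2 : withLabels (d := d) s ⁻¹' Set.univ.pi S
      = Set.univ.pi fun i => Prod.mk (s i) ⁻¹' S i := by
    ext y; simp [withLabels]
  rw [h2, volume_pi, Measure.pi_pi]

theorem lintegral_eq_sum {n : ℕ} {F : (Fin n → X d) → ℝ≥0∞} (hF : Measurable F) :
    ∫⁻ y, F y ∂(μ d n) = ∑ s : Fin n → Fin 2, ∫⁻ y, F (withLabels s y) := by
  rw [μ_eq_sum, lintegral_sum_measure, tsum_fintype]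
  exact Finset.sum_congr rfl fun s _ => lintegral_map hF (measurable_withLabels s)

theorem stronglyMeasurable_of_withLabels {n : ℕ} {f : (Fin n → X d) → ℂ}
    (h : ∀ s : Fin n → Fin 2, StronglyMeasurable fun y => f (withLabels s y)) :
    StronglyMeasurable f := by
  have h1 : f = fun y => ∑ s : Fin n → Fin 2,
      if (fun i => (y i).1) = s then f (withLabels s fun i => (y i).2) else 0 := by
    funext y
    rw [Finset.sum_ite_eq Finset.univ]
    simp [withLabels_eta]
  rw [h1]
  refine Finset.stronglyMeasurable_fun_sum _ fun s _ => ?_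
  have hm1 : Measurable fun (y : Fin n → X d) i => (y i).1 := by fun_prop
  have hm2 : Measurable fun (y : Fin n → X d) i => (y i).2 := by fun_prop
  exact StronglyMeasurable.ite (hm1 (measurableSet_singleton s)) ((h s).comp_measurable hm2)
    stronglyMeasurable_const

instance (d n : ℕ) : (volume : Measure (Fin n → E d)).IsAddHaarMeasure :=
  inferInstanceAs (Measure.pi fun _ : Fin n => (volume : Measure (E d))).IsAddHaarMeasure

theorem IsTest.isL2Wave {g : Wave d} (hg : IsTest g) : IsL2Wave g := by
  have hm : ∀ n, StronglyMeasurable (g n) := fun n => by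
    refine stronglyMeasurable_of_withLabels fun s => ?_
    obtain ⟨φ, hφ⟩ := (hg.2 n).1 s
    have h1 : (fun y => g n (withLabels s y)) = φ := funext hφ
    rw [h1]
    exact φ.continuous.stronglyMeasurable
  refine ⟨hg.1, hm, fun n => memLp_two_of_lintegral (hm n).aestronglyMeasurable ?_,
    fun n => (hg.2 n).2⟩
  rw [lintegral_eq_sum ((hm n).enorm.pow_const 2)]
  refine ENNReal.sum_lt_top.2 fun s _ => ?_
  obtain ⟨φ, hφ⟩ := (hg.2 n).1 s
  have h1 : ∀ y, g n (withLabels s y) = φ y := hφ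
  simp only [h1]
  exact lintegral_enorm_sq_lt_top (φ.memLp 2 volume)

/-- The functions whose restriction to the second copy is a Schwartz function. -/
def schwartzSnd (d : ℕ) : Submodule ℂ (X d → ℂ) where
  carrier := {h | ∃ φ : 𝓢(E d, ℂ), ∀ z, h (1, z) = φ z}
  add_mem' := by
    rintro h h' ⟨φ, hφ⟩ ⟨φ', hφ'⟩
    exact ⟨φ + φ', fun z => by rw [Pi.add_apply, hφ, hφ', _root_.add_apply]⟩
  zero_mem' := ⟨0, fun z => rfl⟩
  smul_mem' := by
    rintro c h ⟨φ, hφ⟩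
    exact ⟨c • φ, fun z => by rw [Pi.smul_apply, hφ, _root_.smul_apply]⟩

theorem IsTest.slice_mem {g : Wave d} (hg : IsTest g) {n : ℕ} (y : Fin n → X d) :
    (fun z => g (n + 1) (Fin.cons (α := fun _ => X d) z y)) ∈ schwartzSnd d := by
  obtain ⟨φ, hφ⟩ := (hg.2 (n + 1)).1 (Fin.cons (α := fun _ => Fin 2) 1 fun i => (y i).1)
  refine ⟨slice (SchwartzMap.compCLMOfContinuousLinearEquiv ℂ
    (Fin.consEquivL ℝ fun _ : Fin (n + 1) => E d) φ) (fun i => (y i).2), fun z => ?_⟩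
  rw [slice_apply]
  dsimp only
  have h1 := cons_withLabels 1 (fun i => (y i).1) z (fun i => (y i).2)
  rw [withLabels_eta] at h1
  rw [h1]
  exact hφ _

namespace MomentumDensity

variable (k : MomentumDensity d)

/-- The symbol of the functional `vec2 x`. -/
def symbol2 (x ξ : E d) : ℂ := k.sqrtCoDensity ξ * Real.fourierChar (inner ℝ ξ x)

theorem aestronglyMeasurable_symbol2 (x : E d) :
    AEStronglyMeasurable (k.symbol2 x) volume := by
  refine k.mul2.aesm.mul (Continuous.aestronglyMeasurable ?_)
  exact continuous_subtype_val.comp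
    (Real.continuous_fourierChar.comp (continuous_id.inner continuous_const))

theorem norm_symbol2_le (x ξ : E d) : ‖k.symbol2 x ξ‖ ≤ 1 := by
  rw [symbol2, norm_mul, Circle.norm_coe, mul_one, sqrtCoDensity, Complex.norm_real,
    Real.norm_eq_abs, abs_of_nonneg (Real.sqrt_nonneg _)]
  exact Real.sqrt_le_one.2 (by linarith [k.nonneg ((2 * Real.pi) • ξ)])

/-- The translation by `x` is moved into the symbol, so that the functional is a bounded weight on
the Fourier side. -/
theorem vec2_eq (x : E d) (h : X d → ℂ) :
    k.vec2 x h = ∫ ξ, k.symbol2 x ξ * 𝓕 (fun z => h (1, z)) ξ := by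
  refine integral_congr_ae (Eventually.of_forall fun ξ => ?_)
  dsimp only
  rw [fourier_comp_add_left (fun z => h (1, z)) x ξ, symbol2, Circle.smul_def, smul_eq_mul,
    mul_assoc]

theorem vec2_mul (x : E d) (c : ℂ) (h : X d → ℂ) :
    k.vec2 x (fun z => c * h z) = c * k.vec2 x h := by
  rw [vec2_eq, vec2_eq, ← integral_const_mul]
  refine integral_congr_ae (Eventually.of_forall fun ξ => ?_)
  have h1 : 𝓕 (fun z : E d => c * h (1, z)) ξ = c * 𝓕 (fun z : E d => h (1, z)) ξ := by
    rw [Real.fourier_eq, Real.fourier_eq, ← integral_const_mul]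
    refine integral_congr_ae (Eventually.of_forall fun v => ?_)
    simp only [Circle.smul_def, smul_eq_mul]
    ring
  dsimp only
  rw [h1]
  ring

theorem vec2_add (x : E d) {h h' : X d → ℂ} (hh : h ∈ schwartzSnd d) (hh' : h' ∈ schwartzSnd d) :
    k.vec2 x (fun z => h z + h' z) = k.vec2 x h + k.vec2 x h' := by
  obtain ⟨φ, hφ⟩ := hh
  obtain ⟨φ', hφ'⟩ := hh'
  have hi : ∀ φ : 𝓢(E d, ℂ), Integrable fun ξ => k.symbol2 x ξ * 𝓕 φ ξ := fun φ =>
    (𝓕 φ).integrable.bdd_mul (k.aestronglyMeasurable_symbol2 x)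
      (Eventually.of_forall (k.norm_symbol2_le x))
  have hF : 𝓕 (fun z => φ z + φ' z) = ⇑(𝓕 φ : 𝓢(E d, ℂ)) + ⇑(𝓕 φ' : 𝓢(E d, ℂ)) := by
    have h1 : (fun z => φ z + φ' z) = ⇑(φ + φ') := rfl
    rw [h1, ← SchwartzMap.fourier_coe, FourierTransform.fourier_add]
    rfl
  simp only [vec2_eq, hφ, hφ', hF]
  rw [← SchwartzMap.fourier_coe, ← SchwartzMap.fourier_coe, ← integral_add (hi φ) (hi φ')]
  exact integral_congr_ae (Eventually.of_forall fun ξ => by simp only [Pi.add_apply, mul_add])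

/-- The two generalized vectors live on different labels, so the annihilation part at `x`
anticommutes with the creation part at `x'` and no pointwise contraction appears. -/
theorem vec2_vec1 (x x' : E d) : k.vec2 x (k.vec1 x') = 0 := by
  have h := k.vec2_mul x 0 (k.vec1 x')
  rw [zero_mul] at h
  rw [← h, vec2_eq, vec2_eq]
  simp [vec1]

theorem vec1_mem (x : E d) : k.vec1 x ∈ schwartzSnd d := ⟨0, fun z => by simp [vec1]⟩

/-- Annihilation at a point maps test waves to test waves. -/
theorem isTest_annihilation {g : Wave d} (hg : IsTest g) (x : E d) :
    IsTest (annihilation (k.vec2 x) g) := by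
  obtain ⟨N, hN⟩ := hg.1
  refine ⟨⟨N, fun n hn => annihilation_fin (k.vec2_mul x) hN n (by omega)⟩,
    fun n => ⟨fun s => ?_, fun σ y => annihilation_anti (k.vec2_mul x) (fun n => (hg.2 n).2) n σ y⟩⟩
  obtain ⟨φ, hφ⟩ := (hg.2 (n + 1)).1 (Fin.cons (α := fun _ => Fin 2) 1 s)
  obtain ⟨χ, hχ⟩ := exists_schwartz_integral_fourier_slice (k.aestronglyMeasurable_symbol2 x)
    (k.norm_symbol2_le x) (SchwartzMap.compCLMOfContinuousLinearEquiv ℂ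
    (Fin.consEquivL ℝ fun _ : Fin (n + 1) => E d) φ)
  refine ⟨(Real.sqrt (n + 1) : ℂ) • χ, fun y => ?_⟩
  rw [_root_.smul_apply, hχ, smul_eq_mul]
  refine congrArg (_ * ·) ?_
  rw [vec2_eq]
  have h1 : (fun z : E d => g (n + 1) (Fin.cons (α := fun _ => X d) (1, z) fun i => (s i, y i)))
      = fun z => (SchwartzMap.compCLMOfContinuousLinearEquiv ℂ
        (Fin.consEquivL ℝ fun _ : Fin (n + 1) => E d) φ) (z, y) := by
    funext z
    have h2 := cons_withLabels 1 s z y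
    refine (congrArg (g (n + 1)) h2).trans (hφ _)
  rw [h1]

/-! ### The fields at a point -/

/-- The waves generated from test waves by creation operators at points. They form the smallest
space that contains the test waves and is preserved by the fields `ψ(x)`. -/
inductive Nice : Wave d → Prop
  | test {g : Wave d} (hg : IsTest g) : Nice g
  | create (x : E d) {g : Wave d} (hg : Nice g) : Nice (creation (k.vec1 x) g)
  | add {g h : Wave d} (hg : Nice g) (hh : Nice h) : Nice (g + h)
  | smul (c : ℂ) {g : Wave d} (hg : Nice g) : Nice (c • g)

theorem vec1_eq (x : E d) : k.vec1 x = onLabel 0 fun z => conj (k.kappa1 (z - x)) := rfl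

theorem stronglyMeasurable_vec1 (x : E d) : StronglyMeasurable (k.vec1 x) := by
  rw [vec1_eq]
  exact onLabel_stronglyMeasurable 0 (Complex.continuous_conj.comp_stronglyMeasurable
    (k.kappa1_stronglyMeasurable.comp_measurable (measurable_id.sub_const x)))

theorem lintegral_vec1 (x : E d) :
    ∫⁻ z, ‖k.vec1 x z‖ₑ ^ 2 ∂(μX d) = ∫⁻ z, ‖k.kappa1 z‖ₑ ^ 2 := by
  have hm : StronglyMeasurable fun z => conj (k.kappa1 (z - x)) :=
    Complex.continuous_conj.comp_stronglyMeasurable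
      (k.kappa1_stronglyMeasurable.comp_measurable (measurable_id.sub_const x))
  rw [vec1_eq, lintegral_onLabel 0 hm.aestronglyMeasurable]
  simp only [RCLike.enorm_conj]
  exact lintegral_sub_right_eq_self (fun z => ‖k.kappa1 z‖ₑ ^ 2) x

theorem memLp_vec1 (x : E d) : MemLp (k.vec1 x) 2 (μX d) :=
  memLp_two_of_lintegral (k.stronglyMeasurable_vec1 x).aestronglyMeasurable (by
    rw [lintegral_vec1]; exact lintegral_enorm_sq_lt_top k.kappa1_memLp)

namespace Nice

variable {k}

theorem isL2Wave {g : Wave d} (hg : k.Nice g) : IsL2Wave g := by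
  induction hg with
  | test hg => exact hg.isL2Wave
  | create x _ ih => exact ih.creation (k.stronglyMeasurable_vec1 x) (k.memLp_vec1 x)
  | add _ _ ih ih' => exact ih.add ih'
  | smul c _ ih => exact ih.smul c

theorem slice_mem {g : Wave d} (hg : k.Nice g) : ∀ {n : ℕ} (y : Fin n → X d),
    (fun z => g (n + 1) (Fin.cons (α := fun _ => X d) z y)) ∈ schwartzSnd d := by
  induction hg with
  | test hg => exact fun y => hg.slice_mem y
  | @create x g hg ih =>
    intro n y
    have h1 : (fun z => creation (k.vec1 x) g (n + 1) (Fin.cons (α := fun _ => X d) z y))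
        = (Real.sqrt (n + 1) : ℂ)⁻¹ • (g n y • k.vec1 x + ∑ i : Fin n,
          ((-1 : ℂ) ^ ((i : ℕ) + 1) * k.vec1 x (y i)) • fun z => g n (i.succ.removeNth
            (Fin.cons (α := fun _ => X d) z y))) := by
      funext z
      simp only [creation, Fin.sum_univ_succ, Pi.smul_apply, Pi.add_apply, Finset.sum_apply,
        smul_eq_mul, Fin.cons_zero, Fin.cons_succ, Fin.val_zero, pow_zero, one_mul, Fin.val_succ,
        Fin.removeNth_zero, Fin.tail_cons]
      rw [mul_comm (k.vec1 x z)]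
    rw [h1]
    refine Submodule.smul_mem _ _ (Submodule.add_mem _ (Submodule.smul_mem _ _ (k.vec1_mem x))
      (Submodule.sum_mem _ fun i _ => Submodule.smul_mem _ _ ?_))
    cases n with
    | zero => exact i.elim0
    | succ n =>
      have h2 : ∀ z, i.succ.removeNth (Fin.cons (α := fun _ => X d) z y)
          = Fin.cons (α := fun _ => X d) z (i.removeNth y) := by
        intro z
        funext j
        refine Fin.cases ?_ (fun j => ?_) j
        · simp [Fin.removeNth]
        · simp [Fin.removeNth]
      simp only [h2]
      exact ih _
  | add _ _ ih ih' => exact fun y => Submodule.add_mem _ (ih y) (ih' y)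
  | smul c _ ih => exact fun y => Submodule.smul_mem _ c (ih y)

theorem annihilation_add (x : E d) {g h : Wave d} (hg : k.Nice g) (hh : k.Nice h) :
    annihilation (k.vec2 x) (g + h) = annihilation (k.vec2 x) g + annihilation (k.vec2 x) h := by
  funext n y
  change _ * k.vec2 x (fun z => g (n + 1) _ + h (n + 1) _) = _ * _ + _ * _
  rw [k.vec2_add x (hg.slice_mem y) (hh.slice_mem y), mul_add]

/-- Annihilation passes through the creation operators up to sign, until it meets a test wave,
which it maps to a test wave. -/
theorem annihilate (x : E d) {g : Wave d} (hg : k.Nice g) :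
    k.Nice (annihilation (k.vec2 x) g) := by
  induction hg with
  | test hg => exact .test (k.isTest_annihilation hg x)
  | @create x' g hg ih =>
    have h1 : annihilation (k.vec2 x) (creation (k.vec1 x') g)
        = (-1 : ℂ) • creation (k.vec1 x') (annihilation (k.vec2 x) g) := by
      funext n y
      rw [annihilation_creation (schwartzSnd d) (fun h hh h' hh' => k.vec2_add x hh hh')
        (k.vec2_mul x) (k.vec1_mem x') n y fun m _ j => hg.slice_mem _, vec2_vec1, zero_mul,
        zero_sub]
      exact (neg_one_mul _).symm
    rw [h1]
    exact .smul _ (.create x' ih)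
  | add hg hh ih ih' => rw [annihilation_add x hg hh]; exact .add ih ih'
  | smul c _ ih => rw [annihilation_smul _ (k.vec2_mul x)]; exact .smul c ih

theorem psi (x : E d) {g : Wave d} (hg : k.Nice g) : k.Nice (k.psi x g) :=
  .add (hg.annihilate x) (.create x hg)

theorem psiProd {n : ℕ} (x : Fin n → E d) {g : Wave d} (hg : k.Nice g) :
    k.Nice (k.psiProd n x g) := by
  induction n with
  | zero => exact hg
  | succ n ih => exact (ih (Fin.tail x)).psi (x 0)

end Nice

theorem psi_add (x : E d) {g h : Wave d} (hg : k.Nice g) (hh : k.Nice h) :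
    k.psi x (g + h) = k.psi x g + k.psi x h := by
  rw [psi, psi, psi, Nice.annihilation_add x hg hh, creation_add]
  abel

/-- The dual operators unfold to the operators `ψ` in the second argument. Additivity of the form
is needed only on nice waves. -/
theorem psiStarProd_apply {n : ℕ} (x : Fin n → E d) {L : GenVec d}
    (hL : ∀ g h, k.Nice g → k.Nice h → L (g + h) = L g + L h) {g : Wave d} (hg : k.Nice g) :
    k.psiStarProd n x L g = L (k.psiProd n x g) := by
  induction n generalizing L with
  | zero => rfl
  | succ n ih =>
    have h1 : ∀ g, k.Nice g → k.psiStar (x 0) L g = L (k.psi (x 0) g) := fun g hg =>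
      (hL _ _ (hg.annihilate (x 0)) (.create (x 0) hg)).symm
    refine (ih (Fin.tail x) (L := k.psiStar (x 0) L) fun g h hg hh => ?_).trans
      (h1 _ (hg.psiProd _))
    rw [h1 _ (.add hg hh), h1 _ hg, h1 _ hh, psi_add k _ hg hh, hL _ _ (hg.psi _) (hh.psi _)]

theorem toGenVec_add {f g h : Wave d} (hf : IsL2Wave f) (hg : IsL2Wave g) (hh : IsL2Wave h) :
    toGenVec f (g + h) = toGenVec f g + toGenVec f h := by
  rw [← hf.represents_vec.inner_eq hg.represents_vec,
    ← hf.represents_vec.inner_eq hh.represents_vec,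
    ← hf.represents_vec.inner_eq (hg.represents_vec.add hh.represents_vec)]
  exact inner_add_right _ _ _

/-- The normal-ordered product at points, as a form on nice waves. -/
theorem normalOrdered_eq {n : ℕ} (x : Fin n → E d) {g h : Wave d} (hg : k.Nice g)
    (hh : k.Nice h) :
    k.normalOrdered n x g h
      = inner ℂ (hg.psiProd x).isL2Wave.vec (hh.psiProd x).isL2Wave.vec := by
  rw [normalOrdered, k.psiStarProd_apply x (fun g' h' hg' hh' => toGenVec_add
    (hg.psiProd x).isL2Wave hg'.isL2Wave hh'.isL2Wave) hh]
  exact ((hg.psiProd x).isL2Wave.represents_vec.inner_eq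
    (hh.psiProd x).isL2Wave.represents_vec).symm

end MomentumDensity

/-! ### Measurability of families of waves -/

section JointMeasurability

variable {T : Type} [MeasurableSpace T]

/-- Joint measurability of a family of waves in the parameter and the configuration. -/
def JointlyMeasurable (A : T → Wave d) : Prop :=
  ∀ n, StronglyMeasurable fun p : T × (Fin n → X d) => A p.1 n p.2

namespace JointlyMeasurable

variable {A : T → Wave d}

theorem annihilate (hA : JointlyMeasurable A) (k : MomentumDensity d) {X₀ : T → E d}
    (hX : Measurable X₀) :
    JointlyMeasurable fun t => annihilation (k.vec2 (X₀ t)) (A t) := by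
  intro n
  set m' := k.mul2.aesm.mk k.sqrtCoDensity with hm'
  have h0 : ∀ x (h : X d → ℂ), k.vec2 x h
      = ∫ ξ, m' ξ * ∫ v, Real.fourierChar (-inner ℝ v ξ) • h (1, x + v) := by
    intro x h
    refine integral_congr_ae ?_
    filter_upwards [k.mul2.aesm.ae_eq_mk] with ξ hξ
    rw [Real.fourier_eq]
    exact congrArg (· * _) hξ
  have h1 : (fun p : T × (Fin n → X d) => annihilation (k.vec2 (X₀ p.1)) (A p.1) n p.2)
      = fun p => (Real.sqrt (n + 1) : ℂ) * ∫ ξ, m' ξ * ∫ v, Real.fourierChar (-inner ℝ v ξ) •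
        A p.1 (n + 1) (Fin.cons (α := fun _ => X d) (1, X₀ p.1 + v) p.2) := by
    funext p
    rw [annihilation, h0]
  rw [h1]
  refine StronglyMeasurable.const_mul ?_ _
  refine StronglyMeasurable.integral_prod_right'
    (f := fun (q : (T × (Fin n → X d)) × E d) => m' q.2 * ∫ v, Real.fourierChar (-inner ℝ v q.2) •
        A q.1.1 (n + 1) (Fin.cons (α := fun _ => X d) (1, X₀ q.1.1 + v) q.1.2)) ?_
  refine (k.mul2.aesm.stronglyMeasurable_mk.comp_measurable measurable_snd).mul ?_
  refine StronglyMeasurable.integral_prod_right'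
    (f := fun (q : ((T × (Fin n → X d)) × E d) × E d) => Real.fourierChar (-inner ℝ q.2 q.1.2) •
        A q.1.1.1 (n + 1) (Fin.cons (α := fun _ => X d) (1, X₀ q.1.1.1 + q.2) q.1.1.2)) ?_
  have hc : StronglyMeasurable fun q : ((T × (Fin n → X d)) × E d) × E d =>
      (Real.fourierChar (-inner ℝ q.2 q.1.2) : ℂ) := by
    have h2 : Measurable fun q : ((T × (Fin n → X d)) × E d) × E d => (inner ℝ q.2 q.1.2 : ℝ) :=
      measurable_snd.inner measurable_fst.snd
    exact ((continuous_subtype_val.comp Real.continuous_fourierChar).measurable.comp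
      h2.neg).stronglyMeasurable
  have hmap : Measurable fun q : ((T × (Fin n → X d)) × E d) × E d =>
      (q.1.1.1, (Fin.cons (α := fun _ => X d) (1, X₀ q.1.1.1 + q.2) q.1.1.2 : Fin (n + 1) → X d)) :=
    measurable_fst.fst.fst.prodMk ((measurePreserving_cons d n).measurable.comp
      ((measurable_const.prodMk ((hX.comp measurable_fst.fst.fst).add measurable_snd)).prodMk
        measurable_fst.fst.snd))
  exact hc.mul ((hA (n + 1)).comp_measurable hmap)

theorem create (hA : JointlyMeasurable A) (k : MomentumDensity d) {X₀ : T → E d}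
    (hX : Measurable X₀) :
    JointlyMeasurable fun t => creation (k.vec1 (X₀ t)) (A t) := by
  intro n
  cases n with
  | zero => exact stronglyMeasurable_const
  | succ n =>
    refine (Finset.stronglyMeasurable_fun_sum (f := fun (i : Fin (n + 1))
      (p : T × (Fin (n + 1) → X d)) => (-1 : ℂ) ^ (i : ℕ) * k.vec1 (X₀ p.1) (p.2 i)
        * A p.1 n (i.removeNth p.2)) Finset.univ fun i _ => ?_).const_mul _
    have hr := (measurePreserving_removeNth d n i).measurable
    refine StronglyMeasurable.mul (StronglyMeasurable.const_mul ?_ _)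
      ((hA n).comp_measurable (measurable_fst.prodMk (hr.snd.comp measurable_snd)))
    refine StronglyMeasurable.ite ?_ ?_ stronglyMeasurable_const
    · exact (measurable_fst.comp ((measurable_pi_apply i).comp measurable_snd))
        (measurableSet_singleton 0)
    · exact Complex.continuous_conj.comp_stronglyMeasurable
        (k.kappa1_stronglyMeasurable.comp_measurable ((measurable_snd.comp
          ((measurable_pi_apply i).comp measurable_snd)).sub (hX.comp measurable_fst)))

theorem psi (hA : JointlyMeasurable A) (k : MomentumDensity d) {X₀ : T → E d}
    (hX : Measurable X₀) : JointlyMeasurable fun t => k.psi (X₀ t) (A t) := fun n =>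
  (hA.annihilate k hX n).add (hA.create k hX n)

theorem measurable_enorm_sq (hA : JointlyMeasurable A) (hL : ∀ t, IsL2Wave (A t)) :
    Measurable fun t => ‖(hL t).vec‖ₑ ^ 2 := by
  simp only [(hL _).represents_vec.enorm_sq]
  exact Measurable.tsum fun n =>
    ((hA n).enorm.pow_const 2).lintegral_prod_right'

theorem stronglyMeasurable_inner (hA : JointlyMeasurable A) (hL : ∀ t, IsL2Wave (A t)) {M : ℕ}
    (hM : ∀ t n, M ≤ n → A t n = 0) (η : FockFin d) :
    StronglyMeasurable fun t => (inner ℂ η (hL t).vec : ℂ) := by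
  have h1 : ∀ t, (inner ℂ η (hL t).vec : ℂ)
      = ∑ n ∈ Finset.range M, ∫ y, conj (rep η n y) * A t n y ∂(μ d n) := by
    intro t
    rw [(represents_rep η).inner_eq (hL t).represents_vec]
    refine tsum_eq_sum fun n hn => ?_
    rw [Finset.mem_range, not_lt] at hn
    simp [hM t n hn]
  simp only [h1]
  refine Finset.stronglyMeasurable_fun_sum _ fun n _ => ?_
  refine StronglyMeasurable.integral_prod_right'
    (f := fun p : T × (Fin n → X d) => conj (rep η n p.2) * A p.1 n p.2) ?_
  exact (Complex.continuous_conj.comp_stronglyMeasurable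
    (((isL2Wave_rep η).meas n).comp_measurable measurable_snd)).mul (hA n)

end JointlyMeasurable

theorem jointlyMeasurable_const {g : Wave d} (hg : IsL2Wave g) :
    JointlyMeasurable fun _ : T => g := fun n => (hg.meas n).comp_measurable measurable_snd

end JointMeasurability

namespace MomentumDensity

variable (k : MomentumDensity d)

theorem psi_fin {g : Wave d} {N : ℕ} (h : ∀ n, N ≤ n → g n = 0) (x : E d) (n : ℕ)
    (hn : N + 1 ≤ n) : k.psi x g n = 0 := by
  rw [psi, Pi.add_apply, annihilation_fin (k.vec2_mul x) h n (by omega), creation_fin h n hn,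
    add_zero]

theorem psiProd_fin {g : Wave d} {N : ℕ} (h : ∀ n, N ≤ n → g n = 0) {m : ℕ} (x : Fin m → E d)
    (n : ℕ) (hn : N + m ≤ n) : k.psiProd m x g n = 0 := by
  induction m generalizing n with
  | zero => exact h n hn
  | succ m ih => exact k.psi_fin (ih (Fin.tail x)) (x 0) n hn

theorem jointlyMeasurable_psiProd {g : Wave d} (hg : IsL2Wave g) (m : ℕ) :
    JointlyMeasurable fun x : Fin m → E d => k.psiProd m x g := by
  induction m with
  | zero => exact jointlyMeasurable_const hg
  | succ m ih =>
    have h1 : JointlyMeasurable fun x : Fin (m + 1) → E d => k.psiProd m (Fin.tail x) g := fun n =>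
      (ih n).comp_measurable (((measurable_pi_lambda (Fin.tail : (Fin (m + 1) → E d) → Fin m → E d)
        fun i => measurable_pi_apply i.succ).comp measurable_fst).prodMk measurable_snd)
    exact h1.psi k (measurable_pi_apply 0)

/-! ### Square-integrability of the field at a point -/

/-- The creation part is bounded uniformly in `x`, as `κ₁` is square-integrable. -/
theorem norm_vec_creation_le (x : E d) {g : Wave d} (hg : k.Nice g) :
    ‖(Nice.create x hg).isL2Wave.vec‖ₑ ^ 2
      ≤ (∫⁻ z, ‖k.kappa1 z‖ₑ ^ 2) * ‖hg.isL2Wave.vec‖ₑ ^ 2 := by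
  have h1 : (Nice.create x hg).isL2Wave.vec
      = cre ((k.memLp_vec1 x).toLp _) hg.isL2Wave.vec :=
    (Nice.create x hg).isL2Wave.represents_vec.ext
      (represents_cre (k.memLp_vec1 x).coeFn_toLp hg.isL2Wave.represents_vec)
  have h2 : ‖(Nice.create x hg).isL2Wave.vec‖ₑ
      ≤ ‖(k.memLp_vec1 x).toLp _‖ₑ * ‖hg.isL2Wave.vec‖ₑ := by
    rw [h1, ← ofReal_norm, ← ofReal_norm, ← ofReal_norm, ← ENNReal.ofReal_mul (norm_nonneg _)]
    exact ENNReal.ofReal_le_ofReal (norm_cre_le _ _)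
  have h3 : ‖(k.memLp_vec1 x).toLp _‖ₑ ^ 2 = ∫⁻ z, ‖k.kappa1 z‖ₑ ^ 2 := by
    rw [enorm_sq_eq_lintegral, ← k.lintegral_vec1 x]
    refine lintegral_congr_ae ?_
    filter_upwards [(k.memLp_vec1 x).coeFn_toLp] with z hz
    rw [hz]
  rw [← h3, ← mul_pow]
  exact pow_le_pow_left₀ (zero_le) h2 2

/-- By Plancherel, the annihilation part is a contraction from wave functions to functions of `x`;
this uses `1 - k̂ ≤ 1`. -/
theorem lintegral_kappa2_le (h : 𝓢(E d, ℂ)) :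
    ∫⁻ x, ‖k.kappa2 fun z => h (x + z)‖ₑ ^ 2 ≤ ∫⁻ z, ‖h z‖ₑ ^ 2 := by
  have h1 : ∫⁻ x, ‖k.kappa2 fun z => h (x + z)‖ₑ ^ 2 = ‖k.K2 (h.toLp 2)‖ₑ ^ 2 := by
    rw [enorm_sq_eq_lintegral]
    refine lintegral_congr_ae ?_
    filter_upwards [k.kappa2_ae h] with x hx
    rw [hx]
  have h2 : ∫⁻ z, ‖h z‖ₑ ^ 2 = ‖h.toLp 2‖ₑ ^ 2 := by
    rw [enorm_sq_eq_lintegral]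
    refine lintegral_congr_ae ?_
    filter_upwards [h.coeFn_toLp 2 volume] with x hx
    rw [hx]
  rw [h1, h2]
  refine pow_le_pow_left₀ (zero_le) ?_ 2
  rw [← ofReal_norm, ← ofReal_norm]
  exact ENNReal.ofReal_le_ofReal (k.norm_K2_le _)

/-- The square of the annihilation part of `ψ(x)` has bounded integral over `x`, although the
annihilation part is not a bounded operator at a single `x`. -/
theorem lintegral_annihilation_le {N : ℕ} {g : Wave d} (hg : k.Nice g)
    (hN : ∀ n, N ≤ n → g n = 0) :
    ∫⁻ x, ‖(hg.annihilate x).isL2Wave.vec‖ₑ ^ 2 ≤ N * ‖hg.isL2Wave.vec‖ₑ ^ 2 := by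
  have hA : JointlyMeasurable fun x : E d => annihilation (k.vec2 x) g :=
    (jointlyMeasurable_const hg.isL2Wave).annihilate k measurable_id
  have hterm : ∀ n, ∫⁻ x, ∫⁻ y, ‖annihilation (k.vec2 x) g n y‖ₑ ^ 2 ∂(μ d n)
      ≤ N * ∫⁻ y, ‖g (n + 1) y‖ₑ ^ 2 ∂(μ d (n + 1)) := by
    intro n
    rcases le_or_gt N (n + 1) with hn | hn
    · have h1 : ∀ x, annihilation (k.vec2 x) g n = 0 := fun x =>
        annihilation_fin (k.vec2_mul x) hN n hn
      simp [h1]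
    have hm : AEMeasurable (Function.uncurry fun (x : E d) (y : Fin n → X d) =>
        ‖annihilation (k.vec2 x) g n y‖ₑ ^ 2) (volume.prod (μ d n)) :=
      ((hA n).enorm.pow_const 2).aemeasurable
    rw [lintegral_lintegral_swap hm, lintegral_cons, lintegral_prod_symm _
      ((IsL2Wave.meas_cons hg.isL2Wave.meas n).enorm.pow_const 2).aemeasurable,
      ← lintegral_const_mul' _ _ (by finiteness)]
    refine lintegral_mono fun y => ?_
    have hms : Measurable fun z => g (n + 1) (Fin.cons (α := fun _ => X d) z y) :=
      (IsL2Wave.meas_cons hg.isL2Wave.meas n).measurable.comp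
        (measurable_id.prodMk measurable_const)
    dsimp only
    rw [lintegral_μX (hms.enorm.pow_const 2).aemeasurable, Fin.sum_univ_two]
    obtain ⟨φ, hφ⟩ := hg.slice_mem y
    have h2 : ∀ x, annihilation (k.vec2 x) g n y
        = (Real.sqrt (n + 1) : ℂ) * k.kappa2 fun z => φ (x + z) := by
      intro x
      have h3 : (fun z => g (n + 1) (Fin.cons (α := fun _ => X d) (1, x + z) y))
          = fun z => φ (x + z) := funext fun z => hφ (x + z)
      rw [annihilation, vec2, h3]
    have h4 : ∀ x, ‖annihilation (k.vec2 x) g n y‖ₑ ^ 2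
        = (n + 1 : ℝ≥0∞) * ‖k.kappa2 fun z => φ (x + z)‖ₑ ^ 2 := by
      intro x
      rw [h2, enorm_mul, mul_pow]
      congr 1
      rw [← ofReal_norm, Complex.norm_real, Real.norm_eq_abs, abs_of_nonneg (Real.sqrt_nonneg _),
        ← ENNReal.ofReal_pow (Real.sqrt_nonneg _), Real.sq_sqrt (by positivity)]
      rw [ENNReal.ofReal_add (by positivity) zero_le_one, ENNReal.ofReal_natCast,
        ENNReal.ofReal_one]
    simp only [h4]
    rw [lintegral_const_mul' _ _ (by finiteness)]
    have h5 : ∫⁻ z, ‖g (n + 1) (Fin.cons (α := fun _ => X d) (1, z) y)‖ₑ ^ 2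
        = ∫⁻ z, ‖φ z‖ₑ ^ 2 := lintegral_congr fun z => by rw [← hφ z]
    rw [h5]
    refine mul_le_mul' ?_ ((k.lintegral_kappa2_le φ).trans le_add_self)
    exact_mod_cast hn.le
  have hmx : ∀ n, Measurable fun x => ∫⁻ y, ‖annihilation (k.vec2 x) g n y‖ₑ ^ 2 ∂(μ d n) :=
    fun n => ((hA n).enorm.pow_const 2).lintegral_prod_right'
  simp only [(hg.annihilate _).isL2Wave.represents_vec.enorm_sq]
  rw [lintegral_tsum fun n => (hmx n).aemeasurable, hg.isL2Wave.represents_vec.enorm_sq]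
  refine (ENNReal.tsum_le_tsum hterm).trans ?_
  rw [ENNReal.tsum_mul_left]
  refine mul_le_mul' le_rfl ?_
  exact ENNReal.tsum_comp_le_tsum_of_injective Nat.succ_injective
    fun n => ∫⁻ y, ‖g n y‖ₑ ^ 2 ∂(μ d n)

theorem vec_psi (x : E d) {g : Wave d} (hg : k.Nice g) :
    (hg.psi x).isL2Wave.vec
      = (hg.annihilate x).isL2Wave.vec + (Nice.create x hg).isL2Wave.vec :=
  (hg.psi x).isL2Wave.represents_vec.ext ((hg.annihilate x).isL2Wave.represents_vec.add
    (Nice.create x hg).isL2Wave.represents_vec)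

theorem _root_.FermiGas.mul_le_of_le_two_add {w s a c κ G B : ℝ≥0∞} (h : s ≤ 2 * a + 2 * c)
    (hc : c ≤ κ * G) (hw : w ≤ B) : w * s ≤ 2 * B * a + w * (2 * κ * G) :=
  calc w * s ≤ w * (2 * a + 2 * (κ * G)) := by gcongr; exact h.trans (by gcongr)
    _ = 2 * w * a + w * (2 * κ * G) := by ring
    _ ≤ _ := by gcongr

/-- One field is square-integrable in `x` against a bounded integrable weight, with a constant
depending only on the weight and on the number of particles. Boundedness serves the annihilation
part and integrability the creation part. -/
theorem exists_lintegral_psi_le {w : E d → ℝ≥0∞} (hw : AEMeasurable w) {B : ℝ≥0∞} (hB : B ≠ ∞)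
    (hwB : ∀ x, w x ≤ B) (hi : ∫⁻ x, w x ≠ ∞) (N : ℕ) :
    ∃ C : ℝ≥0∞, C ≠ ∞ ∧ ∀ (g : Wave d) (hg : k.Nice g), (∀ n, N ≤ n → g n = 0) →
      ∫⁻ x, w x * ‖(hg.psi x).isL2Wave.vec‖ₑ ^ 2 ≤ C * ‖hg.isL2Wave.vec‖ₑ ^ 2 := by
  have hk := lintegral_enorm_sq_lt_top k.kappa1_memLp
  refine ⟨2 * B * N + 2 * (∫⁻ x, w x) * ∫⁻ z, ‖k.kappa1 z‖ₑ ^ 2, by finiteness,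
    fun g hg hN => ?_⟩
  have hA : JointlyMeasurable fun x : E d => annihilation (k.vec2 x) g :=
    (jointlyMeasurable_const hg.isL2Wave).annihilate k measurable_id
  have h1 : ∀ x, w x * ‖(hg.psi x).isL2Wave.vec‖ₑ ^ 2
      ≤ 2 * B * ‖(hg.annihilate x).isL2Wave.vec‖ₑ ^ 2
        + w x * (2 * (∫⁻ z, ‖k.kappa1 z‖ₑ ^ 2) * ‖hg.isL2Wave.vec‖ₑ ^ 2) := by
    intro x
    have h2 : ‖(hg.psi x).isL2Wave.vec‖ₑ ^ 2 ≤ 2 * ‖(hg.annihilate x).isL2Wave.vec‖ₑ ^ 2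
        + 2 * ‖(Nice.create x hg).isL2Wave.vec‖ₑ ^ 2 := by
      rw [k.vec_psi x hg]
      refine (pow_le_pow_left₀ (zero_le) (enorm_add_le _ _) 2).trans ?_
      have h3 := ENNReal.rpow_add_le_mul_rpow_add_rpow
        ‖(hg.annihilate x).isL2Wave.vec‖ₑ ‖(Nice.create x hg).isL2Wave.vec‖ₑ
        (p := 2) (by norm_num)
      norm_num at h3
      rw [← mul_add]
      exact h3
    exact mul_le_of_le_two_add h2 (k.norm_vec_creation_le x hg) (hwB x)
  refine (lintegral_mono h1).trans ?_
  rw [lintegral_add_right' _ (hw.mul_const _), lintegral_mul_const'' _ hw,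
    lintegral_const_mul _ (hA.measurable_enorm_sq fun x => (hg.annihilate x).isL2Wave), add_mul]
  refine add_le_add ?_ (le_of_eq (by ring))
  calc 2 * B * ∫⁻ x, ‖(hg.annihilate x).isL2Wave.vec‖ₑ ^ 2
      ≤ 2 * B * (N * ‖hg.isL2Wave.vec‖ₑ ^ 2) := by
        gcongr; exact k.lintegral_annihilation_le hg hN
    _ = _ := by ring

end MomentumDensity

/-! ### The field at a point and the smeared fields -/

theorem restrict_label (s : Fin 2) :
    (μX d).restrict {z | z.1 = s} = Measure.map (Prod.mk s) volume := by
  ext S hS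
  have hm : MeasurableSet {z : X d | z.1 = s} := measurable_fst (measurableSet_singleton s)
  rw [Measure.restrict_apply hS, Measure.map_apply measurable_prodMk_left hS, μX,
    Measure.prod_apply (hS.inter hm), lintegral_count, tsum_fintype, Finset.sum_eq_single s]
  · congr 1
    ext x
    simp
  · intro t _ hts
    have : Prod.mk t ⁻¹' (S ∩ {z : X d | z.1 = s}) = ∅ := by
      ext x
      simp [hts]
    rw [this, measure_empty]
  · simp

theorem pair_onLabel (s : Fin 2) (u : E d → ℂ) (h : X d → ℂ) :
    pair (onLabel s u) h = ∫ x, conj (u x) * h (s, x) := by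
  have hm : MeasurableSet {z : X d | z.1 = s} := measurable_fst (measurableSet_singleton s)
  have h1 : (fun z => conj (onLabel s u z) * h z)
      = Set.indicator {z : X d | z.1 = s} fun z => conj (u z.2) * h z := by
    funext z
    by_cases hz : z.1 = s <;> simp [onLabel, hz]
  have he : MeasurableEmbedding (Prod.mk s : E d → X d) := .prodMk_left s .id
  rw [pair, h1, integral_indicator hm, restrict_label, he.integral_map]

namespace MomentumDensity

variable (k : MomentumDensity d)

theorem _root_.FermiGas.inner_H1 (a b : H1 d) : (inner ℂ a b : ℂ) = ∫ x, conj (a x) * b x := by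
  rw [L2.inner_def]
  exact integral_congr_ae (Eventually.of_forall fun x => mul_comm _ _)

/-- Smearing the pairing with `κ₂` over `x` gives the multiplier `K₂`. -/
theorem integral_mul_kappa2 (u : H1 d) (φ : 𝓢(E d, ℂ)) :
    Integrable (fun x => conj (u x) * k.kappa2 fun z => φ (x + z)) ∧
    ∫ x, conj (u x) * k.kappa2 (fun z => φ (x + z)) = ∫ x, conj ((k.K2 u : E d → ℂ) x) * φ x := by
  let Φ : H1 d := φ.toLp 2
  have hΦ : (Φ : E d → ℂ) =ᵐ[volume] φ := φ.coeFn_toLp 2 volume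
  have h1 : (fun x => conj (u x) * (k.K2 Φ : E d → ℂ) x) =ᵐ[volume]
      fun x => conj (u x) * k.kappa2 fun z => φ (x + z) :=
    (k.kappa2_ae φ).mono fun x hx => congrArg (conj (u x) * ·) hx
  have h2 : (fun x => conj ((k.K2 u : E d → ℂ) x) * Φ x) =ᵐ[volume]
      fun x => conj ((k.K2 u : E d → ℂ) x) * φ x :=
    hΦ.mono fun x hx => congrArg (conj ((k.K2 u : E d → ℂ) x) * ·) hx
  refine ⟨(integrable_conj_mul (Lp.memLp u) (Lp.memLp (k.K2 Φ))).congr h1, ?_⟩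
  rw [← integral_congr_ae h1, ← integral_congr_ae h2, ← inner_H1, ← inner_H1]
  exact (k.inner_K2 u Φ).symm

theorem integral_mul_annihilation (u : H1 d) {g : Wave d} (hg : k.Nice g) (n : ℕ)
    (y : Fin n → X d) :
    Integrable (fun x => conj (u x) * annihilation (k.vec2 x) g n y) ∧
    ∫ x, conj (u x) * annihilation (k.vec2 x) g n y
      = annihilation (pair (onLabel 1 (k.K2 u))) g n y := by
  obtain ⟨φ, hφ⟩ := hg.slice_mem y
  have h1 : ∀ x, annihilation (k.vec2 x) g n y
      = (Real.sqrt (n + 1) : ℂ) * k.kappa2 fun z => φ (x + z) := by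
    intro x
    have h3 : (fun z => g (n + 1) (Fin.cons (α := fun _ => X d) (1, x + z) y))
        = fun z => φ (x + z) := funext fun z => hφ (x + z)
    rw [annihilation, vec2, h3]
  obtain ⟨h2, h3⟩ := k.integral_mul_kappa2 u φ
  have h4 : ∀ x, conj (u x) * annihilation (k.vec2 x) g n y
      = (Real.sqrt (n + 1) : ℂ) * (conj (u x) * k.kappa2 fun z => φ (x + z)) := fun x => by
    rw [h1, mul_left_comm]
  have h5 : ∀ z, g (n + 1) (Fin.cons (α := fun _ => X d) (1, z) y) = φ z := hφ
  simp only [h4]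
  refine ⟨h2.const_mul _, ?_⟩
  rw [integral_const_mul, h3, annihilation, pair_onLabel]
  simp only [h5]

theorem integral_mul_vec1 (u : H1 d) (z : X d) :
    Integrable (fun x => conj (u x) * k.vec1 x z) ∧
    ∫ x, conj (u x) * k.vec1 x z
      = onLabel 0 (fun z => conj (∫ x, k.kappa1 (z - x) * u x)) z := by
  by_cases hz : z.1 = 0
  · have h1 : (fun x => conj (u x) * k.vec1 x z)
        = fun x => conj (k.kappa1 (z.2 - x) * u x) := by
      funext x
      simp only [vec1, hz, if_true, map_mul]
      ring
    have h2 : Integrable fun x => k.kappa1 (z.2 - x) * u x :=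
      MemLp.integrable_mul (p := 2) (q := 2) (k.kappa1_sub_memLp z.2) (Lp.memLp u)
    rw [h1]
    refine ⟨(RCLike.conjCLE (K := ℂ)).toContinuousLinearMap.integrable_comp h2, ?_⟩
    rw [integral_conj]
    simp [onLabel, hz]
  · simp [vec1, onLabel, hz]

theorem integral_mul_creation (u : H1 d) (g : Wave d) (n : ℕ) (y : Fin n → X d) :
    Integrable (fun x => conj (u x) * creation (k.vec1 x) g n y) ∧
    ∫ x, conj (u x) * creation (k.vec1 x) g n y
      = creation (onLabel 0 fun z => conj (∫ x, k.kappa1 (z - x) * u x)) g n y := by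
  cases n with
  | zero => simp [creation]
  | succ n =>
    have h1 : ∀ x, conj (u x) * creation (k.vec1 x) g (n + 1) y
        = (Real.sqrt (n + 1) : ℂ)⁻¹ * ∑ i : Fin (n + 1), ((-1 : ℂ) ^ (i : ℕ)
          * g n (i.removeNth y)) * (conj (u x) * k.vec1 x (y i)) := by
      intro x
      rw [creation, mul_left_comm, Finset.mul_sum]
      refine congrArg (_ * ·) (Finset.sum_congr rfl fun i _ => ?_)
      ring
    simp only [h1]
    have hi : ∀ i ∈ (Finset.univ : Finset (Fin (n + 1))), Integrable fun x =>
        ((-1 : ℂ) ^ (i : ℕ) * g n (i.removeNth y)) * (conj (u x) * k.vec1 x (y i)) :=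
      fun i _ => (k.integral_mul_vec1 u (y i)).1.const_mul _
    refine ⟨(integrable_finsetSum _ hi).const_mul _, ?_⟩
    rw [integral_const_mul, integral_finsetSum _ hi, creation]
    refine congrArg (_ * ·) (Finset.sum_congr rfl fun i _ => ?_)
    rw [integral_const_mul, (k.integral_mul_vec1 u (y i)).2]
    ring

/-- Smearing the pointwise field with `conj u` gives, at every point, the wave of the operator `b
u`. -/
theorem integral_mul_psi (u : H1 d) {g : Wave d} (hg : k.Nice g) (n : ℕ) (y : Fin n → X d) :
    ∫ x, conj (u x) * k.psi x g n y
      = (annihilation (pair (onLabel 1 (k.K2 u))) g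
        + creation (onLabel 0 fun z => conj (∫ x, k.kappa1 (z - x) * u x)) g) n y := by
  have h1 := k.integral_mul_annihilation u hg n y
  have h2 := k.integral_mul_creation u g n y
  have h3 : ∀ x, conj (u x) * k.psi x g n y = conj (u x) * annihilation (k.vec2 x) g n y
      + conj (u x) * creation (k.vec1 x) g n y := fun x => mul_add _ _ _
  simp only [h3]
  rw [integral_add h1.1 h2.1, h1.2, h2.2]
  rfl

/-- The smeared pointwise field represents the operator `b u`, by the description of `K₁` as
convolution with `κ₁`. -/
theorem represents_b (u : H1 d) {g : Wave d} {G : FockFin d} (hG : Represents g G) :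
    Represents (annihilation (pair (onLabel 1 (k.K2 u))) g
      + creation (onLabel 0 fun z => conj (∫ x, k.kappa1 (z - x) * u x)) g) (k.b u G) := by
  rw [b_apply]
  refine (represents_ann (emb_ae 1 _) hG).add (represents_cre ((emb_ae 0 _).trans
    (onLabel_ae ?_)) hG)
  filter_upwards [Lp.coeFn_star (k.K1 u), k.K1_ae u] with z h1 h2
  rw [h1, Pi.star_apply, h2]
  rfl

/-- The localized field `p(x) ψ(x) G` is square-integrable in `x`. -/
theorem lintegral_weight_psi_lt_top (p : Weight d) {g : Wave d} (hg : k.Nice g) :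
    ∫⁻ x, ‖p.toFun x‖ₑ ^ 2 * ‖(hg.psi x).isL2Wave.vec‖ₑ ^ 2 < ∞ := by
  obtain ⟨C, -, hC⟩ := p.bdd
  obtain ⟨N, hN⟩ := hg.isL2Wave.fin
  obtain ⟨D, hD, h⟩ := k.exists_lintegral_psi_le (w := fun x => ‖p.toFun x‖ₑ ^ 2)
    (p.aesm.enorm.pow_const 2) (B := ENNReal.ofReal C ^ 2) (by finiteness)
    (fun x => pow_le_pow_left₀ zero_le (by
      rw [← ofReal_norm]; exact ENNReal.ofReal_le_ofReal (hC x)) 2)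
    (lintegral_enorm_sq_lt_top p.memLp_toFun).ne N
  exact (h g hg hN).trans_lt (ENNReal.mul_lt_top hD.lt_top (by finiteness))

theorem memLp_weight_psi (p : Weight d) {g : Wave d} (hg : k.Nice g) (n : ℕ) :
    MemLp (fun q : E d × (Fin n → X d) => p.toFun q.1 * k.psi q.1 g n q.2) 2
      (volume.prod (μ d n)) := by
  have hA : JointlyMeasurable fun x : E d => k.psi x g :=
    (jointlyMeasurable_const hg.isL2Wave).psi k measurable_id
  have hm : AEStronglyMeasurable (fun q : E d × (Fin n → X d) => p.toFun q.1 * k.psi q.1 g n q.2)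
      (volume.prod (μ d n)) := p.aesm.comp_fst.mul (hA n).aestronglyMeasurable
  refine memLp_two_of_lintegral hm (lt_of_le_of_lt ?_ (k.lintegral_weight_psi_lt_top p hg))
  rw [lintegral_prod _ (hm.enorm.pow_const 2)]
  refine lintegral_mono fun x => ?_
  simp only [enorm_mul, mul_pow]
  rw [lintegral_const_mul' _ _ (by finiteness), (hg.psi x).isL2Wave.represents_vec.enorm_sq]
  gcongr
  exact ENNReal.le_tsum n

/-- Smearing the field `ψ(x)` with the function `p e` gives the operator `b (p e)`. -/
theorem integral_inner_psi (p : Weight d) (e : H1 d) {g : Wave d} (hg : k.Nice g)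
    (η : FockFin d) :
    ∫ x, conj (e x) * (inner ℂ η (p.toFun x • (hg.psi x).isL2Wave.vec) : ℂ)
      = inner ℂ η (k.b (p.op e) hg.isL2Wave.vec) := by
  obtain ⟨N, hN⟩ := hg.isL2Wave.fin
  have hrep := k.represents_b (p.op e) hg.isL2Wave.represents_vec
  have hfin : ∀ x n, n ∉ Finset.range (N + 1) → k.psi x g n = 0 := fun x n hn =>
    k.psi_fin hN x n (by simpa using hn)
  have hu : ∀ᵐ x, conj ((p.op e : E d → ℂ) x) = p.toFun x * conj (e x) := by
    filter_upwards [p.op_ae e] with x hx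
    rw [hx, map_mul, p.conj_toFun]
  have hI : ∀ n, Integrable (Function.uncurry fun (x : E d) (y : Fin n → X d) =>
      conj (rep η n y) * (conj ((p.op e : E d → ℂ) x) * k.psi x g n y))
      (volume.prod (μ d n)) := by
    intro n
    have h1 : MemLp (fun x => conj (e x)) 2 volume := (Lp.memLp e).star
    have h2 : MemLp (fun y => conj (rep η n y)) 2 (μ d n) := ((isL2Wave_rep η).memLp n).star
    have h3 := MemLp.integrable_mul (p := 2) (q := 2) (memLp_prod_mul h1 h2)
      (k.memLp_weight_psi p hg n)
    refine h3.congr ?_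
    filter_upwards [Measure.quasiMeasurePreserving_fst.ae hu] with q hq
    simp only [Function.uncurry, Pi.mul_apply, hq]
    ring
  have hR : (inner ℂ η (k.b (p.op e) hg.isL2Wave.vec) : ℂ)
      = ∑ n ∈ Finset.range (N + 1), ∫ y, conj (rep η n y)
        * (∫ x, conj ((p.op e : E d → ℂ) x) * k.psi x g n y) ∂(μ d n) := by
    rw [(represents_rep η).inner_eq hrep]
    simp only [k.integral_mul_psi (p.op e) hg]
    refine tsum_eq_sum fun n hn => ?_
    refine integral_eq_zero_of_ae (Eventually.of_forall fun y => ?_)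
    dsimp only
    rw [← k.integral_mul_psi (p.op e) hg]
    simp [hfin _ n hn]
  have hL : ∀ x, (inner ℂ η (hg.psi x).isL2Wave.vec : ℂ)
      = ∑ n ∈ Finset.range (N + 1), ∫ y, conj (rep η n y) * k.psi x g n y ∂(μ d n) := by
    intro x
    rw [(represents_rep η).inner_eq (hg.psi x).isL2Wave.represents_vec]
    exact tsum_eq_sum fun n hn => by simp [hfin x n hn]
  have hL' : (fun x => conj (e x) * (inner ℂ η (p.toFun x • (hg.psi x).isL2Wave.vec) : ℂ))
      =ᵐ[volume] fun x => ∑ n ∈ Finset.range (N + 1), ∫ y, conj (rep η n y)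
        * (conj ((p.op e : E d → ℂ) x) * k.psi x g n y) ∂(μ d n) := by
    filter_upwards [hu] with x hx
    rw [fock_inner_smul_right, hL, hx, ← mul_assoc, mul_comm (conj (e x)), Finset.mul_sum]
    refine Finset.sum_congr rfl fun n _ => ?_
    rw [← integral_const_mul]
    refine integral_congr_ae (Eventually.of_forall fun y => ?_)
    dsimp only
    ring
  rw [hR, integral_congr_ae hL', integral_finsetSum (f := fun n x => ∫ y, conj (rep η n y)
    * (conj ((p.op e : E d → ℂ) x) * k.psi x g n y) ∂(μ d n)) _
    fun n _ => (hI n).integral_prod_left]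
  refine Finset.sum_congr rfl fun n _ => ?_
  rw [integral_integral_swap (hI n)]
  refine integral_congr_ae (Eventually.of_forall fun y => ?_)
  dsimp only
  rw [integral_const_mul]

/-- The field `p(x) ψ(x)` applied to a vector is square-integrable in `x`, with the values of the
smeared fields as coefficients. -/
theorem isField_psi (p : Weight d) {g : Wave d} (hg : k.Nice g) :
    ∃ N, IsField N (fun x => p.toFun x • (hg.psi x).isL2Wave.vec)
      fun j => k.bj p j hg.isL2Wave.vec := by
  obtain ⟨N, hN⟩ := hg.isL2Wave.fin
  refine ⟨N + 1, fun x => ?_, fun η => ?_, ?_, fun η j => k.integral_inner_psi p _ hg η⟩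
  · exact ((hg.psi x).isL2Wave.represents_vec.below (k.psi_fin hN x)).smul _
  · simp only [fock_inner_smul_right]
    exact p.aesm.mul (((jointlyMeasurable_const hg.isL2Wave).psi k
      measurable_id).stronglyMeasurable_inner (fun x => (hg.psi x).isL2Wave)
      (fun x n hn => k.psi_fin hN x n hn) η).aestronglyMeasurable
  · refine lt_of_le_of_lt (le_of_eq (lintegral_congr fun x => ?_))
      (k.lintegral_weight_psi_lt_top p hg)
    rw [enorm_smul, mul_pow]

theorem _root_.FermiGas.inner_map_smul_decay (f : 𝓢(E d, ℝ)) (R : Op d) (x : E d)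
    (G K : FockFin d) :
    (inner ℂ (R.1 ((decay d).toFun x • G)) ((overDecay f).toFun x • K) : ℂ)
      = (f x : ℂ) * inner ℂ (R.1 G) K := by
  have h6 : R.1 ((decay d).toFun x • G) = (decay d).toFun x • R.1 G := R.1.map_smul _ _
  rw [h6, fock_inner_smul_left, fock_inner_smul_right, (decay d).conj_toFun, ← mul_assoc,
    decay_mul_overDecay]

/-- Integrating an operator between `ψ*(x)` and `ψ(x)` against `f` gives the dressed operator. -/
theorem integral_inner_comp_psi (f : 𝓢(E d, ℝ)) (R : Op d) {g h : Wave d} (hg : k.Nice g)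
    (hh : k.Nice h) :
    Integrable (fun x =>
      (f x : ℂ) * (inner ℂ (R.1 (hg.psi x).isL2Wave.vec) (hh.psi x).isL2Wave.vec : ℂ)) ∧
    ∫ x, (f x : ℂ) * (inner ℂ (R.1 (hg.psi x).isL2Wave.vec) (hh.psi x).isL2Wave.vec : ℂ)
      = inner ℂ ((k.dress f R).1 hg.isL2Wave.vec) hh.isL2Wave.vec := by
  obtain ⟨N, h1⟩ := k.isField_psi (decay d) hg
  obtain ⟨M, h2⟩ := h1.map R.2
  obtain ⟨N', h3⟩ := k.isField_psi (overDecay f) hh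
  obtain ⟨hi, h4⟩ := h2.hasSum_inner h3
  have h5 := k.hasSum_inner_sandwich (decay d) (overDecay f) R.2.1 hg.isL2Wave.vec hh.isL2Wave.vec
  have h7 := fun x => inner_map_smul_decay f R x (hg.psi x).isL2Wave.vec (hh.psi x).isL2Wave.vec
  exact ⟨hi.congr (Eventually.of_forall h7),
    (integral_congr_ae (Eventually.of_forall fun x => (h7 x).symm)).trans (h4.unique h5)⟩

end MomentumDensity

/-! ### Integrals of normal-ordered products -/

theorem aestronglyMeasurable_inner {T : Type} [MeasurableSpace T] {ν : Measure T}
    {F F' : T → FockFin d} (hF : ∀ η, AEStronglyMeasurable (fun t => (inner ℂ η (F t) : ℂ)) ν)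
    (hF' : ∀ η, AEStronglyMeasurable (fun t => (inner ℂ η (F' t) : ℂ)) ν) :
    AEStronglyMeasurable (fun t => (inner ℂ (F t) (F' t) : ℂ)) ν := by
  have h1 : ∀ c : ℂ, AEStronglyMeasurable (fun t => ((‖F t + c • F' t‖ ^ 2 : ℝ) : ℂ)) ν := by
    intro c
    have h2 : AEMeasurable (fun t => ‖F t + c • F' t‖ₑ ^ 2) ν := by
      refine aemeasurable_enorm_sq_of_inner fun η => ?_
      have h3 : ∀ t, (inner ℂ η (F t + c • F' t) : ℂ)
          = inner ℂ η (F t) + c * inner ℂ η (F' t) := fun t => by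
        rw [← fock_inner_smul_right]; exact inner_add_right _ _ _
      simp only [h3]
      exact (hF η).add ((hF' η).const_mul c)
    have h4 : ∀ t, ‖F t + c • F' t‖ ^ 2 = (‖F t + c • F' t‖ₑ ^ 2).toReal := fun t => by
      rw [ENNReal.toReal_pow, toReal_enorm]
    simp only [h4]
    exact Complex.continuous_ofReal.comp_aestronglyMeasurable
      h2.ennreal_toReal.aestronglyMeasurable
  simp only [fock_polarization]
  exact ((((h1 1).sub (h1 (-1))).add ((h1 (-Complex.I)).mul_const _)).sub
    ((h1 Complex.I).mul_const _)).const_mul _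

/-- Splitting off the first of `n + 1` points. -/
theorem measurePreserving_consPoint (d n : ℕ) :
    MeasurePreserving (fun x : Fin (n + 1) → E d => (x 0, Fin.tail x)) volume
      (volume.prod volume) :=
  volume_preserving_piFinSuccAbove (fun _ : Fin (n + 1) => E d) 0

theorem measurableEmbedding_consPoint (d n : ℕ) :
    MeasurableEmbedding (fun x : Fin (n + 1) → E d => (x 0, Fin.tail x)) :=
  (MeasurableEquiv.piFinSuccAbove (fun _ : Fin (n + 1) => E d) 0).measurableEmbedding

theorem volume_fin_zero (d : ℕ) : (volume : Measure (Fin 0 → E d)) = Measure.dirac default := by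
  rw [volume_pi, Measure.pi_of_empty _ default]

namespace MomentumDensity

variable (k : MomentumDensity d)

/-- The vector `ψ(x₁) ⋯ ψ(xₙ) G`, where `G` is represented by `g`. -/
def psiVec {n : ℕ} (x : Fin n → E d) {g : Wave d} (hg : k.Nice g) : FockFin d :=
  (hg.psiProd x).isL2Wave.vec

theorem measurable_enorm_psiVec (n : ℕ) {g : Wave d} (hg : k.Nice g) :
    Measurable fun x : Fin n → E d => ‖k.psiVec x hg‖ₑ ^ 2 :=
  (k.jointlyMeasurable_psiProd hg.isL2Wave n).measurable_enorm_sq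
    fun x => (hg.psiProd x).isL2Wave

theorem stronglyMeasurable_inner_psiVec (n : ℕ) {g : Wave d} (hg : k.Nice g) (η : FockFin d) :
    StronglyMeasurable fun x : Fin n → E d => (inner ℂ η (k.psiVec x hg) : ℂ) := by
  obtain ⟨N, hN⟩ := hg.isL2Wave.fin
  exact (k.jointlyMeasurable_psiProd hg.isL2Wave n).stronglyMeasurable_inner
    (fun x => (hg.psiProd x).isL2Wave) (fun x => k.psiProd_fin hN x) η

/-- Iteration of `exists_lintegral_psi_le`, integrating over the outermost field first. -/
theorem lintegral_psiVec_lt_top {n : ℕ} {w : Fin n → E d → ℝ≥0∞} (hw : ∀ i, Measurable (w i))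
    {B : ℝ≥0∞} (hB : B ≠ ∞) (hwB : ∀ i x, w i x ≤ B) (hi : ∀ i, ∫⁻ x, w i x ≠ ∞)
    {g : Wave d} (hg : k.Nice g) :
    ∫⁻ x, (∏ i, w i (x i)) * ‖k.psiVec x hg‖ₑ ^ 2 < ∞ := by
  induction n with
  | zero =>
    rw [volume_fin_zero, lintegral_dirac]
    simp only [Finset.univ_eq_empty, Finset.prod_empty, one_mul]
    finiteness
  | succ n ih =>
    obtain ⟨N, hN⟩ := hg.isL2Wave.fin
    obtain ⟨C, hC, h⟩ := k.exists_lintegral_psi_le (hw 0).aemeasurable hB (hwB 0) (hi 0) (N + n)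
    have hm : Measurable fun x : Fin (n + 1) → E d =>
        (∏ i, w i (x i)) * ‖k.psiVec x hg‖ₑ ^ 2 :=
      (Finset.measurable_fun_prod _ fun i _ => (hw i).comp (measurable_pi_apply i)).mul
        (k.measurable_enorm_psiVec _ hg)
    have he := measurableEmbedding_consPoint d n
    obtain ⟨F, hF⟩ : ∃ F : E d × (Fin n → E d) → ℝ≥0∞, F = fun p =>
        (∏ i, w i (Fin.cons (α := fun _ => E d) p.1 p.2 i))
          * ‖k.psiVec (Fin.cons (α := fun _ => E d) p.1 p.2) hg‖ₑ ^ 2 := ⟨_, rfl⟩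
    have hF1 : ∀ x : Fin (n + 1) → E d, (∏ i, w i (x i)) * ‖k.psiVec x hg‖ₑ ^ 2
        = F (x 0, Fin.tail x) := fun x => by
      rw [hF]
      dsimp only
      rw [Fin.cons_self_tail]
    have hcons : Measurable fun p : E d × (Fin n → E d) =>
        (Fin.cons (α := fun _ => E d) p.1 p.2 : Fin (n + 1) → E d) :=
      measurable_pi_lambda _ (Fin.cases measurable_fst fun i =>
        (measurable_pi_apply i).comp measurable_snd)
    have hFm : Measurable F := by rw [hF]; exact hm.comp hcons
    simp only [hF1]
    rw [(measurePreserving_consPoint d n).lintegral_comp hFm, lintegral_prod_symm _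
      hFm.aemeasurable]
    refine lt_of_le_of_lt (lintegral_mono (g := fun t : Fin n → E d =>
      C * ((∏ i, w i.succ (t i)) * ‖k.psiVec t hg‖ₑ ^ 2)) fun t => ?_) ?_
    · have h1 : ∀ x, F (x, t) = (∏ i : Fin n, w i.succ (t i))
          * (w 0 x * ‖((hg.psiProd t).psi x).isL2Wave.vec‖ₑ ^ 2) := by
        intro x
        rw [hF]
        dsimp only
        rw [Fin.prod_univ_succ, mul_comm (w 0 _), mul_assoc]
        rfl
      have h2 : Measurable fun x => w 0 x * ‖((hg.psiProd t).psi x).isL2Wave.vec‖ₑ ^ 2 :=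
        (hw 0).mul (((jointlyMeasurable_const (hg.psiProd t).isL2Wave).psi k
          measurable_id).measurable_enorm_sq fun x => ((hg.psiProd t).psi x).isL2Wave)
      dsimp only
      simp only [h1]
      rw [lintegral_const_mul _ h2, mul_left_comm]
      exact mul_le_mul' le_rfl (h _ (hg.psiProd t) (k.psiProd_fin hN t))
    · rw [lintegral_const_mul' _ _ hC]
      exact ENNReal.mul_lt_top hC.lt_top (ih (fun i => hw i.succ) (fun i => hwB i.succ)
        fun i => hi i.succ)

/-- Absolute convergence of the integral that defines the normal-ordered product. -/
theorem integrable_psiVec {n : ℕ} (f : Fin n → 𝓢(E d, ℝ)) (R : Op d) {g h : Wave d}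
    (hg : k.Nice g) (hh : k.Nice h) :
    Integrable fun x : Fin n → E d => ((∏ i, f i (x i) : ℝ) : ℂ)
      * (inner ℂ (R.1 (k.psiVec x hg)) (k.psiVec x hh) : ℂ) := by
  obtain ⟨hR, S, -, hS⟩ := R.2
  obtain ⟨N, hN⟩ := hg.isL2Wave.fin
  obtain ⟨M, C, hC0, hC⟩ := hR (N + n)
  have hfm : Continuous fun x : Fin n → E d => ∏ i, f i (x i) :=
    continuous_finsetProd _ fun i _ => (f i).continuous.comp (continuous_apply i)
  have hinner : ∀ {g : Wave d} (hg : k.Nice g) (η : FockFin d), AEStronglyMeasurable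
      (fun x : Fin n → E d => (inner ℂ η (k.psiVec x hg) : ℂ)) volume := fun hg η =>
    (k.stronglyMeasurable_inner_psiVec n hg η).aestronglyMeasurable
  have hm : AEStronglyMeasurable (fun x : Fin n → E d =>
      (inner ℂ (R.1 (k.psiVec x hg)) (k.psiVec x hh) : ℂ)) volume := by
    refine aestronglyMeasurable_inner (fun η => ?_) (hinner hh)
    have h1 : ∀ x : Fin n → E d, (inner ℂ η (R.1 (k.psiVec x hg)) : ℂ)
        = inner ℂ (S η) (k.psiVec x hg) := fun x => by
      have h2 := congrArg conj (hS (k.psiVec x hg) η)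
      have h3 : conj (inner ℂ (R.1 (k.psiVec x hg)) η : ℂ) = inner ℂ η (R.1 (k.psiVec x hg)) :=
        inner_conj_symm _ _
      have h4 : conj (inner ℂ (k.psiVec x hg) (S η) : ℂ) = inner ℂ (S η) (k.psiVec x hg) :=
        inner_conj_symm _ _
      exact h3.symm.trans (h2.trans h4)
    simp only [h1]
    exact hinner hg (S η)
  have hfin : ∀ {g : Wave d} (hg : k.Nice g), Integrable fun x : Fin n → E d =>
      |∏ i, f i (x i)| * ‖k.psiVec x hg‖ ^ 2 := by
    intro g hg
    have hnm : Measurable fun x : Fin n → E d => ‖k.psiVec x hg‖ ^ 2 := by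
      have h1 : ∀ x : Fin n → E d, ‖k.psiVec x hg‖ ^ 2 = (‖k.psiVec x hg‖ₑ ^ 2).toReal :=
        fun x => by rw [ENNReal.toReal_pow, toReal_enorm]
      simp only [h1]
      exact (k.measurable_enorm_psiVec n hg).ennreal_toReal
    refine ⟨(hfm.abs.measurable.mul hnm).aestronglyMeasurable, ?_⟩
    have hb : ∀ i, ∃ B : ℝ, ∀ x, ‖f i x‖ ≤ B := fun i =>
      ⟨_, fun x => SchwartzMap.norm_le_seminorm ℝ (f i) x⟩
    choose B hB using hb
    have hlt := k.lintegral_psiVec_lt_top (w := fun i x => ‖f i x‖ₑ)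
      (fun i => (f i).continuous.measurable.enorm) (B := ∑ i, ENNReal.ofReal (B i))
      (ENNReal.sum_lt_top.2 fun _ _ => ENNReal.ofReal_lt_top).ne (fun i x => (by
        rw [← ofReal_norm]; exact ENNReal.ofReal_le_ofReal (hB i x) :
          ‖f i x‖ₑ ≤ ENNReal.ofReal (B i)).trans (Finset.single_le_sum
            (f := fun i => ENNReal.ofReal (B i)) (fun _ _ => zero_le) (Finset.mem_univ i)))
      (fun i => (f i).integrable.2.ne) hg
    refine lt_of_le_of_lt (le_of_eq (lintegral_congr fun x => ?_)) hlt
    rw [enorm_mul, enorm_pow, enorm_norm, ← Real.norm_eq_abs, enorm_norm]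
    congr 1
    rw [← ofReal_norm, norm_prod, ENNReal.ofReal_prod_of_nonneg fun _ _ => norm_nonneg _]
    exact Finset.prod_congr rfl fun i _ => ofReal_norm _
  refine (((hfin hg).const_mul C).add ((hfin hh).const_mul C)).mono'
    ((Complex.continuous_ofReal.comp hfm).aestronglyMeasurable.mul hm)
    (Eventually.of_forall fun x => ?_)
  have h1 : ‖(inner ℂ (R.1 (k.psiVec x hg)) (k.psiVec x hh) : ℂ)‖
      ≤ C * (‖k.psiVec x hg‖ * ‖k.psiVec x hh‖) := by
    have h2 : Below (N + n) (k.psiVec x hg) :=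
      (hg.psiProd x).isL2Wave.represents_vec.below (k.psiProd_fin hN x)
    refine (norm_inner_le_norm _ _).trans ?_
    rw [← mul_assoc]
    exact mul_le_mul_of_nonneg_right (hC _ h2).2 (norm_nonneg _)
  have h3 : ‖k.psiVec x hg‖ * ‖k.psiVec x hh‖ ≤ ‖k.psiVec x hg‖ ^ 2 + ‖k.psiVec x hh‖ ^ 2 := by
    nlinarith [sq_nonneg (‖k.psiVec x hg‖ - ‖k.psiVec x hh‖), sq_nonneg ‖k.psiVec x hg‖,
      sq_nonneg ‖k.psiVec x hh‖]
  rw [norm_mul, Complex.norm_real, Real.norm_eq_abs]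
  calc |∏ i, f i (x i)| * _ ≤ |∏ i, f i (x i)| * (C * (‖k.psiVec x hg‖ ^ 2
        + ‖k.psiVec x hh‖ ^ 2)) :=
        mul_le_mul_of_nonneg_left (h1.trans (mul_le_mul_of_nonneg_left h3 hC0)) (abs_nonneg _)
    _ = _ := by simp only [Pi.add_apply]; ring

/-- The integral over the first point turns `R` into `dress f R`, inside the fields at the
remaining points. -/
theorem exists_psiVec_succ {n : ℕ} (f : 𝓢(E d, ℝ)) (R : Op d) {g h : Wave d}
    (hg : k.Nice g) (hh : k.Nice h) :
    ∃ J : (Fin n → E d) → E d → ℂ,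
      (∀ t, ∫ x, (f x : ℂ) * J t x
        = inner ℂ ((k.dress f R).1 (k.psiVec t hg)) (k.psiVec t hh)) ∧
      ∀ x : Fin (n + 1) → E d, (inner ℂ (R.1 (k.psiVec x hg)) (k.psiVec x hh) : ℂ)
        = J (Fin.tail x) (x 0) :=
  ⟨fun t x => inner ℂ (R.1 ((hg.psiProd t).psi x).isL2Wave.vec)
    ((hh.psiProd t).psi x).isL2Wave.vec,
    fun t => k.integral_inner_comp_psi f R (hg.psiProd t) (hh.psiProd t) |>.2, fun _ => rfl⟩

/-- Integrating out the points one after the other, from the outermost to the innermost. -/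
theorem integral_psiVec {n : ℕ} (f : Fin n → 𝓢(E d, ℝ)) (l : List 𝓢(E d, ℝ)) {g h : Wave d}
    (hg : k.Nice g) (hh : k.Nice h) :
    ∫ x : Fin n → E d, ((∏ i, f i (x i) : ℝ) : ℂ)
      * (inner ℂ ((k.densProd l).1 (k.psiVec x hg)) (k.psiVec x hh) : ℂ)
      = inner ℂ ((k.densProd (List.ofFn f ++ l)).1 hg.isL2Wave.vec) hh.isL2Wave.vec := by
  induction n generalizing l with
  | zero =>
    rw [volume_fin_zero, integral_dirac]
    simp only [Finset.univ_eq_empty, Finset.prod_empty, Complex.ofReal_one, one_mul,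
      List.ofFn_zero, List.nil_append]
    rfl
  | succ n ih =>
    have hint := k.integrable_psiVec f (k.densProd l) hg hh
    obtain ⟨J, hJ1, hJ2⟩ := k.exists_psiVec_succ (f 0) (k.densProd l) hg hh (n := n)
    rw [← densProd_cons] at hJ1
    obtain ⟨F, hF⟩ : ∃ F : E d × (Fin n → E d) → ℂ, F = fun p =>
        ((∏ i : Fin n, f i.succ (p.2 i) : ℝ) : ℂ) * ((f 0 p.1 : ℂ) * J p.2 p.1) := ⟨_, rfl⟩
    have hF1 : (fun x : Fin (n + 1) → E d => ((∏ i, f i (x i) : ℝ) : ℂ)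
        * (inner ℂ ((k.densProd l).1 (k.psiVec x hg)) (k.psiVec x hh) : ℂ))
        = fun x => F (x 0, Fin.tail x) := by
      funext x
      rw [hF, Fin.prod_univ_succ, Complex.ofReal_mul, mul_comm (f 0 (x 0) : ℂ), mul_assoc, hJ2]
      rfl
    rw [hF1] at hint ⊢
    have hFi : Integrable F (volume.prod volume) :=
      ((measurePreserving_consPoint d n).integrable_comp_emb
        (measurableEmbedding_consPoint d n)).1 hint
    rw [(measurePreserving_consPoint d n).integral_comp (measurableEmbedding_consPoint d n),
      integral_prod_symm _ hFi]
    have h1 : ∀ t : Fin n → E d, ∫ x, F (x, t) = ((∏ i : Fin n, f i.succ (t i) : ℝ) : ℂ)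
        * (inner ℂ ((k.densProd (f 0 :: l)).1 (k.psiVec t hg)) (k.psiVec t hh) : ℂ) := by
      intro t
      rw [hF]
      dsimp only
      rw [integral_const_mul, hJ1]
    simp only [h1]
    have h2 : (List.ofFn (fun i : Fin n => f i.succ) ++ f 0 :: l).Perm (List.ofFn f ++ l) := by
      rw [List.ofFn_succ]
      exact List.perm_middle
    exact (ih (fun i => f i.succ) (f 0 :: l)).trans (congrArg (fun T : Op d =>
      (inner ℂ (T.1 hg.isL2Wave.vec) hh.isL2Wave.vec : ℂ)) (k.densProd_perm h2))

end MomentumDensity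

/-! ### Density of the test vectors -/

theorem eLpNorm_two_sq {α : Type*} [MeasurableSpace α] {m : Measure α} (f : α → ℂ) :
    eLpNorm f 2 m ^ 2 = ∫⁻ x, ‖f x‖ₑ ^ 2 ∂m := by
  have h := eLpNorm_nnreal_pow_eq_lintegral (μ := m) (f := f) (p := 2) two_ne_zero
  norm_num at h
  exact h

theorem tendsto_zero_of_sq {a : ℕ → ℝ≥0∞} (h : Tendsto (fun j => a j ^ 2) atTop (𝓝 0)) :
    Tendsto a atTop (𝓝 0) := by
  have h1 := h.ennrpow_const (1 / 2 : ℝ)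
  have h2 : ∀ j, (a j ^ 2) ^ (1 / 2 : ℝ) = a j := fun j => by
    rw [← ENNReal.rpow_natCast, ← ENNReal.rpow_mul]
    norm_num
  simp only [h2] at h1
  rwa [ENNReal.zero_rpow_of_pos (by norm_num)] at h1

theorem exists_schwartz_tendsto {n : ℕ} {F : (Fin n → E d) → ℂ} (hF : MemLp F 2 volume) :
    ∃ φ : ℕ → 𝓢(Fin n → E d, ℂ), Tendsto (fun j => eLpNorm (⇑(φ j) - F) 2 volume) atTop (𝓝 0) := by
  have h1 : DenseRange (SchwartzMap.toLpCLM ℝ (E := Fin n → E d) ℂ 2 volume) :=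
    SchwartzMap.denseRange_toLpCLM ENNReal.ofNat_ne_top
  obtain ⟨u, hu, hlim⟩ := mem_closure_iff_seq_limit.1 (h1 (hF.toLp F))
  choose φ hφ using hu
  refine ⟨φ, ?_⟩
  rw [Lp.tendsto_Lp_iff_tendsto_eLpNorm'] at hlim
  refine hlim.congr fun j => eLpNorm_congr_ae ?_
  rw [← hφ j]
  exact ((φ j).coeFn_toLp 2 volume).sub hF.coeFn_toLp

/-- Antisymmetrization of a function of `n` particles. -/
def antisymmetrize {n : ℕ} (f : (Fin n → X d) → ℂ) : (Fin n → X d) → ℂ := fun y =>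
  (n.factorial : ℂ)⁻¹ * ∑ σ : Equiv.Perm (Fin n), sgn σ * f (y ∘ σ)

theorem antisymmetrize_comp {n : ℕ} (f : (Fin n → X d) → ℂ) (τ : Equiv.Perm (Fin n))
    (y : Fin n → X d) : antisymmetrize f (y ∘ τ) = sgn τ * antisymmetrize f y := by
  have h : ∑ σ : Equiv.Perm (Fin n), sgn σ * f ((y ∘ τ) ∘ σ)
      = sgn τ * ∑ σ : Equiv.Perm (Fin n), sgn σ * f (y ∘ σ) := by
    rw [Finset.mul_sum, ← Equiv.sum_comp (Equiv.mulLeft τ) fun σ => sgn τ * (sgn σ * f (y ∘ σ))]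
    refine Finset.sum_congr rfl fun σ _ => ?_
    have h1 : sgn τ * (sgn (τ * σ) * f (y ∘ ⇑(τ * σ))) = sgn σ * f ((y ∘ τ) ∘ σ) := by
      rw [sgn_mul, ← mul_assoc, ← mul_assoc, sgn_mul_self, one_mul]
      rfl
    exact h1.symm
  rw [antisymmetrize, antisymmetrize, h, mul_left_comm]

theorem antisymmetrize_eq_self {n : ℕ} {F : (Fin n → X d) → ℂ}
    (hF : ∀ (σ : Equiv.Perm (Fin n)) (y : Fin n → X d), F (y ∘ σ) = sgn σ * F y) :
    antisymmetrize F = F := by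
  funext y
  have h1 : ∀ σ : Equiv.Perm (Fin n), sgn σ * F (y ∘ σ) = F y := fun σ => by
    rw [hF, ← mul_assoc, sgn_mul_self, one_mul]
  simp only [antisymmetrize, h1, Finset.sum_const, Finset.card_univ, Fintype.card_perm,
    Fintype.card_fin, nsmul_eq_mul]
  rw [← mul_assoc, inv_mul_cancel₀ (Nat.cast_ne_zero.2 n.factorial_ne_zero), one_mul]

theorem antisymmetrize_sub {n : ℕ} (f h : (Fin n → X d) → ℂ) :
    antisymmetrize (f - h) = antisymmetrize f - antisymmetrize h := by
  funext y
  simp only [antisymmetrize, Pi.sub_apply, mul_sub, Finset.sum_sub_distrib]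

theorem eLpNorm_antisymmetrize_le {n : ℕ} {f : (Fin n → X d) → ℂ} (hf : StronglyMeasurable f) :
    eLpNorm (antisymmetrize f) 2 (μ d n) ≤ n.factorial * eLpNorm f 2 (μ d n) := by
  have h1 : antisymmetrize f = ∑ σ : Equiv.Perm (Fin n),
      ((n.factorial : ℂ)⁻¹ * sgn σ) • fun y : Fin n → X d => f (y ∘ σ) := by
    funext y
    simp only [antisymmetrize, Finset.sum_apply, Pi.smul_apply, smul_eq_mul, Finset.mul_sum,
      mul_assoc]
  have hm : ∀ σ : Equiv.Perm (Fin n), StronglyMeasurable fun y : Fin n → X d => f (y ∘ σ) :=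
    fun σ => hf.comp_measurable (measurePreserving_perm d n σ).measurable
  rw [h1]
  refine (eLpNorm_sum_le (fun σ _ => ((hm σ).const_smul _).aestronglyMeasurable)
    one_le_two).trans ?_
  have h2 : ∀ σ ∈ (Finset.univ : Finset (Equiv.Perm (Fin n))),
      eLpNorm (((n.factorial : ℂ)⁻¹ * sgn σ) • fun y : Fin n → X d => f (y ∘ σ)) 2 (μ d n)
        ≤ eLpNorm f 2 (μ d n) := by
    intro σ _
    have h3 : eLpNorm (fun y : Fin n → X d => f (y ∘ σ)) 2 (μ d n) = eLpNorm f 2 (μ d n) :=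
      eLpNorm_comp_measurePreserving hf.aestronglyMeasurable (measurePreserving_perm d n σ)
    have h4 : ‖(n.factorial : ℂ)⁻¹ * sgn σ‖ₑ ≤ 1 := by
      rw [← ofReal_norm, norm_mul, norm_sgn, mul_one, norm_inv, Complex.norm_natCast]
      refine ENNReal.ofReal_le_one.2 (inv_le_one_of_one_le₀ ?_)
      exact_mod_cast n.factorial_pos
    rw [eLpNorm_const_smul, h3]
    exact mul_le_of_le_one_left zero_le h4
  refine (Finset.sum_le_card_nsmul _ _ _ h2).trans (le_of_eq ?_)
  rw [Finset.card_univ, Fintype.card_perm, Fintype.card_fin, nsmul_eq_mul]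

/-- Antisymmetrization preserves Schwartz functions and is bounded on `L²`, so approximations may
be taken antisymmetric. -/
theorem exists_test_tendsto {n : ℕ} {F : (Fin n → X d) → ℂ} (hm : StronglyMeasurable F)
    (hF : MemLp F 2 (μ d n))
    (ha : ∀ (σ : Equiv.Perm (Fin n)) (y : Fin n → X d), F (y ∘ σ) = sgn σ * F y) :
    ∃ f : ℕ → (Fin n → X d) → ℂ,
      (∀ j, (∀ s : Fin n → Fin 2, ∃ φ : 𝓢(Fin n → E d, ℂ), ∀ y, f j (fun i => (s i, y i)) = φ y) ∧
        ∀ (σ : Equiv.Perm (Fin n)) (y : Fin n → X d), f j (y ∘ σ) = sgn σ * f j y) ∧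
      Tendsto (fun j => eLpNorm (f j - F) 2 (μ d n)) atTop (𝓝 0) := by
  have hms : ∀ s : Fin n → Fin 2, StronglyMeasurable fun y => F (withLabels s y) := fun s =>
    hm.comp_measurable (measurable_withLabels s)
  have hs : ∀ s : Fin n → Fin 2, MemLp (fun y => F (withLabels s y)) 2 volume := by
    intro s
    refine memLp_two_of_lintegral (hms s).aestronglyMeasurable (lt_of_le_of_lt ?_
      (lintegral_enorm_sq_lt_top hF))
    rw [lintegral_eq_sum (hm.enorm.pow_const 2)]
    exact Finset.single_le_sum (f := fun s => ∫⁻ y, ‖F (withLabels s y)‖ₑ ^ 2)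
      (fun _ _ => zero_le) (Finset.mem_univ s)
  choose φ hφ using fun s => exists_schwartz_tendsto (hs s)
  obtain ⟨f, hf⟩ : ∃ f : ℕ → (Fin n → X d) → ℂ,
    f = fun j y => φ (fun i => (y i).1) j fun i => (y i).2 := ⟨_, rfl⟩
  have hfs : ∀ j s y, f j (withLabels s y) = φ s j y := fun j s y => by rw [hf]; rfl
  have hfm : ∀ j, StronglyMeasurable (f j) := fun j =>
    stronglyMeasurable_of_withLabels fun s => by
      simp only [hfs]
      exact (φ s j).continuous.stronglyMeasurable
  refine ⟨fun j => antisymmetrize (f j), fun j => ⟨fun s => ?_, antisymmetrize_comp (f j)⟩, ?_⟩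
  · refine ⟨(n.factorial : ℂ)⁻¹ • ∑ σ : Equiv.Perm (Fin n), sgn σ •
      SchwartzMap.compCLMOfContinuousLinearEquiv ℂ
        (LinearEquiv.funCongrLeft ℝ (E d) σ).toContinuousLinearEquiv (φ (s ∘ σ) j), fun y => ?_⟩
    rw [_root_.smul_apply, _root_.sum_apply]
    refine congrArg (_ * ·) (Finset.sum_congr rfl fun σ _ => ?_)
    exact congrArg (sgn σ * ·) (hfs j (s ∘ σ) (y ∘ σ))
  · have h1 : ∀ j, antisymmetrize (f j) - F = antisymmetrize (f j - F) := fun j => by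
      rw [antisymmetrize_sub, antisymmetrize_eq_self ha]
    have h2 : Tendsto (fun j => eLpNorm (f j - F) 2 (μ d n)) atTop (𝓝 0) := by
      refine tendsto_zero_of_sq ?_
      have h3 : ∀ j, eLpNorm (f j - F) 2 (μ d n) ^ 2
          = ∑ s, eLpNorm (⇑(φ s j) - fun y => F (withLabels s y)) 2 volume ^ 2 := by
        intro j
        simp only [eLpNorm_two_sq]
        rw [lintegral_eq_sum (((hfm j).sub hm).enorm.pow_const 2)]
        simp only [Pi.sub_apply, hfs]
      simp only [h3]
      have h0 : (0 : ℝ≥0∞) = ∑ _s : Fin n → Fin 2, 0 := by rw [Finset.sum_const_zero]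
      conv => arg 3; rw [h0]
      refine tendsto_finsetSum _ fun s _ => ?_
      have h4 := ENNReal.Tendsto.pow (n := 2) (hφ s)
      rwa [zero_pow two_ne_zero] at h4
    have h5 := ENNReal.Tendsto.const_mul (a := (n.factorial : ℝ≥0∞)) h2
      (Or.inr (ENNReal.natCast_ne_top _))
    rw [mul_zero] at h5
    refine tendsto_of_tendsto_of_tendsto_of_le_of_le tendsto_const_nhds h5 (fun _ => zero_le)
      fun j => ?_
    dsimp only
    rw [h1]
    exact eLpNorm_antisymmetrize_le ((hfm j).sub hm)

/-- Every vector is a limit of test vectors in the topology of the finite-particle space. -/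
theorem exists_isTest_tendsto (G : FockFin d) :
    ∃ (g : ℕ → Wave d) (u : ℕ → FockFin d), (∀ j, IsTest (g j)) ∧ (∀ j, Represents (g j) (u j)) ∧
      FinTendsto u G := by
  have hL := isL2Wave_rep G
  obtain ⟨N, hN⟩ := hL.fin
  choose f hf hlim using fun n => exists_test_tendsto (hL.meas n) (hL.memLp n) (hL.anti n)
  obtain ⟨g, hg⟩ : ∃ g : ℕ → Wave d, g = fun j n => if n < N then f n j else 0 := ⟨_, rfl⟩
  have hg1 : ∀ j n, n < N → g j n = f n j := fun j n h => by rw [hg]; exact if_pos h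
  have hg0 : ∀ j n, N ≤ n → g j n = 0 := fun j n h => by rw [hg]; exact if_neg h.not_gt
  have htest : ∀ j, IsTest (g j) := by
    refine fun j => ⟨⟨N, hg0 j⟩, fun n => ?_⟩
    rcases lt_or_ge n N with h | h
    · rw [hg1 j n h]; exact hf n j
    · rw [hg0 j n h]; exact ⟨fun s => ⟨0, fun _ => rfl⟩, fun _ _ => (mul_zero _).symm⟩
  have hrep := fun j => (htest j).isL2Wave.represents_vec
  refine ⟨g, fun j => (htest j).isL2Wave.vec, htest, hrep,
    ⟨N, fun j => (hrep j).below (hg0 j)⟩, fun n => ?_⟩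
  rw [tendsto_subtype_rng, Lp.tendsto_Lp_iff_tendsto_eLpNorm']
  rcases lt_or_ge n N with h | h
  · refine (hlim n).congr fun j => eLpNorm_congr_ae ?_
    rw [← hg1 j n h]
    exact ((hrep j n).sub (represents_rep G n)).symm
  · refine tendsto_const_nhds.congr fun j => ?_
    rw [← eLpNorm_zero (α := Fin n → X d) (ε := ℂ) (p := 2) (μ := μ d n)]
    refine eLpNorm_congr_ae ?_
    have h1 := (hrep j n).sub (represents_rep G n)
    rw [hg0 j n h, hN n h, sub_zero] at h1
    exact h1.symm

/-! ### Existence and uniqueness of the operator-valued integrals -/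

theorem tendsto_inner_of_finTendsto {u : ℕ → FockFin d} {v : FockFin d} (h : FinTendsto u v)
    (K : FockFin d) : Tendsto (fun j => (inner ℂ K (u j) : ℂ)) atTop (𝓝 (inner ℂ K v)) :=
  (continuous_const.inner continuous_id).continuousAt.tendsto.comp h.tendsto

theorem FinTendsto.unique {u : ℕ → FockFin d} {v w : FockFin d} (h : FinTendsto u v)
    (h' : FinTendsto u w) : v = w := by
  ext n : 3
  exact tendsto_nhds_unique (h.2 n) (h'.2 n)

/-- The form on test vectors determines the operator, as test vectors are sequentially dense and
the operator is sequentially continuous. -/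
theorem IsWeakIntegral.unique {ι : Type} [MeasureSpace ι] {w : ι → ℝ} {A : ι → Wave d → GenVec d}
    {T T' : FockFin d →ₗ[ℂ] FockFin d} (h : IsWeakIntegral w A T) (h' : IsWeakIntegral w A T') :
    T = T' := by
  have htest : ∀ g G, IsTest g → Represents g G → T G = T' G := by
    intro g G hg hG
    refine eq_of_forall_inner fun K => ?_
    obtain ⟨g', u, hg', hu, hlim⟩ := exists_isTest_tendsto K
    refine tendsto_nhds_unique (tendsto_inner_of_finTendsto hlim (T G)) ?_
    refine (tendsto_inner_of_finTendsto hlim (T' G)).congr fun j => ?_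
    exact (h'.2 g (g' j) G (u j) hg (hg' j) hG (hu j)).2.trans
      (h.2 g (g' j) G (u j) hg (hg' j) hG (hu j)).2.symm
  refine LinearMap.ext fun G => ?_
  obtain ⟨g, u, hg, hu, hlim⟩ := exists_isTest_tendsto G
  have h1 : (fun j => T (u j)) = fun j => T' (u j) :=
    funext fun j => htest (g j) (u j) (hg j) (hu j)
  have h2 := h.1 u G hlim
  rw [h1] at h2
  exact h2.unique (h'.1 u G hlim)

theorem IsWeakIntegral.weakIntegral_eq {ι : Type} [MeasureSpace ι] {w : ι → ℝ}
    {A : ι → Wave d → GenVec d} {T : FockFin d →ₗ[ℂ] FockFin d} (h : IsWeakIntegral w A T) :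
    weakIntegral w A = T := by
  have hex : ∃ T, IsWeakIntegral w A T := ⟨T, h⟩
  rw [weakIntegral, dif_pos hex]
  exact hex.choose_spec.unique h

namespace MomentumDensity

variable (k : MomentumDensity d)

theorem isWeakIntegral_rhoAt (f : 𝓢(E d, ℝ)) :
    IsWeakIntegral (fun x => f x) k.rhoAt (k.densProd [f]).1 := by
  refine ⟨(k.densProd [f]).2.1.finContinuous, fun g₁ g₂ G₁ G₂ h₁ h₂ hG₁ hG₂ => ?_⟩
  have hg := Nice.test (k := k) h₁
  have hh := Nice.test (k := k) h₂
  rw [hG₁.eq_vec hg.isL2Wave, hG₂.eq_vec hh.isL2Wave]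
  have h := k.integral_inner_comp_psi f (k.densProd []) hg hh
  have h1 : (fun x => (f x : ℂ) * k.rhoAt x g₁ g₂) = fun x => (f x : ℂ)
      * (inner ℂ ((k.densProd []).1 (hg.psi x).isL2Wave.vec) (hh.psi x).isL2Wave.vec : ℂ) :=
    funext fun x => congrArg ((f x : ℂ) * ·) (k.normalOrdered_eq (fun _ : Fin 1 => x) hg hh)
  rw [h1]
  exact ⟨h.1, h.2.symm⟩

/-- The operator `densProd` is the smeared normal-ordered product. -/
theorem isWeakIntegral_normalOrdered {n : ℕ} (f : Fin n → 𝓢(E d, ℝ)) :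
    IsWeakIntegral (fun x => ∏ i, f i (x i)) (k.normalOrdered n) (k.densProd (List.ofFn f)).1 := by
  refine ⟨(k.densProd (List.ofFn f)).2.1.finContinuous, fun g₁ g₂ G₁ G₂ h₁ h₂ hG₁ hG₂ => ?_⟩
  have hg := Nice.test (k := k) h₁
  have hh := Nice.test (k := k) h₂
  rw [hG₁.eq_vec hg.isL2Wave, hG₂.eq_vec hh.isL2Wave]
  have h1 : (fun x : Fin n → E d => ((∏ i, f i (x i) : ℝ) : ℂ) * k.normalOrdered n x g₁ g₂)
      = fun x => ((∏ i, f i (x i) : ℝ) : ℂ)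
        * (inner ℂ ((k.densProd []).1 (k.psiVec x hg)) (k.psiVec x hh) : ℂ) :=
    funext fun x => congrArg (((∏ i, f i (x i) : ℝ) : ℂ) * ·) (k.normalOrdered_eq x hg hh)
  rw [h1]
  refine ⟨k.integrable_psiVec f (k.densProd []) hg hh, ?_⟩
  have h2 := k.integral_psiVec f [] hg hh
  rw [List.append_nil] at h2
  exact h2.symm

theorem rho_eq_densProd (f : 𝓢(E d, ℝ)) : k.rho f = (k.densProd [f]).1 :=
  (k.isWeakIntegral_rhoAt f).weakIntegral_eq

end MomentumDensity

end FermiGas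

end

theorem proposition3p1 (d : ℕ) (k : FermiGas.MomentumDensity d) :
    (∀ f : SchwartzMap (FermiGas.E d) ℝ,
      ∃! T, FermiGas.IsWeakIntegral (fun x => f x) k.rhoAt T) ∧
    ∀ n : ℕ, 1 ≤ n → ∀ f : Fin n → SchwartzMap (FermiGas.E d) ℝ,
      (∃! T, FermiGas.IsWeakIntegral (fun x => ∏ i, f i (x i)) (k.normalOrdered n) T) ∧
      k.wick n f = FermiGas.weakIntegral (fun x => ∏ i, f i (x i)) (k.normalOrdered n) := by
  refine ⟨fun f => ⟨_, k.isWeakIntegral_rhoAt f, fun T hT => hT.unique (k.isWeakIntegral_rhoAt f)⟩,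
    fun n hn f => ?_⟩
  have h := k.isWeakIntegral_normalOrdered f
  refine ⟨⟨_, h, fun T hT => hT.unique h⟩, ?_⟩
  obtain ⟨m, rfl⟩ : ∃ m, n = m + 1 := ⟨n - 1, by omega⟩
  rw [k.wick_eq_densProd k.rho_eq_densProd m f, h.weakIntegral_eq]
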